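/- **Setting.** Let $r=(r_1\ge r_2\ge\dots)$ be a partition of $n$, let $r:=r_1$, and let $k_1\ge\dots\ge k_r$ be the parts of the conjugate partition. Let $A\in\mathbb R^{n\times n}$ be a matrix in real Weyr canonical form: $A$ is block diagonal, with one block for each of finitely many distinct real eigenvalues $\lambda$ and one for each of finitely many distinct pairs $a\pm bi$ ($b\ne0$) of conjugate eigenvalues. The block of a real eigenvalue with Weyr characteristic $w=(w_1\ge\dots\ge w_m\ge 1)$ has diagonal blocks $\lambda I_{w_1},\dots,\lambda I_{w_m}$, blocks $\left[\begin{smallmatrix}I_{w_{j+1}}\\0\end{smallmatrix}\right]$ immediately above the diagonal, and zeros elsewhere; for a conjugate pair each entry $a+bi$, $1$, $0$ of the analogous complex matrix is replaced by $\left[\begin{smallmatrix}a&b\\-b&a\end{smallmatrix}\right]$, $I_2$, $0$. Let $\widetilde{\mathcal C}_A$ be the group of invertible matrices that commute with $A$, and let $N$ be the dimension of the algebra of all matrices that commute with $A$. For $Z\in\mathbb R^{r\times n}$ let $P(Z)\in\mathbb R^{n\times n}$ be the truncated observability matrix, with successive blocks $P_1,P_2,\dots$ of $r_1,r_2,\dots$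 rows, where $P_i$ consists of the first $r_i$ rows of $ZA^{i-1}$ (so $P_1=Z$). Let $\mathcal P_{(A;r)}$ be the set of the nonsingular $P(Z)$, an open subset of the linear space $\{P(Z)\}\cong\mathbb R^{r\times n}$. The group $\widetilde{\mathcal C}_A$ acts on it by $P\mapsto PX$; let $\pi:\mathcal P_{(A;r)}\to\mathcal P_{(A;r)}/\widetilde{\mathcal C}_A$ be the projection to the orbit space, with the quotient topology. **Multi-indices.** For a matrix whose entries are arranged in pairs $(z_1,z_2)$ of columns, let $\diamond$ denote the replacement of each pair by $\left[\begin{smallmatrix}z_1&z_2\\-z_2&z_1\end{smallmatrix}\right]$. For a block of $A$ with Weyr characteristic $w=(w_1,\dots,w_m)$ put $\tau_j=w_{m-j+1}$, $\tau_0=0$. An index sequence for this block is a chain $I_1\subseteq\dots\subseteq I_m$, where $I_j$ is a sequence of $\tau_j$ distinct elements of $\{1,\dots,r\}$ that starts with $I_{j-1}$ and continues with increasing indices. Divide the columns of $Z$ that belong to the block as $[Z_1\ \cdots\ Z_m]$, with $w_1,\dots,w_m$ columns (pairs of columns, for a conjugate pair of eigenvalues). The chain is *admissible* for $P(Z)$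 if for all $j$ the matrix formed by the rows $I_j$ and the first $\tau_j$ columns (pairs of columns) of $Z_1$ is invertible (after applying $\diamond$, for a conjugate pair). A *multi-index* $I$ is a choice of an index sequence for each block of $A$; it is a multi-index of $P(Z)$ if each of them is admissible for it. Let $V_I\subseteq\mathcal P_{(A;r)}$ be the set of the matrices of which $I$ is a multi-index, and $\widetilde V_I=\pi(V_I)$. **Reduced forms.** For each block of $A$, divide the rows $I_m$ into the groups $I_i\setminus I_{i-1}$ ($1\le i\le m$), and divide the columns (pairs) of each $Z_j$ into the groups with positions $\tau_{k-1}+1,\dots,\tau_k$. $P(Z)$ is in *reduced form* with respect to $I$ if for each block of $A$ the submatrix of the rows $I_m$ satisfies the following, for conjugate pairs after applying $\diamond$: in $Z_1$, the $(i,k)$ subblocks are $I$ for $k=i$ and $0$ for $k>i$; in $Z_j$ with $j\ge2$, the $(i,k)$ subblocks with $k\ge i-j+1$ are $0$. All other entries of $Z$ (including all those in rows outside $I_m$) are free. Given an enumeration of the free entries of $Z$, let $\nu_I(x)=P(Z)$ be the matrix for which these conditions hold and the free entries of $Z$ are the coordinates of $x$. Let $W_I$ be the set of the parameters $x$ for which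 $\nu_I(x)$ is nonsingular. **The pole assignment problem.** Let $l\ge 0$ and let $(F,G)$, $G=[G_1\ 0]\in\mathbb R^{n\times(r+l)}$, be the pair in $p$-Brunovsky form with Brunovsky indices $r_1\ge r_2\ge\cdots$: with respect to blocks of sizes $r_1,r_2,\dots$, the matrix $F$ has the blocks $\left[\begin{smallmatrix}I_{r_{i+1}}\\0\end{smallmatrix}\right]$ immediately above the diagonal and zeros elsewhere, and in the $i$-th block of rows of $G_1\in\mathbb R^{n\times r}$ the last $r_i-r_{i+1}$ rows are those of $I_r$ with the same numbers, the others being $0$. Let $\mathcal H_{(F,G_1)}$ and $\mathcal H_{(F,G)}$ be the sets of the matrices $K_1\in\mathbb R^{r\times n}$ and $K\in\mathbb R^{(r+l)\times n}$, respectively, such that $F+G_1K_1$ and $F+GK$ are similar to $A$. Let $$\varphi:\mathcal P_{(A;r)}/\widetilde{\mathcal C}_A\to\mathbb R^{r\times n},\qquad \varphi(\pi(P))=\begin{bmatrix}p_1A^{k_1}\\ \vdots\\ p_rA^{k_r}\end{bmatrix}P^{-1},$$ where $p_1,\dots,p_r$ are the first $r$ rows of $P$ (this is well defined). A map between subsets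 of Euclidean spaces is called smooth if it extends locally to a smooth map on an open set, and such a map is a diffeomorphism if it is bijective and it and its inverse are smooth. **Theorem.** The orbit space $\mathcal P_{(A;r)}/\widetilde{\mathcal C}_A$ is Hausdorff and second countable, and it has a structure of a smooth manifold of dimension $nr-N$ for which $\pi$ is a submersion. For every multi-index $I$, there are exactly $nr-N$ free entries, so that $W_I\subseteq\mathbb R^{nr-N}$; and for each enumeration of these entries: 1. $W_I$ is open, $\nu_I$ maps it bijectively onto the set of the nonsingular matrices $P(Z)$ in reduced form with respect to $I$, $\widetilde V_I$ is open in the orbit space, and for every such manifold structure $$\psi_I:W_I\to\widetilde V_I,\qquad x\mapsto\pi(\nu_I(x)),$$ is a diffeomorphism. 2. $\varphi(\widetilde V_I)$ is an open subset of $\mathcal H_{(F,G_1)}$, and $\alpha_I=\varphi\circ\psi_I:W_I\to\varphi(\widetilde V_I)$ is a diffeomorphism. 3. The set $\left\{\left[\begin{smallmatrix}K_1\\K_2\end{smallmatrix}\right]:K_1\in\varphi(\widetilde V_I),\ K_2\in\mathbb R^{l\times n}\right\}$ is an open subset of $\mathcal H_{(F,G)}$, and $(x,K_2)\mapsto\left[\begin{smallmatrix}\alpha_I(x)\\K_2\end{smallmatrix}\right]$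 is a diffeomorphism of $W_I\times\mathbb R^{l\times n}$ onto it. The sets $\widetilde V_I$ cover the orbit space, the sets $\varphi(\widetilde V_I)$ cover $\mathcal H_{(F,G_1)}$, and the sets in 3 cover $\mathcal H_{(F,G)}$, with $I$ ranging over all multi-indices. -/

import Mathlib

open Set Matrix
open scoped Manifold ContDiff Matrix.Norms.Elementwise

noncomputable section

namespace FeedbackParam

/-! ### Partitions

A partition is a Young diagram `μ`; its parts are `μ.rowLen 0 ≥ μ.rowLen 1 ≥ …`, the parts of the
conjugate partition are `μ.colLen 0 ≥ μ.colLen 1 ≥ …`, and `μ.card` is the number partitioned.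
Counting from `0`, a cell `(i, a)` (where `a < μ.rowLen i`) stands for the `a`-th index of the
`i`-th block in a vector that is split in blocks of sizes `μ.rowLen 0, μ.rowLen 1, …`. -/

/-- The cells of a Young diagram, used as an index type. -/
abbrev Cell (μ : YoungDiagram) : Type := {c : ℕ × ℕ // c ∈ μ.cells}

theorem Cell.snd_lt {μ : YoungDiagram} (c : Cell μ) : c.1.2 < μ.rowLen 0 :=
  lt_of_lt_of_le (YoungDiagram.mem_iff_lt_rowLen.1 ((YoungDiagram.mem_cells (μ := μ) _).1 c.2))
    (μ.rowLen_anti 0 c.1.1 (Nat.zero_le _))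

/-- The position `a` of a cell `(i, a)` inside its block. -/
def Cell.pos {μ : YoungDiagram} (c : Cell μ) : Fin (μ.rowLen 0) := ⟨c.1.2, c.snd_lt⟩

/-- The cell `(0, a)` of the first block. -/
def topCell (μ : YoungDiagram) (a : Fin (μ.rowLen 0)) : Cell μ :=
  ⟨(0, a.1), (YoungDiagram.mem_cells (μ := μ) _).2 (YoungDiagram.mem_iff_lt_rowLen.2 a.2)⟩

/-! ### Real Weyr canonical forms -/

/-- The block `[[a, b], [-b, a]]` of the complex number `a + b i`. -/
def rotBlock (z : ℂ) : Matrix (Fin 2) (Fin 2) ℝ := !![z.re, z.im; -z.im, z.re]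

/-- The Weyr block of a real eigenvalue `a` with Weyr characteristic `w`: diagonal blocks `a I`, and
`[I; 0]` as blocks immediately above the diagonal. -/
def weyrBlock (w : YoungDiagram) (a : ℝ) : Matrix (Cell w) (Cell w) ℝ :=
  Matrix.of fun c d => if c = d then a else if d.1 = (c.1.1 + 1, c.1.2) then 1 else 0

/-- The real Weyr block of a pair of conjugate nonreal eigenvalues `z`, `conj z` with common Weyr
characteristic `w`: each scalar entry of the Weyr block is replaced by a `2 × 2` block. -/
def weyrBlockPair (w : YoungDiagram) (z : ℂ) : Matrix (Cell w × Fin 2) (Cell w × Fin 2) ℝ :=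
  Matrix.of fun c d =>
    if c.1 = d.1 then rotBlock z c.2 d.2
    else if d.1.1 = (c.1.1.1 + 1, c.1.1.2) then (1 : Matrix (Fin 2) (Fin 2) ℝ) c.2 d.2 else 0

/-- The data of a real Weyr canonical form: distinct real eigenvalues, distinct pairs of conjugate
nonreal eigenvalues, and a (nonempty) Weyr characteristic for each of them. -/
structure WeyrData where
  p : ℕ
  q : ℕ
  realEig : Fin p → ℝ
  realEig_injective : Function.Injective realEig
  realWeyr : Fin p → YoungDiagram
  realWeyr_ne : ∀ i, realWeyr i ≠ ⊥
  cplxEig : Fin q → ℂ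
  cplxEig_im : ∀ j, (cplxEig j).im ≠ 0
  cplxEig_injective : Function.Injective cplxEig
  cplxEig_conj : ∀ i j, cplxEig i ≠ starRingEnd ℂ (cplxEig j)
  cplxWeyr : Fin q → YoungDiagram
  cplxWeyr_ne : ∀ j, cplxWeyr j ≠ ⊥

/-- The index set of the rows and columns of the real Weyr canonical form. -/
abbrev WeyrData.Idx (D : WeyrData) : Type :=
  (Σ i : Fin D.p, Cell (D.realWeyr i)) ⊕ (Σ j : Fin D.q, Cell (D.cplxWeyr j) × Fin 2)

/-- The real Weyr canonical form. -/
def WeyrData.mat (D : WeyrData) : Matrix D.Idx D.Idx ℝ :=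
  Matrix.fromBlocks
    (Matrix.blockDiagonal' fun i => weyrBlock (D.realWeyr i) (D.realEig i)) 0 0
    (Matrix.blockDiagonal' fun j => weyrBlockPair (D.cplxWeyr j) (D.cplxEig j))

/-- `N`, the dimension of the centralizer of the real Weyr canonical form. -/
def WeyrData.centDim (D : WeyrData) : ℕ :=
  Module.finrank ℝ (Subalgebra.centralizer ℝ ({D.mat} : Set (Matrix D.Idx D.Idx ℝ)))

/-! ### Truncated observability matrices and their orbit space -/

section Orbit

variable {ι : Type} [Fintype ι] [DecidableEq ι]

/-- The first block `P₁` of rows of `P`. -/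
def topRows {μ : YoungDiagram} (P : Matrix (Cell μ) ι ℝ) : Matrix (Fin (μ.rowLen 0)) ι ℝ :=
  P.submatrix (topCell μ) id

/-- The truncated observability matrix with first block of rows `Z`: its row `(i, a)` is the `a`-th
row of `Z A ^ i`. -/
def observability (μ : YoungDiagram) (A : Matrix ι ι ℝ) (Z : Matrix (Fin (μ.rowLen 0)) ι ℝ) :
    Matrix (Cell μ) ι ℝ :=
  Matrix.of fun c => (Z * A ^ c.1.1) c.pos

theorem topRows_observability (μ : YoungDiagram) (A : Matrix ι ι ℝ)
    (Z : Matrix (Fin (μ.rowLen 0)) ι ℝ) : topRows (observability μ A Z) = Z := by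
  ext a j
  simp [topRows, observability, topCell, Cell.pos]

/-- The linear space of all truncated observability matrices with state matrix `A`. (Its elements
are written as functions, to have the usual norm and topology of coordinates on it; `toMat` reads
them as matrices.) -/
def truncSpace (μ : YoungDiagram) (A : Matrix ι ι ℝ) : Submodule ℝ (Cell μ → ι → ℝ) where
  carrier := {P | Matrix.of P = observability μ A (topRows (Matrix.of P))}
  add_mem' := by
    intro P P' hP hP'
    have h : observability μ A (topRows (Matrix.of (P + P'))) =
        observability μ A (topRows (Matrix.of P)) + observability μ A (topRows (Matrix.of P')) := by
      ext c j
      have e : topRows (Matrix.of (P + P')) = topRows (Matrix.of P) + topRows (Matrix.of P') := rfl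
      simp [observability, e, Matrix.add_mul]
    rw [mem_ofPred_eq, h, ← hP, ← hP']
    rfl
  zero_mem' := by
    have e : topRows (Matrix.of (0 : Cell μ → ι → ℝ)) = 0 := rfl
    rw [mem_ofPred_eq, e]
    ext c j
    simp [observability]
  smul_mem' := by
    intro t P hP
    have h : observability μ A (topRows (Matrix.of (t • P))) =
        t • observability μ A (topRows (Matrix.of P)) := by
      ext c j
      have e : topRows (Matrix.of (t • P)) = t • topRows (Matrix.of P) := rfl
      simp [observability, e]
    rw [mem_ofPred_eq, h, ← hP]
    rfl

/-- An element of `truncSpace`, as a matrix. -/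
def toMat {μ : YoungDiagram} {A : Matrix ι ι ℝ} (P : truncSpace μ A) : Matrix (Cell μ) ι ℝ :=
  Matrix.of P.1

/-- A truncated observability matrix, as an element of the linear space of these matrices. -/
def truncOf (μ : YoungDiagram) (A : Matrix ι ι ℝ) (Z : Matrix (Fin (μ.rowLen 0)) ι ℝ) :
    truncSpace μ A :=
  ⟨fun c j => observability μ A Z c j, by
    change observability μ A Z = observability μ A (topRows (observability μ A Z))
    rw [topRows_observability]⟩

theorem toMat_truncOf (μ : YoungDiagram) (A : Matrix ι ι ℝ)
    (Z : Matrix (Fin (μ.rowLen 0)) ι ℝ) : toMat (truncOf μ A Z) = observability μ A Z := rfl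

theorem rank_eq_card_iff {κ : Type} [Fintype κ] (P : Matrix κ ι ℝ) :
    P.rank = Fintype.card ι ↔ (Pᵀ * P).det ≠ 0 := by
  rw [← Matrix.rank_transpose_mul_self]
  constructor
  · intro h hdet
    obtain ⟨v, hv, hv0⟩ := Matrix.exists_mulVec_eq_zero_iff.2 hdet
    have h1 := LinearMap.finrank_range_add_finrank_ker (Pᵀ * P).mulVecLin
    rw [← Matrix.rank, h, Module.finrank_fintype_fun_eq_card] at h1
    have h2 : LinearMap.ker (Pᵀ * P).mulVecLin = ⊥ := by
      apply Submodule.finrank_eq_zero.1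
      omega
    have h3 : v ∈ LinearMap.ker (Pᵀ * P).mulVecLin := hv0
    rw [h2] at h3
    exact hv ((Submodule.mem_bot ℝ).1 h3)
  · intro h
    exact Matrix.rank_of_isUnit _ ((Matrix.isUnit_iff_isUnit_det _).2 h.isUnit)

/-- The open set of the truncated observability matrices of full column rank in the linear space of
all truncated observability matrices. -/
def fullRank (μ : YoungDiagram) (A : Matrix ι ι ℝ) : TopologicalSpace.Opens (truncSpace μ A) where
  carrier := {P | (toMat P).rank = Fintype.card ι}
  is_open' := by
    simp only [rank_eq_card_iff, toMat]
    apply isOpen_ne_fun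
    · fun_prop
    · fun_prop

/-- The group of the invertible matrices that commute with `A`. -/
def centGroup (A : Matrix ι ι ℝ) : Subgroup (Matrix ι ι ℝ)ˣ where
  carrier := {X | X.1 * A = A * X.1}
  mul_mem' := by
    intro X Y hX hY
    exact Commute.mul_left (show Commute X.1 A from hX) (show Commute Y.1 A from hY)
  one_mem' := by simp
  inv_mem' := by
    intro X hX
    exact Commute.units_inv_left (show Commute (X : Matrix ι ι ℝ) A from hX)

/-- Two matrices are equivalent if they are in the same orbit of the action `(X, P) ↦ P X` of the
invertible matrices that commute with `A`. -/
def orbitSetoid (μ : YoungDiagram) (A : Matrix ι ι ℝ) : Setoid (fullRank μ A) where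
  r P P' := ∃ X ∈ centGroup A, toMat P'.1 = toMat P.1 * X.1
  iseqv :=
    { refl := fun P => ⟨1, one_mem _, by simp⟩
      symm := by
        rintro P P' ⟨X, hX, h⟩
        refine ⟨X⁻¹, inv_mem hX, ?_⟩
        rw [h, Matrix.mul_assoc, ← Units.val_mul, mul_inv_cancel, Units.val_one, Matrix.mul_one]
      trans := by
        rintro P P' P'' ⟨X, hX, h⟩ ⟨Y, hY, h'⟩
        refine ⟨X * Y, mul_mem hX hY, ?_⟩
        rw [h', h, Matrix.mul_assoc, Units.val_mul] }

/-- The orbit space, with the quotient topology. -/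
abbrev OrbitSpace (μ : YoungDiagram) (A : Matrix ι ι ℝ) : Type := Quotient (orbitSetoid μ A)

/-- The projection of a matrix to its orbit. -/
def orbitMk (μ : YoungDiagram) (A : Matrix ι ι ℝ) (P : fullRank μ A) : OrbitSpace μ A :=
  Quotient.mk (orbitSetoid μ A) P

/-- `cs` is a smooth manifold structure on the orbit space (whose topology is the quotient
topology), modelled on `E`, such that the projection to the orbit space is a smooth submersion. -/
def IsOrbitManifold (μ : YoungDiagram) (A : Matrix ι ι ℝ) (E : Type) [NormedAddCommGroup E]
    [NormedSpace ℝ E] (cs : ChartedSpace E (OrbitSpace μ A)) : Prop :=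
  letI := cs
  IsManifold 𝓘(ℝ, E) ∞ (OrbitSpace μ A) ∧
    Manifold.IsSubmersion 𝓘(ℝ, truncSpace μ A) 𝓘(ℝ, E) ∞ (orbitMk μ A)

/-- The left inverse `(Pᵀ P)⁻¹ Pᵀ` of a matrix `P` of full column rank. It is the inverse `P⁻¹` when
`P` has as many rows as columns. -/
def leftInv {κ : Type} [Fintype κ] (P : Matrix κ ι ℝ) : Matrix ι κ ℝ := (Pᵀ * P)⁻¹ * Pᵀ

/-- The feedback matrix `[p₁ A ^ k₁; …; p_r A ^ k_r] P⁻¹`, where `p₁, …, p_r` are the first `r` rows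
of `P` and `k` is the conjugate partition of `μ`. -/
def feedbackOf (μ : YoungDiagram) (A : Matrix ι ι ℝ) (P : Matrix (Cell μ) ι ℝ) :
    Matrix (Fin (μ.rowLen 0)) (Cell μ) ℝ :=
  (Matrix.of fun a : Fin (μ.rowLen 0) => (topRows P * A ^ μ.colLen a) a) * leftInv P

theorem feedbackOf_mul (μ : YoungDiagram) (A : Matrix ι ι ℝ) (P : Matrix (Cell μ) ι ℝ)
    (X : (Matrix ι ι ℝ)ˣ) (hX : X ∈ centGroup A) :
    feedbackOf μ A (P * X.1) = feedbackOf μ A P := by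
  have h1 : (Matrix.of fun a : Fin (μ.rowLen 0) => (topRows (P * X.1) * A ^ μ.colLen a) a) =
      (Matrix.of fun a : Fin (μ.rowLen 0) => (topRows P * A ^ μ.colLen a) a) * X.1 := by
    have h : ∀ n : ℕ, X.1 * A ^ n = A ^ n * X.1 := fun n =>
      (show Commute X.1 A from hX).pow_right n
    have h0 : topRows (P * X.1) = topRows P * X.1 := by
      ext a j
      simp [topRows, Matrix.mul_apply]
    ext a j
    rw [Matrix.of_apply, h0, Matrix.mul_assoc, h, ← Matrix.mul_assoc]
    simp [Matrix.mul_apply]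
  have hu : IsUnit X.1.det := (Matrix.isUnit_iff_isUnit_det _).1 X.isUnit
  have hut : IsUnit (X.1ᵀ).det := by rwa [Matrix.det_transpose]
  have h2 : X.1 * leftInv (P * X.1) = leftInv P := by
    have e : (P * X.1)ᵀ * (P * X.1) = X.1ᵀ * ((Pᵀ * P) * X.1) := by
      simp [Matrix.transpose_mul, Matrix.mul_assoc]
    rw [leftInv, e, Matrix.mul_inv_rev, Matrix.mul_inv_rev, Matrix.transpose_mul, leftInv]
    simp only [← Matrix.mul_assoc]
    rw [Matrix.mul_nonsing_inv _ hu, Matrix.one_mul, Matrix.mul_assoc _ (X.1ᵀ)⁻¹,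
      Matrix.nonsing_inv_mul _ hut, Matrix.mul_one]
  rw [feedbackOf, h1, Matrix.mul_assoc, h2, feedbackOf]

/-- The map `φ` from the orbit space to the feedback matrices, which takes the orbit of `P` to
`[p₁ A ^ k₁; …; p_r A ^ k_r] P⁻¹`. -/
def phi (μ : YoungDiagram) (A : Matrix ι ι ℝ) :
    OrbitSpace μ A → Matrix (Fin (μ.rowLen 0)) (Cell μ) ℝ :=
  Quotient.lift (fun P : fullRank μ A => feedbackOf μ A (toMat P.1)) (by
    rintro P P' ⟨X, hX, h⟩
    rw [h, feedbackOf_mul μ A _ X hX])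

end Orbit

/-! ### The pole assignment problem -/

/-- Similarity of two square matrices over index types of the same size. -/
def SimilarTo {κ ι : Type} [Fintype κ] [Fintype ι] [DecidableEq κ] [DecidableEq ι]
    (M : Matrix κ κ ℝ) (A : Matrix ι ι ℝ) : Prop :=
  ∃ (T : Matrix κ ι ℝ) (S : Matrix ι κ ℝ), T * S = 1 ∧ S * T = 1 ∧ M = T * A * S

/-- The set of the feedback matrices `K` such that `F + G K` is similar to `A`. -/
def feedbackSet {κ ι τ : Type} [Fintype κ] [Fintype ι] [Fintype τ] [DecidableEq κ] [DecidableEq ι]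
    (F : Matrix κ κ ℝ) (G : Matrix κ τ ℝ) (A : Matrix ι ι ℝ) : Set (Matrix τ κ ℝ) :=
  {K | SimilarTo (F + G * K) A}

/-- The state matrix of the `p`-Brunovsky form with Brunovsky indices `μ`: the blocks immediately
above the diagonal are `[I; 0]`, all others vanish. -/
def brunovskyF (μ : YoungDiagram) : Matrix (Cell μ) (Cell μ) ℝ :=
  Matrix.of fun c d => if d.1 = (c.1.1 + 1, c.1.2) then 1 else 0

/-- The nonzero columns of the input matrix of the `p`-Brunovsky form: in the `i`-th block of rows,
the last `r i - r (i + 1)` rows are those of the identity matrix with the same numbers, and the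
others vanish. -/
def brunovskyG (μ : YoungDiagram) : Matrix (Cell μ) (Fin (μ.rowLen 0)) ℝ :=
  Matrix.of fun c a => if c.1.2 = a ∧ μ.rowLen (c.1.1 + 1) ≤ c.1.2 then 1 else 0

/-- The input matrix `[G₁ 0]` of the `p`-Brunovsky form with `l` zero columns. -/
def brunovskyGFull (μ : YoungDiagram) (l : ℕ) : Matrix (Cell μ) (Fin (μ.rowLen 0) ⊕ Fin l) ℝ :=
  Matrix.fromCols (brunovskyG μ) 0

/-! ### Multi-indices and reduced forms -/

/-- A chain `I₁ ⊆ … ⊆ I_m` of sequences of indices for a block with Weyr characteristic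
`w = (w₁ ≥ … ≥ w_m)`, the `j`-th one having `τ_j = w_{m-j+1}` distinct terms in `{1, …, r}`, such
that the terms of `I_j` which are not in `I_{j-1}` increase. It is given by its last member `idx`:
the sequence `I_j` consists of the first `τ_j` terms, and the positions `a`, `b` belong to the same
difference `I_j \ I_{j-1}` if and only if the columns `a`, `b` of `w` have the same length
`m - j + 1`. -/
structure IndexSeq (w : YoungDiagram) (r : ℕ) where
  idx : Fin (w.rowLen 0) → Fin r
  injective : Function.Injective idx
  increasing : ∀ a b : Fin (w.rowLen 0), a < b → w.colLen a = w.colLen b → idx a < idx b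

/-- The replacement of each pair `z = [z₁ z₂]` by the block `[[z₁, z₂], [-z₂, z₁]]`. -/
def diamond {α β : Type} (Z : Matrix α (β × Fin 2) ℝ) : Matrix (α × Fin 2) (β × Fin 2) ℝ :=
  Matrix.of fun a b =>
    !![Z a.1 (b.1, 0), Z a.1 (b.1, 1); -Z a.1 (b.1, 1), Z a.1 (b.1, 0)] a.2 b.2

namespace IndexSeq

variable {w : YoungDiagram} {r : ℕ} (s : IndexSeq w r)

/-- The inclusion of the first `w.rowLen j` positions in the first block. -/
def incl (w : YoungDiagram) (j : ℕ) : Fin (w.rowLen j) → Fin (w.rowLen 0) :=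
  Fin.castLE (w.rowLen_anti 0 j (Nat.zero_le j))

/-- The chain is admissible, for the first `r` rows `Z` of the columns of a block with a real
eigenvalue: the rows in `I_j` and the first `τ_j` columns give an invertible matrix. -/
def Admissible (Z : Matrix (Fin r) (Cell w) ℝ) : Prop :=
  ∀ j, IsUnit (Z.submatrix (s.idx ∘ incl w j) (topCell w ∘ incl w j))

/-- The analogue of `Admissible` for a block with two conjugate eigenvalues. -/
def AdmissiblePair (Z : Matrix (Fin r) (Cell w × Fin 2) ℝ) : Prop :=
  ∀ j, IsUnit (diamond
    (Z.submatrix (s.idx ∘ incl w j) (Prod.map (topCell w ∘ incl w j) (id : Fin 2 → Fin 2))))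

/-- The row `idx a` is in the group of number `m - w.colLen a + 1`, and the column `(j, b)` is in the
group of number `m - w.colLen b + 1` of the block of columns `j`; in each reduced form, the entry at
this place is fixed if and only if `w.colLen b ≤ w.colLen a + j`. -/
def IsFixed (a : Fin (w.rowLen 0)) (c : Cell w) : Prop := w.colLen c.1.2 ≤ w.colLen a + c.1.1

/-- Reduced forms, for a block with a real eigenvalue (`Z` are the first `r` rows): the rows in
`I_m` of the first block of columns form a lower block triangular matrix with identity matrices on
its diagonal, and in the block of columns `j ≥ 2` the blocks `(i, k)` with `k ≥ i - j + 1` vanish. -/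
def Reduced (Z : Matrix (Fin r) (Cell w) ℝ) : Prop :=
  ∀ a c, IsFixed a c → Z (s.idx a) c = if c = topCell w a then 1 else 0

/-- The analogue of `Reduced` for a block with two conjugate eigenvalues. -/
def ReducedPair (Z : Matrix (Fin r) (Cell w × Fin 2) ℝ) : Prop :=
  ∀ a c, IsFixed a c → ∀ u v, diamond Z (s.idx a, u) (c, v) = if c = topCell w a ∧ u = v then 1 else 0

end IndexSeq

/-- A multi-index: a chain of index sequences for each block of the real Weyr form. -/
structure MultiIndex (D : WeyrData) (r : ℕ) where
  real : ∀ i : Fin D.p, IndexSeq (D.realWeyr i) r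
  cplx : ∀ j : Fin D.q, IndexSeq (D.cplxWeyr j) r

/-- The columns of the `i`-th block with a real eigenvalue. -/
def realCols {D : WeyrData} {κ : Type} (Z : Matrix κ D.Idx ℝ) (i : Fin D.p) :
    Matrix κ (Cell (D.realWeyr i)) ℝ := Z.submatrix id fun c => Sum.inl ⟨i, c⟩

/-- The columns of the `j`-th block with two conjugate eigenvalues. -/
def cplxCols {D : WeyrData} {κ : Type} (Z : Matrix κ D.Idx ℝ) (j : Fin D.q) :
    Matrix κ (Cell (D.cplxWeyr j) × Fin 2) ℝ := Z.submatrix id fun c => Sum.inr ⟨j, c⟩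

/-- The number `n r - N` of parameters. -/
def paramDim (μ : YoungDiagram) (D : WeyrData) : ℕ := μ.card * μ.rowLen 0 - D.centDim

/-- The parameter space `ℝ ^ (n r - N)`. -/
abbrev Param (μ : YoungDiagram) (D : WeyrData) : Type := EuclideanSpace ℝ (Fin (paramDim μ D))

namespace MultiIndex

section

variable {D : WeyrData} {r : ℕ} (I : MultiIndex D r)

/-- `I` is a multi-index for the matrix with first `r` rows `Z`. -/
def Admissible (Z : Matrix (Fin r) D.Idx ℝ) : Prop :=
  (∀ i, (I.real i).Admissible (realCols Z i)) ∧ ∀ j, (I.cplx j).AdmissiblePair (cplxCols Z j)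

/-- The matrix with first `r` rows `Z` is in reduced form with respect to `I`. -/
def Reduced (Z : Matrix (Fin r) D.Idx ℝ) : Prop :=
  (∀ i, (I.real i).Reduced (realCols Z i)) ∧ ∀ j, (I.cplx j).ReducedPair (cplxCols Z j)

/-- The places of the first `r` rows whose entry is fixed in a reduced form. -/
def Fixed (ρ : Fin r) : D.Idx → Prop
  | Sum.inl ⟨i, c⟩ => ∃ a, (I.real i).idx a = ρ ∧ IndexSeq.IsFixed a c
  | Sum.inr ⟨j, c, _⟩ => ∃ a, (I.cplx j).idx a = ρ ∧ IndexSeq.IsFixed a c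

/-- The fixed places whose entry is `1`; the entry at all other fixed places is `0`. -/
def FixedOne (ρ : Fin r) : D.Idx → Prop
  | Sum.inl ⟨i, c⟩ => ∃ a, (I.real i).idx a = ρ ∧ c = topCell _ a
  | Sum.inr ⟨j, c, u⟩ => (∃ a, (I.cplx j).idx a = ρ ∧ c = topCell _ a) ∧ u = 0

/-- The free places of the first `r` rows in a reduced form. -/
abbrev Free : Type := {x : Fin r × D.Idx // ¬ I.Fixed x.1 x.2}

open Classical in
/-- The first `r` rows of the matrix in reduced form that is built from the parameters `x`, when
the free places are enumerated by `e`. -/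
def rows {d : ℕ} (e : I.Free ≃ Fin d) (x : EuclideanSpace ℝ (Fin d)) : Matrix (Fin r) D.Idx ℝ :=
  Matrix.of fun ρ c =>
    if h : I.Fixed ρ c then (if I.FixedOne ρ c then 1 else 0) else x (e ⟨(ρ, c), h⟩)

end

variable {D : WeyrData} {μ : YoungDiagram} (I : MultiIndex D (μ.rowLen 0))

/-- The map `ν` which builds a matrix in reduced form from the parameters `x`. -/
def nu (e : I.Free ≃ Fin (paramDim μ D)) (x : Param μ D) : truncSpace μ D.mat :=
  truncOf μ D.mat (I.rows e x)

/-- The matrices of full rank in reduced form with respect to `I`. -/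
def reducedSet : Set (truncSpace μ D.mat) :=
  {P | P ∈ fullRank μ D.mat ∧ I.Reduced (topRows (toMat P))}

/-- The parameters of the matrices of full rank. -/
def dom (e : I.Free ≃ Fin (paramDim μ D)) : Set (Param μ D) := I.nu e ⁻¹' I.reducedSet

/-- The matrices of full rank for which `I` is a multi-index. -/
def admissibleSet : Set (fullRank μ D.mat) := {P | I.Admissible (topRows (toMat P.1))}

/-- The orbits of the matrices for which `I` is a multi-index. -/
def orbits : Set (OrbitSpace μ D.mat) := orbitMk μ D.mat '' I.admissibleSet

/-- The map `ψ`, which takes `x` to the orbit of the matrix in reduced form built from `x`. -/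
def psi (e : I.Free ≃ Fin (paramDim μ D)) (x : I.dom e) : OrbitSpace μ D.mat :=
  orbitMk μ D.mat ⟨I.nu e x.1, x.2.1⟩

/-- The matrix `φ (ψ x)`, for `x` in the domain of `ψ`. -/
def alpha (e : I.Free ≃ Fin (paramDim μ D)) (x : Param μ D) :
    Matrix (Fin (μ.rowLen 0)) (Cell μ) ℝ :=
  feedbackOf μ D.mat (toMat (I.nu e x))

theorem alpha_eq (e : I.Free ≃ Fin (paramDim μ D)) (x : I.dom e) :
    I.alpha e x.1 = phi μ D.mat (I.psi e x) := rfl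

end MultiIndex

/-! ### Smooth maps between subsets of normed spaces -/

section Smooth

variable {E F : Type} [NormedAddCommGroup E] [NormedSpace ℝ E] [NormedAddCommGroup F]
  [NormedSpace ℝ F]

/-- Smoothness of a map on a subset: locally it extends to a smooth map on an open set. -/
def SmoothOnSubset (f : E → F) (X : Set E) : Prop :=
  ∀ x ∈ X, ∃ U : Set E, IsOpen U ∧ x ∈ U ∧ ∃ g : E → F, ContDiffOn ℝ ∞ g U ∧ EqOn f g (U ∩ X)

/-- `f` is a diffeomorphism of the subset `X` onto the subset `Y`. -/
def IsDiffeoOnto (f : E → F) (X : Set E) (Y : Set F) : Prop :=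
  BijOn f X Y ∧ SmoothOnSubset f X ∧ ∃ g : F → E, LeftInvOn g f X ∧ SmoothOnSubset g Y

/-- `Y` is an open subset of `H`, for the subspace topology. -/
def IsOpenSubset (Y H : Set F) : Prop := ∃ O : Set F, IsOpen O ∧ Y = O ∩ H

end Smooth

end FeedbackParam

end

open FeedbackParam

noncomputable section

namespace FeedbackParam

/-! ### The nilpotent part of a Weyr block and its commutant -/

/-! The equation `P A = (F + G₁ K) P` says that `P` is a truncated observability matrix and that row
`a` of `K P` is `p_a A ^ k_a` (`observability_mul_eq_iff`, `eq_observability_of_mul_eq`). So every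
similarity between `F + G₁ K` and `A` is a nonsingular truncated observability matrix, it determines
`K`, and two of them with the same `K` differ by an invertible matrix commuting with `A`. Hence `φ`
is a continuous bijection of the orbit space onto the feedback set (`phi_injective`, `range_phi`).

Reduced forms are slices of the action. Matrices commuting with `A` are block diagonal, and each
block is a block Toeplitz matrix over ℝ or ℂ whose first rows are supported exactly on the places
(`IsFixed`) where a reduced form has prescribed entries. For admissible `Z`, the linear map from `X`
in the commutant to the fixed entries of `Z X` is injective, by triangular elimination with the
invertible minors (`commutant_eq_zero`, `eq_zero_of_fixed`). For one particular `Z` it is also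
surjective, so `N` is the number of fixed places (`centDim_eq`), there are `nr - N` free ones, and
the map is bijective for all admissible `Z`. So each admissible orbit contains exactly one matrix in
reduced form. Pivoting in the eigenvector columns provides an admissible multi-index for every
nonsingular `P(Z)` (`exists_leading_minors`, `exists_multiIndex`).

Smoothness of the inverse comes from linear algebra: for given `K`, the parameters of the reduced
form solve a linear system whose coefficients depend smoothly on `K`. Its least squares solution
`solve` is defined and smooth on an open set of all matrices `K`, and inverts `α` on the feedback
set (`solve_alpha`, `alpha_solve`). Thus `solve ∘ φ` gives charts of the orbit space with smooth
transition maps, and `P = ν(x) X ↦ (x, X)` is a local product decomposition in which `π` is the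
first projection (`isSubmersion_orbitMk`). For any other structure with `π` a submersion, smoothness
is tested on `P` through local sections (`contMDiffAt_of_comp_orbitMk`). -/

theorem mem_cells_iff_lt_rowLen {w : YoungDiagram} {i a : ℕ} :
    (i, a) ∈ w.cells ↔ a < w.rowLen i :=
  (YoungDiagram.mem_cells (μ := w) _).trans YoungDiagram.mem_iff_lt_rowLen

theorem mem_cells_iff_lt_colLen {w : YoungDiagram} {i a : ℕ} :
    (i, a) ∈ w.cells ↔ i < w.colLen a :=
  (YoungDiagram.mem_cells (μ := w) _).trans YoungDiagram.mem_iff_lt_colLen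

theorem lt_rowLen_iff_lt_colLen {w : YoungDiagram} {i a : ℕ} :
    a < w.rowLen i ↔ i < w.colLen a :=
  mem_cells_iff_lt_rowLen.symm.trans mem_cells_iff_lt_colLen

theorem Cell.lt_colLen {w : YoungDiagram} (c : Cell w) : c.1.1 < w.colLen c.1.2 :=
  mem_cells_iff_lt_colLen.1 c.2

theorem Cell.eq_topCell {w : YoungDiagram} (c : Cell w) (h : c.1.1 = 0) : c = topCell w c.pos :=
  Subtype.ext (Prod.ext h rfl)

theorem topCell_injective (w : YoungDiagram) : Function.Injective (topCell w) := by
  intro a b h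
  exact Fin.ext (congrArg (fun c : Cell w => c.1.2) h)

/-- The cell which lies `i` places above `c`. -/
def Cell.lower {w : YoungDiagram} (c : Cell w) (i : ℕ) : Cell w :=
  ⟨(c.1.1 - i, c.1.2), mem_cells_iff_lt_colLen.2 (lt_of_le_of_lt (Nat.sub_le _ _) c.lt_colLen)⟩

section Commutant

variable {w : YoungDiagram} {K : Type} [Field K]

/-- The nilpotent part of a Weyr block. -/
def weyrNil (w : YoungDiagram) (K : Type) [Field K] : Matrix (Cell w) (Cell w) K :=
  Matrix.of fun c d => if d.1 = (c.1.1 + 1, c.1.2) then 1 else 0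

/-- Right multiplication by the nilpotent part moves the columns one block to the right, and left
multiplication moves the rows one block up; zeros fill the places that become vacant. Comparing the
two products entry by entry describes the commutant. -/
theorem mul_weyrNil_apply_zero {κ : Type} (X : Matrix κ (Cell w) K) (c : κ) (d : Cell w)
    (hd : d.1.1 = 0) : (X * weyrNil w K) c d = 0 := by
  rw [Matrix.mul_apply]
  refine Finset.sum_eq_zero fun e _ => ?_
  have : d.1 ≠ (e.1.1 + 1, e.1.2) := fun h => by
    have := congrArg Prod.fst h
    simp only at this
    omega
  simp [weyrNil, this]

theorem mul_weyrNil_apply_succ {κ : Type} (X : Matrix κ (Cell w) K) (c : κ) (d d' : Cell w)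
    (hd : d'.1 = (d.1.1 + 1, d.1.2)) : (X * weyrNil w K) c d' = X c d := by
  rw [Matrix.mul_apply, Finset.sum_eq_single d]
  · simp [weyrNil, hd]
  · intro e _ he
    have : d'.1 ≠ (e.1.1 + 1, e.1.2) := fun h => he <| by
      rw [hd] at h
      simp only [Prod.mk.injEq, add_left_inj] at h
      exact Subtype.ext (Prod.ext h.1.symm h.2.symm)
    simp [weyrNil, this]
  · simp

theorem weyrNil_mul_apply_succ {κ : Type} (X : Matrix (Cell w) κ K) (c c' : Cell w) (d : κ)
    (hc : c'.1 = (c.1.1 + 1, c.1.2)) : (weyrNil w K * X) c d = X c' d := by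
  rw [Matrix.mul_apply, Finset.sum_eq_single c']
  · simp [weyrNil, hc]
  · intro e _ he
    have : e.1 ≠ (c.1.1 + 1, c.1.2) := fun h => he (Subtype.ext (h.trans hc.symm))
    simp [weyrNil, this]
  · simp

theorem weyrNil_mul_apply_last {κ : Type} (X : Matrix (Cell w) κ K) (c : Cell w) (d : κ)
    (hc : (c.1.1 + 1, c.1.2) ∉ w.cells) : (weyrNil w K * X) c d = 0 := by
  rw [Matrix.mul_apply]
  refine Finset.sum_eq_zero fun e _ => ?_
  have : e.1 ≠ (c.1.1 + 1, c.1.2) := fun h => hc (h ▸ e.2)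
  simp [weyrNil, this]

theorem weyrNil_pow_mul_apply {κ : Type} (X : Matrix (Cell w) κ K) (k : ℕ) (c : Cell w) (d : κ)
    (hc : w.colLen c.1.2 ≤ c.1.1 + k) : (weyrNil w K ^ k * X) c d = 0 := by
  induction k generalizing c with
  | zero => exact absurd c.lt_colLen (by simpa using hc)
  | succ k ih =>
    rw [pow_succ', Matrix.mul_assoc]
    by_cases h : (c.1.1 + 1, c.1.2) ∈ w.cells
    · rw [weyrNil_mul_apply_succ _ c ⟨_, h⟩ d rfl]
      exact ih _ (show w.colLen c.1.2 ≤ c.1.1 + 1 + k by omega)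
    · exact weyrNil_mul_apply_last _ _ _ h

theorem isNilpotent_weyrNil (w : YoungDiagram) (K : Type) [Field K] :
    IsNilpotent (weyrNil w K) := by
  refine ⟨w.colLen 0, ?_⟩
  ext c d
  rw [← Matrix.mul_one (weyrNil w K ^ _), weyrNil_pow_mul_apply _ _ _ _
    ((w.colLen_anti 0 c.1.2 (Nat.zero_le _)).trans (Nat.le_add_left _ _))]
  rfl

variable {X : Matrix (Cell w) (Cell w) K} (hX : X * weyrNil w K = weyrNil w K * X)

include hX

/-- The Toeplitz property: entries of the commutant are constant along the diagonals of blocks. The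
first and the last entry of a diagonal give the vanishing conditions in the two lemmas after this
one. -/
theorem commutant_apply_succ {c c' d d' : Cell w} (hc : c'.1 = (c.1.1 + 1, c.1.2))
    (hd : d'.1 = (d.1.1 + 1, d.1.2)) : X c' d' = X c d := by
  rw [← mul_weyrNil_apply_succ X c d d' hd, hX, weyrNil_mul_apply_succ X c c' d' hc]

theorem commutant_apply_zero {c c' d : Cell w} (hc : c'.1 = (c.1.1 + 1, c.1.2))
    (hd : d.1.1 = 0) : X c' d = 0 := by
  rw [← weyrNil_mul_apply_succ X c c' d hc, ← hX, mul_weyrNil_apply_zero X c d hd]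

theorem commutant_apply_last {c d d' : Cell w} (hc : (c.1.1 + 1, c.1.2) ∉ w.cells)
    (hd : d'.1 = (d.1.1 + 1, d.1.2)) : X c d = 0 := by
  rw [← mul_weyrNil_apply_succ X c d d' hd, hX, weyrNil_mul_apply_last X c d' hc]

theorem commutant_apply_of_lt {c d : Cell w} (h : d.1.1 < c.1.1) : X c d = 0 := by
  induction hk : d.1.1 generalizing c d with
  | zero =>
    exact commutant_apply_zero hX (c := c.lower 1)
      (Prod.ext (by change _ = c.1.1 - 1 + 1; omega) rfl) hk
  | succ k ih =>
    rw [commutant_apply_succ hX (c := c.lower 1) (c' := c) (d := d.lower 1) (d' := d)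
      (Prod.ext (by change _ = c.1.1 - 1 + 1; omega) rfl)
      (Prod.ext (by change _ = d.1.1 - 1 + 1; omega) rfl)]
    exact ih (by change d.1.1 - 1 < c.1.1 - 1; omega) (by change d.1.1 - 1 = k; omega)

theorem commutant_apply_of_le {c d : Cell w} (h : c.1.1 ≤ d.1.1) :
    X c d = X (topCell w c.pos) (d.lower c.1.1) := by
  induction hk : c.1.1 generalizing c d with
  | zero =>
    rw [← c.eq_topCell hk]
    rfl
  | succ k ih =>
    rw [commutant_apply_succ hX (c := c.lower 1) (c' := c) (d := d.lower 1) (d' := d)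
      (Prod.ext (by change _ = c.1.1 - 1 + 1; omega) rfl)
      (Prod.ext (by change _ = d.1.1 - 1 + 1; omega) rfl),
      ih (c := c.lower 1) (d := d.lower 1) (by change c.1.1 - 1 ≤ d.1.1 - 1; omega)
        (by change c.1.1 - 1 = k; omega)]
    congr 1
    exact Subtype.ext (Prod.ext (by change d.1.1 - 1 - k = d.1.1 - (k + 1); omega) rfl)

/-- Column `a` ends before column `d.1.2` does when both cells are moved down along the diagonal.
The last cell in column `a` then still has an entry to its lower right, which forces the whole
diagonal to vanish. -/
theorem commutant_topCell_apply {a : Fin (w.rowLen 0)} {d : Cell w}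
    (h : ¬ IndexSeq.IsFixed a d) : X (topCell w a) d = 0 := by
  have ha : 0 < w.colLen a := lt_rowLen_iff_lt_colLen.1 a.2
  simp only [IndexSeq.IsFixed, not_le] at h
  -- `c` is the last cell of column `a`, `d'` is `d` moved down by the same number of blocks, and
  -- `d''` is the cell below `d'`, which exists because the place is not fixed.
  let c : Cell w := ⟨(w.colLen a - 1, a), mem_cells_iff_lt_colLen.2 (by omega)⟩
  let d' : Cell w := ⟨(d.1.1 + (w.colLen a - 1), d.1.2), mem_cells_iff_lt_colLen.2 (by omega)⟩
  let d'' : Cell w := ⟨(d.1.1 + (w.colLen a - 1) + 1, d.1.2),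
    mem_cells_iff_lt_colLen.2 (by omega)⟩
  have e : X c d' = X (topCell w a) d := by
    rw [commutant_apply_of_le hX (show c.1.1 ≤ d'.1.1 from Nat.le_add_left _ _)]
    congr 1
    exact Subtype.ext (Prod.ext (Nat.add_sub_cancel _ _) rfl)
  rw [← e]
  refine commutant_apply_last hX (d' := d'') ?_ rfl
  rw [mem_cells_iff_lt_colLen]
  change ¬ (w.colLen a - 1 + 1 < w.colLen a)
  omega

omit hX in
theorem incl_injective (w : YoungDiagram) (j : ℕ) : Function.Injective (IndexSeq.incl w j) :=
  Fin.castLE_injective _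

/-- An element of the commutant is determined by the fixed entries of its product with an
admissible matrix. -/
theorem commutant_eq_zero {r : ℕ} (s : IndexSeq w r) (Z : Matrix (Fin r) (Cell w) K)
    (hZ : ∀ j, IsUnit
      (Z.submatrix (s.idx ∘ IndexSeq.incl w j) (topCell w ∘ IndexSeq.incl w j)))
    (h : ∀ a c, IndexSeq.IsFixed a c → (Z * X) (s.idx a) c = 0) : X = 0 := by
  -- By the Toeplitz property it suffices to treat the first rows; this is done one block of columns
  -- at a time.
  have key : ∀ k a (c : Cell w), c.1.1 = k → X (topCell w a) c = 0 := by
    intro k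
    induction k using Nat.strong_induction_on with
    | _ k ih =>
    intro a c hc
    have hcl := c.lt_colLen
    -- With this `t`, the place `(b, c)` is fixed if and only if `b < w.rowLen t`. So the possibly
    -- nonzero entries of column `c` in the first rows form a vector of the size of the minor of
    -- level `t`, and that minor annihilates the vector.
    set t := w.colLen c.1.2 - k - 1 with ht
    have hv : (fun b : Fin (w.rowLen t) => X (topCell w (IndexSeq.incl w t b)) c) = 0 := by
      refine Matrix.mulVec_injective_of_isUnit (hZ t) ?_
      rw [Matrix.mulVec_zero]
      ext a'
      have ha' : t < w.colLen (IndexSeq.incl w t a') := lt_rowLen_iff_lt_colLen.1 a'.2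
      have := h (IndexSeq.incl w t a') c (by simp only [IndexSeq.IsFixed]; omega)
      rw [Pi.zero_apply, ← this, Matrix.mul_apply]
      simp only [Matrix.mulVec, dotProduct]
      refine Finset.sum_of_injOn (topCell w ∘ IndexSeq.incl w t) ?_ ?_ ?_ ?_
      · exact ((topCell_injective w).comp (incl_injective w t)).injOn
      · simp
      · intro e _ he
        rcases Nat.eq_zero_or_pos e.1.1 with h0 | h0
        · rw [e.eq_topCell h0, commutant_topCell_apply hX, mul_zero]
          intro hf
          simp only [IndexSeq.IsFixed] at hf
          refine he ⟨⟨e.1.2, lt_rowLen_iff_lt_colLen.2 ?_⟩, by simp, ?_⟩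
          · change _ ≤ w.colLen e.1.2 + _ at hf
            omega
          · exact (e.eq_topCell h0).symm
        -- An entry below the first block equals an entry of the first rows in an earlier block of
        -- columns, which vanishes by induction.
        · rcases lt_or_ge c.1.1 e.1.1 with h1 | h1
          · rw [commutant_apply_of_lt hX h1, mul_zero]
          · rw [commutant_apply_of_le hX h1, ih (c.1.1 - e.1.1) (by omega) _ _ rfl, mul_zero]
      · intro b _
        rfl
    by_cases ha : (a : ℕ) < w.rowLen t
    · exact congrFun hv ⟨a, ha⟩
    · refine commutant_topCell_apply hX ?_
      rw [lt_rowLen_iff_lt_colLen] at ha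
      simp only [IndexSeq.IsFixed]
      omega
  ext c d
  rcases lt_or_ge d.1.1 c.1.1 with h1 | h1
  · exact commutant_apply_of_lt hX h1
  · rw [commutant_apply_of_le hX h1, key _ _ _ rfl]
    rfl

omit hX

/-- The element of the commutant with given first rows. -/
def commutantOf (Y : Fin (w.rowLen 0) → Cell w → K) : Matrix (Cell w) (Cell w) K :=
  Matrix.of fun c d => if c.1.1 ≤ d.1.1 then Y c.pos (d.lower c.1.1) else 0

theorem commutantOf_topCell (Y : Fin (w.rowLen 0) → Cell w → K) (a : Fin (w.rowLen 0))
    (d : Cell w) : commutantOf Y (topCell w a) d = Y a d := by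
  rw [commutantOf, Matrix.of_apply, if_pos (show (topCell w a).1.1 ≤ d.1.1 from Nat.zero_le _)]
  rfl

/-- The only obstruction for a Toeplitz matrix is at the last cell of a column, where a diagonal
that could be continued on the right must vanish. These are precisely the diagonals that start at
places that are not fixed. -/
theorem commutantOf_comm (Y : Fin (w.rowLen 0) → Cell w → K)
    (hY : ∀ a c, ¬ IndexSeq.IsFixed a c → Y a c = 0) :
    commutantOf Y * weyrNil w K = weyrNil w K * commutantOf Y := by
  ext c d
  rcases Nat.eq_zero_or_pos d.1.1 with hd | hd
  · rw [mul_weyrNil_apply_zero _ _ _ hd]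
    by_cases hc : (c.1.1 + 1, c.1.2) ∈ w.cells
    · rw [weyrNil_mul_apply_succ _ c ⟨_, hc⟩ d rfl]
      exact (if_neg (by change ¬ (c.1.1 + 1 ≤ d.1.1); omega)).symm
    · rw [weyrNil_mul_apply_last _ _ _ hc]
  · rw [mul_weyrNil_apply_succ _ c (d.lower 1) d
      (Prod.ext (by change _ = d.1.1 - 1 + 1; omega) rfl)]
    by_cases hc : (c.1.1 + 1, c.1.2) ∈ w.cells
    · rw [weyrNil_mul_apply_succ _ c ⟨_, hc⟩ d rfl]
      simp only [commutantOf, Matrix.of_apply]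
      have e : (d.lower 1).lower c.1.1 = d.lower (c.1.1 + 1) :=
        Subtype.ext (Prod.ext (by change d.1.1 - 1 - c.1.1 = d.1.1 - (c.1.1 + 1); omega) rfl)
      rw [e]
      refine if_congr ?_ rfl rfl
      change c.1.1 ≤ d.1.1 - 1 ↔ c.1.1 + 1 ≤ d.1.1
      omega
    · rw [weyrNil_mul_apply_last _ _ _ hc]
      simp only [commutantOf, Matrix.of_apply]
      split_ifs with h1
      · refine hY _ _ ?_
        have h2 := d.lt_colLen
        rw [mem_cells_iff_lt_colLen] at hc
        simp only [IndexSeq.IsFixed, not_le]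
        change c.1.1 ≤ d.1.1 - 1 at h1
        change w.colLen c.1.2 + (d.1.1 - 1 - c.1.1) < w.colLen d.1.2
        omega
      · rfl

end Commutant

/-! ### Existence of admissible index sequences -/

section Minors

variable {K : Type} [Field K]

/-- Gaussian elimination with row pivoting: `f` chooses rows for which all leading minors are
nonsingular. The nonsingularity is expressed by kernels, for vectors supported on the first `j`
coordinates, which avoids determinants of varying size. -/
theorem exists_leading_minors {r n : ℕ} (M : Matrix (Fin r) (Fin n) K)
    (hM : ∀ v, M *ᵥ v = 0 → v = 0) : ∃ f : Fin n → Fin r, ∀ j ≤ n, ∀ v : Fin n → K,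
      (∀ b : Fin n, j ≤ b → v b = 0) → (∀ i : Fin n, i < j → (M *ᵥ v) (f i) = 0) → v = 0 := by
  rcases isEmpty_or_nonempty (Fin r) with hr | ⟨⟨ρ₀⟩⟩
  · have h0 : ∀ v : Fin n → K, v = 0 := fun v => hM v (Subsingleton.elim _ _)
    have : IsEmpty (Fin n) := ⟨fun i => one_ne_zero (congrFun (h0 1) i)⟩
    exact ⟨fun i => isEmptyElim i, fun _ _ v _ _ => h0 v⟩
  suffices H : ∀ k ≤ n, ∃ f : Fin n → Fin r, ∀ j ≤ k, ∀ v : Fin n → K,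
      (∀ b : Fin n, j ≤ b → v b = 0) → (∀ i : Fin n, i < j → (M *ᵥ v) (f i) = 0) → v = 0 from
    H n le_rfl
  intro k
  induction k with
  | zero =>
    intro _
    refine ⟨fun _ => ρ₀, fun j hj v hv _ => funext fun b => hv b ?_⟩
    omega
  | succ k ih =>
    intro hk
    obtain ⟨f, hf⟩ := ih (by omega)
    let κ : Fin n := ⟨k, hk⟩
    -- These are `n - 1` equations in `n` unknowns: the rows chosen so far annihilate the vector,
    -- and its coordinates after `κ` vanish. A nonzero solution `v` has `v κ ≠ 0` by induction, and
    -- any row of `M` that does not annihilate `v` serves as the next pivot row.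
    let T : (Fin n → K) →ₗ[K] ({i : Fin n // i ≠ κ} → K) :=
      LinearMap.pi fun i => if i.1 < κ then (LinearMap.proj (f i.1)) ∘ₗ M.mulVecLin
        else LinearMap.proj i.1
    have hT : LinearMap.ker T ≠ ⊥ := by
      apply LinearMap.ker_ne_bot_of_finrank_lt
      simp only [Module.finrank_fintype_fun_eq_card, Fintype.card_subtype_compl, Fintype.card_fin,
        Fintype.card_unique]
      omega
    obtain ⟨v, hv, hv0⟩ := Submodule.exists_mem_ne_zero_of_ne_bot hT
    have hTv : ∀ i, T v i = 0 := fun i => congrFun (LinearMap.mem_ker.1 hv) i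
    have hlt : ∀ i : Fin n, (i : ℕ) < k → (M *ᵥ v) (f i) = 0 := by
      intro i hi
      have hne : i ≠ κ := fun h => by rw [h] at hi; exact lt_irrefl _ hi
      have := hTv ⟨i, hne⟩
      simpa [T, show i < κ from hi] using this
    have hgt : ∀ i : Fin n, k + 1 ≤ (i : ℕ) → v i = 0 := by
      intro i hi
      have hne : i ≠ κ := fun h => by rw [h] at hi; change k + 1 ≤ k at hi; omega
      have := hTv ⟨i, hne⟩
      simpa [T, show ¬ i < κ from fun h => by
        have : (i : ℕ) < k := h
        omega] using this
    have hvκ : v κ ≠ 0 := by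
      intro h0
      refine hv0 (hf k le_rfl v (fun b hb => ?_) hlt)
      rcases Nat.eq_or_lt_of_le hb with h | h
      · rw [show b = κ from Fin.ext h.symm, h0]
      · exact hgt b h
    obtain ⟨ρ, hρ⟩ : ∃ ρ, (M *ᵥ v) ρ ≠ 0 := by
      by_contra! h
      exact hv0 (hM v (funext h))
    have hup : ∀ i : Fin n, (i : ℕ) < k → Function.update f κ ρ i = f i := fun i hi =>
      Function.update_of_ne (fun h => by rw [h] at hi; exact lt_irrefl _ hi) _ _
    refine ⟨Function.update f κ ρ, fun j hj u hu hi => ?_⟩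
    rcases Nat.le_succ_iff.1 hj with hj | rfl
    · refine hf j hj u hu fun i hij => ?_
      rw [← hup i (by omega)]
      exact hi i hij
    -- Subtracting a multiple of `v` removes the coordinate `κ`, so the induction hypothesis
    -- applies; the new row then shows that the multiple is zero.
    · have hz : u - (u κ / v κ) • v = 0 := by
        refine hf k le_rfl _ (fun b hb => ?_) fun i hik => ?_
        · rcases Nat.eq_or_lt_of_le hb with h | h
          · rw [show b = κ from Fin.ext h.symm]
            simp [hvκ]
          · simp [hu b h, hgt b h]
        · have h1 := hi i (by omega)
          rw [hup i hik] at h1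
          rw [Matrix.mulVec_sub, Matrix.mulVec_smul, Pi.sub_apply, Pi.smul_apply, h1, hlt i hik]
          simp
      have hu' : u = (u κ / v κ) • v := sub_eq_zero.1 hz
      have h2 := hi κ (Nat.lt_succ_self k)
      rw [hu', Function.update_self, Matrix.mulVec_smul, Pi.smul_apply, smul_eq_mul] at h2
      rcases mul_eq_zero.1 h2 with h3 | h3
      · rw [hu', h3, zero_smul]
      · exact absurd h3 hρ

/-- If the columns in the first block are linearly independent, then some index sequence is
admissible. -/
theorem exists_indexSeq {w : YoungDiagram} {r : ℕ} (Z : Matrix (Fin r) (Cell w) K)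
    (hZ : ∀ v, Z.submatrix id (topCell w) *ᵥ v = 0 → v = 0) : ∃ s : IndexSeq w r, ∀ j, IsUnit
      (Z.submatrix (s.idx ∘ IndexSeq.incl w j) (topCell w ∘ IndexSeq.incl w j)) := by
  obtain ⟨f, hf⟩ := exists_leading_minors _ hZ
  set M := Z.submatrix id (topCell w)
  have hfi : Function.Injective f := by
    intro a b hab
    by_contra hne
    let S : Matrix (Fin (w.rowLen 0)) (Fin (w.rowLen 0)) K := M.submatrix f id
    have hS : IsUnit S := by
      rw [← Matrix.mulVec_injective_iff_isUnit]
      refine (injective_iff_map_eq_zero S.mulVecLin).2 fun v hv => ?_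
      exact hf _ le_rfl v (fun b hb => absurd b.2 (not_lt.2 hb)) fun i _ => congrFun hv i
    have := (Matrix.isUnit_iff_isUnit_det S).1 hS
    rw [Matrix.det_zero_of_row_eq hne (show S a = S b by ext j; simp [S, hab])] at this
    exact not_isUnit_zero this
  -- The chosen rows must increase within each group of columns of equal length. Sorting by
  -- (decreasing column length, row index) only permutes positions inside the groups, so each minor
  -- of size `w.rowLen j` merely has its rows permuted.
  let g : Fin (w.rowLen 0) → ℕᵒᵈ := fun a => OrderDual.toDual (w.colLen a)
  let F : Fin (w.rowLen 0) → Lex (ℕᵒᵈ × Fin r) := fun a => toLex (g a, f a)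
  set σ := Tuple.sort F
  have hF : Monotone (F ∘ σ) := Tuple.monotone_sort F
  have hgσ : Monotone (g ∘ σ) := by
    intro a b hab
    have := hF hab
    simp only [F, Function.comp, Prod.Lex.toLex_le_toLex] at this
    rcases this with h | h
    · exact h.le
    · exact h.1.le
  have hg : Monotone (g ∘ (Equiv.refl _ : Equiv.Perm (Fin (w.rowLen 0)))) := by
    intro a b hab
    exact w.colLen_anti a b hab
  have hgg : ∀ a, w.colLen (σ a) = w.colLen a := fun a =>
    congrFun (Tuple.unique_monotone hgσ hg) a
  refine ⟨⟨f ∘ σ, hfi.comp σ.injective, fun a b hab hc => ?_⟩, fun j => ?_⟩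
  · have := hF hab.le
    simp only [F, Function.comp, Prod.Lex.toLex_le_toLex, g, hgg, hc] at this
    rcases this with h | h
    · exact absurd h (lt_irrefl _)
    · exact lt_of_le_of_ne h.2 ((hfi.comp σ.injective).ne hab.ne)
  · rw [← Matrix.mulVec_injective_iff_isUnit]
    refine (injective_iff_map_eq_zero (Matrix.mulVecLin _)).2 fun v hv => ?_
    let u : Fin (w.rowLen 0) → K := fun b => if h : (b : ℕ) < w.rowLen j then v ⟨b, h⟩ else 0
    have hu : ∀ ρ, (M *ᵥ u) ρ =
        ((M.submatrix id (IndexSeq.incl w j)) *ᵥ v) ρ := by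
      intro ρ
      symm
      simp only [Matrix.mulVec, dotProduct]
      refine Finset.sum_of_injOn (IndexSeq.incl w j) (incl_injective w j).injOn ?_ ?_ ?_
      · simp
      · intro b _ hb
        have : u b = 0 := dif_neg fun h => hb ⟨⟨b, h⟩, by simp, rfl⟩
        rw [this, mul_zero]
      · intro b _
        have : u (IndexSeq.incl w j b) = v b := dif_pos b.2
        rw [this]
        rfl
    have hu0 : u = 0 := by
      refine hf _ (w.rowLen_anti 0 j (Nat.zero_le _)) u (fun b hb => dif_neg (not_lt.2 hb))
        fun i hij => ?_
      have hi : ((σ.symm i : Fin _) : ℕ) < w.rowLen j := by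
        rw [lt_rowLen_iff_lt_colLen, ← hgg, Equiv.apply_symm_apply, ← lt_rowLen_iff_lt_colLen]
        exact hij
      have := congrFun hv ⟨_, hi⟩
      rw [hu, show f i = (f ∘ σ) (IndexSeq.incl w j ⟨_, hi⟩) by
        simp [IndexSeq.incl]]
      exact this
    ext b
    have := congrFun hu0 (IndexSeq.incl w j b)
    rwa [show u (IndexSeq.incl w j b) = v b from dif_pos b.2] at this

end Minors

/-! ### Complex matrices as real matrices -/

section ToReal

variable {l m n : Type}

/-- The real matrix with the blocks `rotBlock (M c d)`. -/
def toReal (M : Matrix m n ℂ) : Matrix (m × Fin 2) (n × Fin 2) ℝ :=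
  Matrix.of fun c d => rotBlock (M c.1 d.1) c.2 d.2

/-- The complex matrix with the entries `z₁ + z₂ i`, for the pairs of columns `(z₁, z₂)`. -/
def toCplx (Z : Matrix m (n × Fin 2) ℝ) : Matrix m n ℂ :=
  Matrix.of fun c d => ⟨Z c (d, 0), Z c (d, 1)⟩

theorem toReal_add (M M' : Matrix m n ℂ) : toReal (M + M') = toReal M + toReal M' := by
  ext ⟨c, u⟩ ⟨d, v⟩
  fin_cases u <;> fin_cases v <;> simp [toReal, rotBlock, add_comm]

theorem toReal_mul [Fintype m] (M : Matrix l m ℂ) (M' : Matrix m n ℂ) :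
    toReal (M * M') = toReal M * toReal M' := by
  ext ⟨c, u⟩ ⟨d, v⟩
  simp only [Matrix.mul_apply, toReal, Matrix.of_apply, Fintype.sum_prod_type, Fin.sum_univ_two]
  fin_cases u <;> fin_cases v <;>
    simp [rotBlock, Complex.re_sum, Complex.im_sum, Finset.sum_add_distrib, Complex.mul_re,
      Complex.mul_im] <;> ring

theorem toReal_one [DecidableEq m] : toReal (1 : Matrix m m ℂ) = 1 := by
  ext ⟨c, u⟩ ⟨d, v⟩
  by_cases h : c = d <;> fin_cases u <;> fin_cases v <;>
    simp [toReal, rotBlock, Matrix.one_apply, h]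

theorem toReal_pow [Fintype m] [DecidableEq m] (M : Matrix m m ℂ) (k : ℕ) :
    toReal (M ^ k) = toReal M ^ k := by
  induction k with
  | zero => simp [toReal_one]
  | succ k ih => rw [pow_succ, pow_succ, toReal_mul, ih]

theorem toReal_zero : toReal (0 : Matrix m n ℂ) = 0 := by
  ext ⟨c, u⟩ ⟨d, v⟩
  fin_cases u <;> fin_cases v <;> simp [toReal, rotBlock]

theorem toCplx_toReal (M : Matrix m n ℂ) (c : m) (d : n) :
    toCplx (toReal M) (c, 0) d = M c d := by
  simp [toCplx, toReal, rotBlock]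

theorem toReal_injective {M M' : Matrix m n ℂ} (h : toReal M = toReal M') : M = M' := by
  ext c d
  rw [← toCplx_toReal M, h, toCplx_toReal]

theorem toCplx_mul_toReal [Fintype m] (Z : Matrix l (m × Fin 2) ℝ) (M : Matrix m n ℂ) :
    toCplx (Z * toReal M) = toCplx Z * M := by
  ext c d
  apply Complex.ext
  · simp [Matrix.mul_apply, toReal, toCplx, Fintype.sum_prod_type, rotBlock, Complex.re_sum,
      Complex.mul_re, Finset.sum_add_distrib]
    ring
  · simp [Matrix.mul_apply, toReal, toCplx, Fintype.sum_prod_type, rotBlock, Complex.im_sum,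
      Complex.mul_im, Finset.sum_add_distrib]

theorem isUnit_toReal [Fintype m] [DecidableEq m] {M : Matrix m m ℂ} (h : IsUnit M) :
    IsUnit (toReal M) := by
  obtain ⟨N, hN, hN'⟩ := isUnit_iff_exists.1 h
  exact isUnit_iff_exists.2
    ⟨toReal N, by rw [← toReal_mul, hN, toReal_one], by rw [← toReal_mul, hN', toReal_one]⟩

/-- This transfers admissibility for conjugate pairs, stated by real matrices, to complex minors, so
that the arguments over a general field apply. -/
theorem isUnit_toReal_iff [Fintype m] [DecidableEq m] {M : Matrix m m ℂ} :
    IsUnit (toReal M) ↔ IsUnit M := by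
  refine ⟨fun h => ?_, isUnit_toReal⟩
  rw [← Matrix.mulVec_injective_iff_isUnit]
  refine (injective_iff_map_eq_zero M.mulVecLin).2 fun v hv => ?_
  have h0 : toReal M * toReal (Matrix.replicateCol Unit v) = 0 := by
    rw [← toReal_mul, ← Matrix.replicateCol_mulVec, show M *ᵥ v = 0 from hv,
      Matrix.replicateCol_zero, toReal_zero]
  have h1 : toReal (Matrix.replicateCol Unit v) = 0 := by
    have hd := (Matrix.isUnit_iff_isUnit_det _).1 h
    have := congrArg (fun Y => (toReal M)⁻¹ * Y) h0
    simpa only [← Matrix.mul_assoc, Matrix.nonsing_inv_mul _ hd, Matrix.one_mul,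
      Matrix.mul_zero] using this
  ext c
  have h2 := toCplx_toReal (Matrix.replicateCol Unit v) c ()
  rw [h1] at h2
  exact h2.symm

/-- A real matrix which commutes with the complex structure comes from a complex matrix. -/
theorem eq_toReal_of_comm [Fintype m] [DecidableEq m] {X : Matrix (m × Fin 2) (m × Fin 2) ℝ}
    (h : X * toReal (Complex.I • (1 : Matrix m m ℂ)) =
      toReal (Complex.I • (1 : Matrix m m ℂ)) * X) :
    X = toReal (Matrix.of fun c d => ⟨X (c, 0) (d, 0), X (c, 0) (d, 1)⟩) := by
  have e1 : ∀ (c : m × Fin 2) d, (X * toReal (Complex.I • (1 : Matrix m m ℂ))) c (d, 0) =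
      -X c (d, 1) := by
    intro c d
    simp [Matrix.mul_apply, Fintype.sum_prod_type, toReal, rotBlock, Matrix.one_apply,
      apply_ite Complex.im, apply_ite Complex.re]
  have e1' : ∀ (c : m × Fin 2) d, (X * toReal (Complex.I • (1 : Matrix m m ℂ))) c (d, 1) =
      X c (d, 0) := by
    intro c d
    simp [Matrix.mul_apply, Fintype.sum_prod_type, toReal, rotBlock, Matrix.one_apply,
      apply_ite Complex.im, apply_ite Complex.re]
  have e2 : ∀ c (d : m × Fin 2), (toReal (Complex.I • (1 : Matrix m m ℂ)) * X) (c, 0) d =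
      X (c, 1) d := by
    intro c d
    simp [Matrix.mul_apply, Fintype.sum_prod_type, toReal, rotBlock, Matrix.one_apply,
      apply_ite Complex.im, apply_ite Complex.re]
  have h0 : ∀ c d, X (c, 1) (d, 0) = -X (c, 0) (d, 1) := fun c d => by
    rw [← e2, ← h, e1]
  have h1 : ∀ c d, X (c, 1) (d, 1) = X (c, 0) (d, 0) := fun c d => by
    rw [← e2, ← h, e1']
  ext ⟨c, u⟩ ⟨d, v⟩
  fin_cases u <;> fin_cases v <;> simp [toReal, rotBlock, h0, h1]

end ToReal

theorem weyrBlock_eq (w : YoungDiagram) (a : ℝ) : weyrBlock w a = a • 1 + weyrNil w ℝ := by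
  ext c d
  by_cases h : c = d
  · subst h
    have : c.1 ≠ (c.1.1 + 1, c.1.2) := fun h => by
      have := congrArg Prod.fst h
      simp only at this
      omega
    simp [weyrBlock, weyrNil, this]
  · simp [weyrBlock, weyrNil, h]

theorem weyrBlockPair_eq (w : YoungDiagram) (z : ℂ) :
    weyrBlockPair w z = toReal (z • 1 + weyrNil w ℂ) := by
  ext ⟨c, u⟩ ⟨d, v⟩
  by_cases h : c = d
  · subst h
    have : c.1 ≠ (c.1.1 + 1, c.1.2) := fun h => by
      have := congrArg Prod.fst h
      simp only at this
      omega
    simp [weyrBlockPair, weyrNil, this, toReal]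
  · by_cases h' : d.1 = (c.1.1 + 1, c.1.2)
    · fin_cases u <;> fin_cases v <;>
      simp [weyrBlockPair, weyrNil, h, h', toReal, rotBlock]
    · fin_cases u <;> fin_cases v <;>
      simp [weyrBlockPair, weyrNil, h, h', toReal, rotBlock]

/-! ### Blocks with different eigenvalues -/

section Sylvester

variable {m n : Type} [Fintype m] [Fintype n] [DecidableEq m] [DecidableEq n]

/-- Iterating the relation gives `0 = M ^ k * X = X * M' ^ k`, and `M' ^ k` can be cancelled. -/
theorem eq_zero_of_nilpotent_unit {K : Type} [Field K] {M : Matrix m m K} {M' : Matrix n n K}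
    {X : Matrix m n K}
    (hM : IsNilpotent M) (hM' : IsUnit M') (h : M * X = X * M') : X = 0 := by
  obtain ⟨k, hk⟩ := hM
  have h1 : ∀ k, M ^ k * X = X * M' ^ k := by
    intro k
    induction k with
    | zero => simp
    | succ k ih => rw [pow_succ, Matrix.mul_assoc, h, ← Matrix.mul_assoc, ih, Matrix.mul_assoc,
        ← pow_succ]
  have h2 := h1 k
  rw [hk, Matrix.zero_mul] at h2
  have h3 := (Matrix.isUnit_iff_isUnit_det _).1 (hM'.pow k)
  have := congrArg (· * (M' ^ k)⁻¹) h2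
  simpa only [Matrix.mul_assoc, Matrix.mul_nonsing_inv _ h3, Matrix.mul_one, Matrix.zero_mul,
    eq_comm] using this

theorem eq_zero_of_unit_nilpotent {K : Type} [Field K] {M : Matrix m m K} {M' : Matrix n n K}
    {X : Matrix m n K}
    (hM : IsUnit M) (hM' : IsNilpotent M') (h : M * X = X * M') : X = 0 := by
  have : Xᵀ = 0 := by
    refine eq_zero_of_nilpotent_unit (M := M'ᵀ) (M' := Mᵀ) ?_ ?_ ?_
    · obtain ⟨k, hk⟩ := hM'
      exact ⟨k, by rw [← Matrix.transpose_pow, hk, Matrix.transpose_zero]⟩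
    · rw [Matrix.isUnit_iff_isUnit_det] at hM ⊢
      rwa [Matrix.det_transpose]
    · rw [← Matrix.transpose_mul, ← Matrix.transpose_mul, h]
  simpa using this

theorem isUnit_smul_one_add_weyrNil (w : YoungDiagram) {K : Type} [Field K] {z : K} (hz : z ≠ 0) :
    IsUnit (z • 1 + weyrNil w K) := by
  refine (isNilpotent_weyrNil w K).isUnit_add_left_of_commute ?_ ?_
  · rw [Matrix.isUnit_iff_isUnit_det]
    simp [hz]
  · exact (Commute.one_right _).smul_right _

end Sylvester

/-! ### Diagonal blocks -/

/-- `M` is the diagonal block of `A` with the indices in the range of `f`, and the other entries of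
`A` in these rows and columns vanish. -/
structure IsBlock {α β : Type} (A : Matrix β β ℝ) (f : α → β) (M : Matrix α α ℝ) : Prop where
  injective : Function.Injective f
  diag : A.submatrix f f = M
  col_zero : ∀ y, y ∉ range f → ∀ d, A y (f d) = 0
  row_zero : ∀ y, y ∉ range f → ∀ c, A (f c) y = 0

namespace IsBlock

variable {α β : Type} [Fintype α] [Fintype β] {A : Matrix β β ℝ} {f : α → β} {M : Matrix α α ℝ}
  (h : IsBlock A f M)

include h

theorem mul_submatrix {κ : Type} (Z : Matrix κ β ℝ) :
    (Z * A).submatrix id f = Z.submatrix id f * M := by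
  rw [← h.diag]
  ext k d
  symm
  simp only [Matrix.submatrix_apply, Matrix.mul_apply, id]
  refine Finset.sum_of_injOn f h.injective.injOn (by simp) (fun y _ hy => ?_) fun _ _ => rfl
  rw [h.col_zero y (by simpa using hy), mul_zero]

theorem submatrix_mul {κ : Type} (Z : Matrix β κ ℝ) :
    (A * Z).submatrix f id = M * Z.submatrix f id := by
  rw [← h.diag]
  ext k d
  symm
  simp only [Matrix.submatrix_apply, Matrix.mul_apply, id]
  refine Finset.sum_of_injOn f h.injective.injOn (by simp) (fun y _ hy => ?_) fun _ _ => rfl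
  rw [h.row_zero y (by simpa using hy), zero_mul]

theorem commute_submatrix {α' : Type} [Fintype α'] {f' : α' → β} {M' : Matrix α' α' ℝ}
    (h' : IsBlock A f' M') {X : Matrix β β ℝ} (hX : X * A = A * X) :
    M * X.submatrix f f' = X.submatrix f f' * M' := by
  have h1 := congrArg (fun Y => Y.submatrix id f') (h.submatrix_mul X)
  have h2 := congrArg (fun Y => Y.submatrix f id) (h'.mul_submatrix X)
  rw [hX] at h2
  exact h1.symm.trans h2

theorem mul_extend [DecidableEq β] {κ : Type} (V : Matrix α κ ℝ) :
    A * ((1 : Matrix β β ℝ).submatrix id f * V) = (1 : Matrix β β ℝ).submatrix id f * (M * V) := by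
  have e : A * (1 : Matrix β β ℝ).submatrix id f = (1 : Matrix β β ℝ).submatrix id f * M := by
    rw [← h.mul_submatrix, Matrix.one_mul]
    ext y d
    simp [Matrix.mul_apply, Matrix.one_apply]
  rw [← Matrix.mul_assoc, e, Matrix.mul_assoc]

end IsBlock

theorem mul_one_submatrix {α β κ : Type} [Fintype β] [DecidableEq β] (Z : Matrix κ β ℝ)
    (f : α → β) : Z * (1 : Matrix β β ℝ).submatrix id f = Z.submatrix id f := by
  ext k d
  simp [Matrix.mul_apply, Matrix.one_apply]

theorem submatrix_extend {α β κ : Type} [Fintype α] [DecidableEq β]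
    {f : α → β} (hf : Function.Injective f) (V : Matrix α κ ℝ) :
    ((1 : Matrix β β ℝ).submatrix id f * V).submatrix f id = V := by
  classical
  ext c k
  simp [Matrix.mul_apply, Matrix.one_apply, hf.eq_iff]

section Sum

variable {p q : ℕ} {α : Fin p → Type} {β : Fin q → Type} (R : ∀ i, Matrix (α i) (α i) ℝ)
  (C : ∀ j, Matrix (β j) (β j) ℝ)

theorem isBlock_inl (i : Fin p) :
    IsBlock (Matrix.fromBlocks (Matrix.blockDiagonal' R) 0 0 (Matrix.blockDiagonal' C))
      (fun c => Sum.inl ⟨i, c⟩) (R i) where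
  injective := by
    intro c d h
    simpa using h
  diag := by
    ext c d
    simp [Matrix.blockDiagonal'_apply]
  col_zero := by
    rintro (⟨i', c⟩ | y) hy d
    · have : i' ≠ i := by
        rintro rfl
        exact hy ⟨c, rfl⟩
      simp [Matrix.blockDiagonal'_apply, this]
    · simp
  row_zero := by
    rintro (⟨i', c⟩ | y) hy d
    · have : i ≠ i' := by
        rintro rfl
        exact hy ⟨c, rfl⟩
      simp [Matrix.blockDiagonal'_apply, this]
    · simp

theorem isBlock_inr (j : Fin q) :
    IsBlock (Matrix.fromBlocks (Matrix.blockDiagonal' R) 0 0 (Matrix.blockDiagonal' C))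
      (fun c => Sum.inr ⟨j, c⟩) (C j) where
  injective := by
    intro c d h
    simpa using h
  diag := by
    ext c d
    simp [Matrix.blockDiagonal'_apply]
  col_zero := by
    rintro (y | ⟨i', c⟩) hy d
    · simp
    · have : i' ≠ j := by
        rintro rfl
        exact hy ⟨c, rfl⟩
      simp [Matrix.blockDiagonal'_apply, this]
  row_zero := by
    rintro (y | ⟨i', c⟩) hy d
    · simp
    · have : j ≠ i' := by
        rintro rfl
        exact hy ⟨c, rfl⟩
      simp [Matrix.blockDiagonal'_apply, this]

end Sum

/-! ### The commutant of a real Weyr form -/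

/-- The inclusion of the indices of a block with a real eigenvalue. -/
abbrev realEmb (D : WeyrData) (i : Fin D.p) (c : Cell (D.realWeyr i)) : D.Idx := Sum.inl ⟨i, c⟩

/-- The inclusion of the indices of a block with two conjugate eigenvalues. -/
abbrev cplxEmb (D : WeyrData) (j : Fin D.q) (c : Cell (D.cplxWeyr j) × Fin 2) : D.Idx :=
  Sum.inr ⟨j, c⟩

theorem isBlock_real (D : WeyrData) (i : Fin D.p) :
    IsBlock D.mat (realEmb D i) (weyrBlock (D.realWeyr i) (D.realEig i)) :=
  isBlock_inl _ _ i

theorem isBlock_cplx (D : WeyrData) (j : Fin D.q) :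
    IsBlock D.mat (cplxEmb D j) (weyrBlockPair (D.cplxWeyr j) (D.cplxEig j)) :=
  isBlock_inr _ _ j

theorem toReal_real_smul {m n : Type} (t : ℝ) (M : Matrix m n ℂ) :
    toReal ((t : ℂ) • M) = t • toReal M := by
  ext ⟨c, u⟩ ⟨d, v⟩
  fin_cases u <;> fin_cases v <;> simp [toReal, rotBlock]

theorem toReal_sub {m n : Type} (M M' : Matrix m n ℂ) :
    toReal (M - M') = toReal M - toReal M' := by
  rw [eq_sub_iff_add_eq, ← toReal_add, sub_add_cancel]

theorem isNilpotent_toReal {m : Type} [Fintype m] [DecidableEq m] {M : Matrix m m ℂ}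
    (h : IsNilpotent M) : IsNilpotent (toReal M) := by
  obtain ⟨k, hk⟩ := h
  exact ⟨k, by rw [← toReal_pow, hk, toReal_zero]⟩

theorem intertwine_sub_smul {m n : Type} [Fintype m] [Fintype n] [DecidableEq m] [DecidableEq n]
    {M : Matrix m m ℝ} {M' : Matrix n n ℝ} {X : Matrix m n ℝ} (h : M * X = X * M') (t : ℝ) :
    (M - t • 1) * X = X * (M' - t • 1) := by
  simp [Matrix.sub_mul, Matrix.mul_sub, h]

theorem weyrBlock_sub (w : YoungDiagram) (a b : ℝ) :
    weyrBlock w a - b • 1 = (a - b) • 1 + weyrNil w ℝ := by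
  rw [weyrBlock_eq, sub_smul]
  abel

theorem weyrBlockPair_sub (w : YoungDiagram) (z : ℂ) (b : ℝ) :
    weyrBlockPair w z - b • 1 = toReal ((z - b) • 1 + weyrNil w ℂ) := by
  rw [weyrBlockPair_eq, ← toReal_one, ← toReal_real_smul, ← toReal_sub, sub_smul]
  congr 1
  abel

/-- Subtracting `a` on both sides makes one block nilpotent and leaves the other invertible. The
mixed cases below use the same shift. -/
theorem intertwine_real_real {w w' : YoungDiagram} {a a' : ℝ} (ha : a' ≠ a)
    {X : Matrix (Cell w) (Cell w') ℝ} (h : weyrBlock w a * X = X * weyrBlock w' a') : X = 0 := by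
  have h1 := intertwine_sub_smul h a
  rw [weyrBlock_sub, weyrBlock_sub, sub_self, zero_smul, zero_add] at h1
  exact eq_zero_of_nilpotent_unit (isNilpotent_weyrNil _ _)
    (isUnit_smul_one_add_weyrNil _ (sub_ne_zero.2 ha)) h1

theorem sub_ofReal_ne_zero {z : ℂ} (hz : z.im ≠ 0) (a : ℝ) : z - a ≠ 0 := by
  intro h
  apply hz
  simpa using congrArg Complex.im h

theorem intertwine_real_cplx {w w' : YoungDiagram} {a : ℝ} {z : ℂ} (hz : z.im ≠ 0)
    {X : Matrix (Cell w) (Cell w' × Fin 2) ℝ} (h : weyrBlock w a * X = X * weyrBlockPair w' z) :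
    X = 0 := by
  have h1 := intertwine_sub_smul h a
  rw [weyrBlock_sub, weyrBlockPair_sub, sub_self, zero_smul, zero_add] at h1
  exact eq_zero_of_nilpotent_unit (isNilpotent_weyrNil _ _)
    (isUnit_toReal (isUnit_smul_one_add_weyrNil _ (sub_ofReal_ne_zero hz a))) h1

theorem intertwine_cplx_real {w w' : YoungDiagram} {a : ℝ} {z : ℂ} (hz : z.im ≠ 0)
    {X : Matrix (Cell w' × Fin 2) (Cell w) ℝ} (h : weyrBlockPair w' z * X = X * weyrBlock w a) :
    X = 0 := by
  have h1 := intertwine_sub_smul h a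
  rw [weyrBlock_sub, weyrBlockPair_sub, sub_self, zero_smul, zero_add] at h1
  exact eq_zero_of_unit_nilpotent
    (isUnit_toReal (isUnit_smul_one_add_weyrNil _ (sub_ofReal_ne_zero hz a)))
    (isNilpotent_weyrNil _ _) h1

/-- The real quadratic polynomial with the roots `z`, `conj z`, at a complex Weyr block. -/
theorem quadratic_weyrBlockPair (w : YoungDiagram) (z z' : ℂ) :
    weyrBlockPair w z' * weyrBlockPair w z' - (2 * z.re) • weyrBlockPair w z' +
      (z.re ^ 2 + z.im ^ 2) • 1 =
    toReal (((z' - z) • 1 + weyrNil w ℂ) * ((z' - starRingEnd ℂ z) • 1 + weyrNil w ℂ)) := by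
  rw [weyrBlockPair_eq, ← toReal_mul, ← toReal_one, ← toReal_real_smul, ← toReal_real_smul,
    ← toReal_sub, ← toReal_add]
  congr 1
  have h1 : z + starRingEnd ℂ z = ((2 * z.re : ℝ) : ℂ) := by rw [Complex.add_conj]
  have h2 : z * starRingEnd ℂ z = ((z.re ^ 2 + z.im ^ 2 : ℝ) : ℂ) := by
    rw [Complex.mul_conj, Complex.normSq_apply]
    congr 1
    ring
  rw [← h1, ← h2]
  simp only [Matrix.add_mul, Matrix.mul_add, Matrix.smul_mul, Matrix.mul_smul, Matrix.one_mul,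
    Matrix.mul_one, smul_add, smul_smul]
  module

/-- A shift by `z` is not available, since the intertwining matrix is only real. The real quadratic
polynomial with roots `z`, `conj z` takes its place: it is nilpotent at the first block and
invertible at the second. -/
theorem intertwine_cplx_cplx {w w' : YoungDiagram} {z z' : ℂ} (h1 : z' ≠ z)
    (h2 : z' ≠ starRingEnd ℂ z) {X : Matrix (Cell w × Fin 2) (Cell w' × Fin 2) ℝ}
    (h : weyrBlockPair w z * X = X * weyrBlockPair w' z') : X = 0 := by
  have h3 : (weyrBlockPair w z * weyrBlockPair w z - (2 * z.re) • weyrBlockPair w z +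
      (z.re ^ 2 + z.im ^ 2) • 1) * X = X * (weyrBlockPair w' z' * weyrBlockPair w' z' -
      (2 * z.re) • weyrBlockPair w' z' + (z.re ^ 2 + z.im ^ 2) • 1) := by
    simp only [Matrix.add_mul, Matrix.mul_add, Matrix.sub_mul, Matrix.mul_sub, Matrix.smul_mul,
      Matrix.mul_smul, Matrix.one_mul, Matrix.mul_one, h, Matrix.mul_assoc]
    simp only [← Matrix.mul_assoc, h]
  rw [quadratic_weyrBlockPair, quadratic_weyrBlockPair, sub_self, zero_smul, zero_add] at h3
  refine eq_zero_of_nilpotent_unit (isNilpotent_toReal ?_) (isUnit_toReal ?_) h3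
  · refine Commute.isNilpotent_mul_right ?_ (isNilpotent_weyrNil w ℂ)
    exact ((Commute.one_right _).smul_right _).add_right (Commute.refl _)
  · exact (isUnit_smul_one_add_weyrNil _ (sub_ne_zero.2 h1)).mul
      (isUnit_smul_one_add_weyrNil _ (sub_ne_zero.2 h2))

/-- A real matrix that commutes with a Weyr block of two conjugate eigenvalues comes from a complex
matrix that commutes with the nilpotent part. -/
theorem exists_eq_toReal {w : YoungDiagram} {z : ℂ} (hz : z.im ≠ 0)
    {X : Matrix (Cell w × Fin 2) (Cell w × Fin 2) ℝ}
    (h : weyrBlockPair w z * X = X * weyrBlockPair w z) :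
    ∃ Y : Matrix (Cell w) (Cell w) ℂ, X = toReal Y ∧ Y * weyrNil w ℂ = weyrNil w ℂ * Y := by
  set J := toReal (Complex.I • (1 : Matrix (Cell w) (Cell w) ℂ)) with hJ
  set U := toReal (weyrNil w ℂ) with hU
  have hJJ : J * J = -1 := by
    rw [hJ, ← toReal_mul, ← toReal_one]
    simp only [Matrix.smul_mul, Matrix.mul_smul, Matrix.one_mul, smul_smul, Complex.I_mul_I]
    have := toReal_real_smul (-1) (1 : Matrix (Cell w) (Cell w) ℂ)
    simpa using this
  have hUJ : U * J = J * U := by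
    rw [hJ, hU, ← toReal_mul, ← toReal_mul]
    simp
  have hW : weyrBlockPair w z = z.re • 1 + z.im • J + U := by
    rw [weyrBlockPair_eq, hJ, hU, ← toReal_one, ← toReal_real_smul, ← toReal_real_smul,
      ← toReal_add, ← toReal_add, smul_smul, ← add_smul, Complex.re_add_im]
  have hUX : U * X - X * U = z.im • (X * J - J * X) := by
    rw [hW] at h
    simp only [Matrix.add_mul, Matrix.mul_add, Matrix.smul_mul, Matrix.mul_smul, Matrix.one_mul,
      Matrix.mul_one] at h
    linear_combination (norm := module) h
  -- The commutator `C = X J - J X` anticommutes with `J`, since `J² = -1`. As `U` commutes with `J`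
  -- and `U X - X U = z.im • C`, this gives `U C = C (2 z.im J + U)`, where `U` is nilpotent and the
  -- other factor invertible.
  have hcomm : X * J - J * X = 0 := by
    have hunit : IsUnit ((2 * z.im) • J + U) := by
      have : (2 * z.im) • J + U = toReal (((2 * z.im : ℝ) * Complex.I : ℂ) • 1 + weyrNil w ℂ) := by
        rw [toReal_add, mul_smul ((2 * z.im : ℝ) : ℂ) Complex.I, toReal_real_smul]
      rw [this]
      refine isUnit_toReal (isUnit_smul_one_add_weyrNil _ ?_)
      simp [hz]
    refine eq_zero_of_nilpotent_unit (isNilpotent_toReal (isNilpotent_weyrNil w ℂ)) hunit ?_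
    have e : U * (X * J - J * X) = (U * X - X * U) * J - J * (U * X - X * U) +
        (X * J - J * X) * U := by
      simp only [Matrix.mul_sub, Matrix.sub_mul, ← Matrix.mul_assoc, hUJ]
      simp only [Matrix.mul_assoc, hUJ]
      abel
    have e1 : J * (X * J) = J * X * J := (Matrix.mul_assoc _ _ _).symm
    have e2 : J * (J * X) = -X := by rw [← Matrix.mul_assoc, hJJ, Matrix.neg_mul, Matrix.one_mul]
    have e3 : X * J * J = -X := by rw [Matrix.mul_assoc, hJJ, Matrix.mul_neg, Matrix.mul_one]
    rw [← hU, e, hUX, Matrix.mul_add]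
    congr 1
    simp only [Matrix.smul_mul, Matrix.mul_smul, Matrix.mul_sub, Matrix.sub_mul, e1, e2, e3]
    module
  have hX := eq_toReal_of_comm (sub_eq_zero.1 hcomm)
  refine ⟨_, hX, ?_⟩
  rw [hcomm, smul_zero, hX, hU, ← toReal_mul, ← toReal_mul, ← toReal_sub] at hUX
  exact (sub_eq_zero.1 (toReal_injective (hUX.trans toReal_zero.symm))).symm

section Centralizer

variable {D : WeyrData} {X : Matrix D.Idx D.Idx ℝ} (hX : X * D.mat = D.mat * X)

include hX

/-- An off-diagonal block of `X` intertwines two blocks of `A` without common eigenvalues, so it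
vanishes. -/
theorem isBlock_real_of_comm (i : Fin D.p) :
    IsBlock X (realEmb D i) (X.submatrix (realEmb D i) (realEmb D i)) where
  injective := (isBlock_real D i).injective
  diag := rfl
  col_zero := by
    rintro (⟨i', c⟩ | ⟨j, c⟩) hy d
    · have hi : i' ≠ i := by
        rintro rfl
        exact hy ⟨c, rfl⟩
      exact congrFun₂ (intertwine_real_real (D.realEig_injective.ne hi.symm)
        ((isBlock_real D i').commute_submatrix (isBlock_real D i) hX)) c d
    · exact congrFun₂ (intertwine_cplx_real (D.cplxEig_im j)
        ((isBlock_cplx D j).commute_submatrix (isBlock_real D i) hX)) c d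
  row_zero := by
    rintro (⟨i', c⟩ | ⟨j, c⟩) hy d
    · have hi : i' ≠ i := by
        rintro rfl
        exact hy ⟨c, rfl⟩
      exact congrFun₂ (intertwine_real_real (D.realEig_injective.ne hi)
        ((isBlock_real D i).commute_submatrix (isBlock_real D i') hX)) d c
    · exact congrFun₂ (intertwine_real_cplx (D.cplxEig_im j)
        ((isBlock_real D i).commute_submatrix (isBlock_cplx D j) hX)) d c

theorem isBlock_cplx_of_comm (j : Fin D.q) :
    IsBlock X (cplxEmb D j) (X.submatrix (cplxEmb D j) (cplxEmb D j)) where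
  injective := (isBlock_cplx D j).injective
  diag := rfl
  col_zero := by
    rintro (⟨i', c⟩ | ⟨j', c⟩) hy d
    · exact congrFun₂ (intertwine_real_cplx (D.cplxEig_im j)
        ((isBlock_real D i').commute_submatrix (isBlock_cplx D j) hX)) c d
    · have hj : j' ≠ j := by
        rintro rfl
        exact hy ⟨c, rfl⟩
      exact congrFun₂ (intertwine_cplx_cplx (D.cplxEig_injective.ne hj.symm) (D.cplxEig_conj _ _)
        ((isBlock_cplx D j').commute_submatrix (isBlock_cplx D j) hX)) c d
  row_zero := by
    rintro (⟨i', c⟩ | ⟨j', c⟩) hy d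
    · exact congrFun₂ (intertwine_cplx_real (D.cplxEig_im j)
        ((isBlock_cplx D j).commute_submatrix (isBlock_real D i') hX)) d c
    · have hj : j' ≠ j := by
        rintro rfl
        exact hy ⟨c, rfl⟩
      exact congrFun₂ (intertwine_cplx_cplx (D.cplxEig_injective.ne hj) (D.cplxEig_conj _ _)
        ((isBlock_cplx D j).commute_submatrix (isBlock_cplx D j') hX)) d c

theorem realBlock_comm (i : Fin D.p) :
    X.submatrix (realEmb D i) (realEmb D i) * weyrNil _ ℝ =
      weyrNil _ ℝ * X.submatrix (realEmb D i) (realEmb D i) := by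
  have h := (isBlock_real D i).commute_submatrix (isBlock_real D i) hX
  have h1 := intertwine_sub_smul h (D.realEig i)
  rw [weyrBlock_sub, sub_self, zero_smul, zero_add] at h1
  exact h1.symm

theorem cplxBlock_comm (j : Fin D.q) :
    ∃ Y : Matrix (Cell (D.cplxWeyr j)) (Cell (D.cplxWeyr j)) ℂ,
      X.submatrix (cplxEmb D j) (cplxEmb D j) = toReal Y ∧
        Y * weyrNil _ ℂ = weyrNil _ ℂ * Y :=
  exists_eq_toReal (D.cplxEig_im j) ((isBlock_cplx D j).commute_submatrix (isBlock_cplx D j) hX)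

end Centralizer

/-! ### Multi-indices and the commutant -/

namespace MultiIndex

variable {D : WeyrData} {r : ℕ} (I : MultiIndex D r)

theorem isUnit_toCplx_minor {Z : Matrix (Fin r) D.Idx ℝ} (hZ : I.Admissible Z) (j : Fin D.q)
    (t : ℕ) : IsUnit ((toCplx (cplxCols Z j)).submatrix ((I.cplx j).idx ∘ IndexSeq.incl _ t)
      (topCell _ ∘ IndexSeq.incl _ t)) :=
  isUnit_toReal_iff.1 (hZ.2 j t)

/-- An element of the commutant is determined by the fixed entries of its product with an
admissible matrix. -/
theorem eq_zero_of_fixed {Z : Matrix (Fin r) D.Idx ℝ} (hZ : I.Admissible Z)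
    {X : Matrix D.Idx D.Idx ℝ} (hX : X * D.mat = D.mat * X)
    (h : ∀ ρ c, I.Fixed ρ c → (Z * X) ρ c = 0) : X = 0 := by
  have hr : ∀ i, X.submatrix (realEmb D i) (realEmb D i) = 0 := by
    intro i
    refine commutant_eq_zero (realBlock_comm hX i) (I.real i) (realCols Z i) (hZ.1 i) ?_
    intro a c hac
    have := congrFun₂ ((isBlock_real_of_comm hX i).mul_submatrix Z) ((I.real i).idx a) c
    exact this.symm.trans (h _ _ ⟨a, rfl, hac⟩)
  have hc : ∀ j, X.submatrix (cplxEmb D j) (cplxEmb D j) = 0 := by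
    intro j
    obtain ⟨Y, hY, hYN⟩ := cplxBlock_comm hX j
    have : Y = 0 := by
      refine commutant_eq_zero hYN (I.cplx j) (toCplx (cplxCols Z j))
        (fun t => I.isUnit_toCplx_minor hZ j t) ?_
      intro a c hac
      have e := (isBlock_cplx_of_comm hX j).mul_submatrix Z
      rw [hY] at e
      rw [← toCplx_mul_toReal]
      change toCplx (Z.submatrix id (cplxEmb D j) * toReal Y) _ _ = 0
      rw [← e]
      exact Complex.ext (h _ _ ⟨a, rfl, hac⟩) (h _ _ ⟨a, rfl, hac⟩)
    rw [hY, this, toReal_zero]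
  ext x y
  rcases y with ⟨i, d⟩ | ⟨j, d⟩
  · by_cases hx : x ∈ range (realEmb D i)
    · obtain ⟨c, rfl⟩ := hx
      exact congrFun₂ (hr i) c d
    · exact (isBlock_real_of_comm hX i).col_zero x hx d
  · by_cases hx : x ∈ range (cplxEmb D j)
    · obtain ⟨c, rfl⟩ := hx
      exact congrFun₂ (hc j) c d
    · exact (isBlock_cplx_of_comm hX j).col_zero x hx d

open Classical in
/-- The fixed entries of a matrix in reduced form. -/
def fixedVal (ρ : Fin r) (c : D.Idx) : ℝ := if I.FixedOne ρ c then 1 else 0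

theorem fixedVal_real {i : Fin D.p} (a : Fin ((D.realWeyr i).rowLen 0)) (c : Cell (D.realWeyr i)) :
    I.fixedVal ((I.real i).idx a) (Sum.inl ⟨i, c⟩) = if c = topCell _ a then 1 else 0 := by
  have : I.FixedOne ((I.real i).idx a) (Sum.inl ⟨i, c⟩) ↔ c = topCell _ a := by
    refine ⟨?_, fun h => ⟨a, rfl, h⟩⟩
    rintro ⟨a', ha', hc⟩
    rwa [(I.real i).injective ha'] at hc
  simp only [fixedVal, this]

theorem fixedVal_cplx {j : Fin D.q} (a : Fin ((D.cplxWeyr j).rowLen 0)) (c : Cell (D.cplxWeyr j))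
    (u : Fin 2) : I.fixedVal ((I.cplx j).idx a) (Sum.inr ⟨j, c, u⟩) =
      if c = topCell _ a ∧ u = 0 then 1 else 0 := by
  have : I.FixedOne ((I.cplx j).idx a) (Sum.inr ⟨j, c, u⟩) ↔ c = topCell _ a ∧ u = 0 := by
    refine ⟨?_, fun h => ⟨⟨a, rfl, h.1⟩, h.2⟩⟩
    rintro ⟨⟨a', ha', hc⟩, hu⟩
    rw [(I.cplx j).injective ha'] at hc
    exact ⟨hc, hu⟩
  simp only [fixedVal, this]

/-- This puts real and complex blocks on the same footing. For a pair, the first row of each `2 × 2`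
block carries the whole condition, since `diamond` builds the second row from it. -/
theorem reduced_iff {Z : Matrix (Fin r) D.Idx ℝ} :
    I.Reduced Z ↔ ∀ ρ c, I.Fixed ρ c → Z ρ c = I.fixedVal ρ c := by
  constructor
  · rintro ⟨h1, h2⟩ ρ (⟨i, c⟩ | ⟨j, c, u⟩)
    · rintro ⟨a, rfl, hac⟩
      rw [fixedVal_real]
      exact h1 i a c hac
    · rintro ⟨a, rfl, hac⟩
      rw [fixedVal_cplx]
      refine Eq.trans ?_ ((h2 j a c hac 0 u).trans
        (if_congr (and_congr_right fun _ => eq_comm) rfl rfl))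
      fin_cases u <;> rfl
  · intro h
    refine ⟨fun i a c hac => ?_, fun j a c hac u v => ?_⟩
    · rw [← fixedVal_real]
      exact h _ _ ⟨a, rfl, hac⟩
    · have h0 : ∀ u, (cplxCols Z j) ((I.cplx j).idx a) (c, u) = _ :=
        fun u => (h _ (Sum.inr ⟨j, c, u⟩) ⟨a, rfl, hac⟩).trans (I.fixedVal_cplx a c u)
      fin_cases u <;> fin_cases v <;> simp [diamond, h0]

theorem fixed_entries_toCplx {Z : Matrix (Fin r) D.Idx ℝ} (hZ : I.Reduced Z) (j : Fin D.q)
    (a : Fin ((D.cplxWeyr j).rowLen 0)) (c : Cell (D.cplxWeyr j)) (hac : IndexSeq.IsFixed a c) :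
    toCplx (cplxCols Z j) ((I.cplx j).idx a) c = if c = topCell _ a then 1 else 0 := by
  have h := I.reduced_iff.1 hZ
  have h0 : ∀ u, (cplxCols Z j) ((I.cplx j).idx a) (c, u) = _ :=
        fun u => (h _ (Sum.inr ⟨j, c, u⟩) ⟨a, rfl, hac⟩).trans (I.fixedVal_cplx a c u)
  apply Complex.ext <;> simp [toCplx, h0, apply_ite Complex.re, apply_ite Complex.im]

/-- Column lengths decrease, so all places on and above the diagonal of the minor are fixed: the
minor is lower triangular with ones on its diagonal. -/
theorem isUnit_minor_of_fixed {w : YoungDiagram} {K : Type} [Field K] (s : IndexSeq w r)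
    {Z : Matrix (Fin r) (Cell w) K}
    (hZ : ∀ a c, IndexSeq.IsFixed a c → Z (s.idx a) c = if c = topCell w a then 1 else 0) (t : ℕ) :
    IsUnit (Z.submatrix (s.idx ∘ IndexSeq.incl w t) (topCell w ∘ IndexSeq.incl w t)) := by
  have h : ∀ a b : Fin (w.rowLen t), a ≤ b → Z (s.idx (IndexSeq.incl w t a))
      (topCell w (IndexSeq.incl w t b)) = if b = a then 1 else 0 := by
    intro a b hab
    have hf : IndexSeq.IsFixed (IndexSeq.incl w t a) (topCell w (IndexSeq.incl w t b)) :=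
      w.colLen_anti a b hab
    rw [hZ _ _ hf]
    refine if_congr ?_ rfl rfl
    exact ((topCell_injective w).comp (incl_injective w t)).eq_iff (a := b) (b := a)
  rw [Matrix.isUnit_iff_isUnit_det, Matrix.det_of_isLowerTriangular]
  · refine isUnit_iff_ne_zero.2 (Finset.prod_ne_zero_iff.2 fun a _ => ?_)
    simp [h a a le_rfl]
  · intro a b hab
    have hab : a < b := hab
    simp [h a b hab.le, hab.ne']

theorem admissible_of_reduced {Z : Matrix (Fin r) D.Idx ℝ} (hZ : I.Reduced Z) : I.Admissible Z :=
  ⟨fun i => isUnit_minor_of_fixed (I.real i) (hZ.1 i),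
    fun j t => isUnit_toReal (isUnit_minor_of_fixed (I.cplx j) (I.fixed_entries_toCplx hZ j) t)⟩

open Classical in
/-- An element of the commutant, built from its fixed entries. -/
def commutantElt (y : Fin r → D.Idx → ℝ) : Matrix D.Idx D.Idx ℝ :=
  Matrix.fromBlocks
    (Matrix.blockDiagonal' fun i => commutantOf fun a c =>
      if IndexSeq.IsFixed a c then y ((I.real i).idx a) (Sum.inl ⟨i, c⟩) else 0) 0 0
    (Matrix.blockDiagonal' fun j => toReal (commutantOf fun a c =>
      if IndexSeq.IsFixed a c then ⟨y ((I.cplx j).idx a) (Sum.inr ⟨j, c, 0⟩),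
        y ((I.cplx j).idx a) (Sum.inr ⟨j, c, 1⟩)⟩ else 0))

theorem commutantElt_comm (y : Fin r → D.Idx → ℝ) :
    I.commutantElt y * D.mat = D.mat * I.commutantElt y := by
  rw [commutantElt, WeyrData.mat, Matrix.fromBlocks_multiply, Matrix.fromBlocks_multiply]
  simp only [Matrix.mul_zero, Matrix.zero_mul, add_zero, zero_add, ← Matrix.blockDiagonal'_mul]
  congr 2
  · funext i
    rw [weyrBlock_eq, Matrix.mul_add, Matrix.add_mul, commutantOf_comm]
    · simp
    · exact fun a c h => if_neg h
  · funext j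
    rw [weyrBlockPair_eq, ← toReal_mul, ← toReal_mul, Matrix.mul_add, Matrix.add_mul,
      commutantOf_comm]
    · simp
    · exact fun a c h => if_neg h

/-- The matrix in reduced form whose free entries vanish. -/
def baseRows : Matrix (Fin r) D.Idx ℝ := Matrix.of I.fixedVal

theorem reduced_baseRows : I.Reduced I.baseRows := I.reduced_iff.2 fun _ _ _ => rfl

/-- Within the block, row `idx a` of `baseRows` is a unit vector, so the product reads off row
`topCell a` of the commuting matrix, where the prescribed entries are. -/
theorem baseRows_mul_commutantElt (y : Fin r → D.Idx → ℝ) (ρ : Fin r) (c : D.Idx)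
    (h : I.Fixed ρ c) : (I.baseRows * I.commutantElt y) ρ c = y ρ c := by
  rcases c with ⟨i, c⟩ | ⟨j, c, u⟩
  · obtain ⟨a, rfl, hac⟩ := h
    have hb := isBlock_inl (fun i => commutantOf fun a c =>
      open Classical in
      if IndexSeq.IsFixed a c then y ((I.real i).idx a) (Sum.inl ⟨i, c⟩) else 0)
      (fun j => toReal (commutantOf fun a c =>
      open Classical in
      if IndexSeq.IsFixed a c then ⟨y ((I.cplx j).idx a) (Sum.inr ⟨j, c, 0⟩),
        y ((I.cplx j).idx a) (Sum.inr ⟨j, c, 1⟩)⟩ else 0)) i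
    refine (congrFun₂ (hb.mul_submatrix I.baseRows) ((I.real i).idx a) c).trans ?_
    rw [Matrix.mul_apply, Finset.sum_eq_single (topCell _ a)]
    · rw [commutantOf_topCell, if_pos hac]
      simp [baseRows, fixedVal_real]
    · intro b _ hb
      simp [baseRows, fixedVal_real, hb]
    · simp
  · obtain ⟨a, rfl, hac⟩ := h
    have hb := isBlock_inr (fun i => commutantOf fun a c =>
      open Classical in
      if IndexSeq.IsFixed a c then y ((I.real i).idx a) (Sum.inl ⟨i, c⟩) else 0)
      (fun j => toReal (commutantOf fun a c =>
      open Classical in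
      if IndexSeq.IsFixed a c then ⟨y ((I.cplx j).idx a) (Sum.inr ⟨j, c, 0⟩),
        y ((I.cplx j).idx a) (Sum.inr ⟨j, c, 1⟩)⟩ else 0)) j
    refine (congrFun₂ (hb.mul_submatrix I.baseRows) ((I.cplx j).idx a) (c, u)).trans ?_
    rw [Matrix.mul_apply, Finset.sum_eq_single (topCell _ a, 0)]
    · simp only [toReal, Matrix.of_apply]
      rw [commutantOf_topCell, if_pos hac]
      fin_cases u <;> simp [baseRows, fixedVal_cplx, rotBlock]
    · rintro ⟨b, v⟩ _ hb
      have : ¬ (b = topCell _ a ∧ v = 0) := fun h => hb (by rw [h.1, h.2])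
      simp [baseRows, fixedVal_cplx, this]
    · simp

end MultiIndex

/-- The commutant of the real Weyr form, as a linear space. -/
abbrev Cent (D : WeyrData) : Type :=
  Subalgebra.centralizer ℝ ({D.mat} : Set (Matrix D.Idx D.Idx ℝ))

theorem mem_cent_iff {D : WeyrData} {X : Matrix D.Idx D.Idx ℝ} :
    X ∈ Subalgebra.centralizer ℝ ({D.mat} : Set (Matrix D.Idx D.Idx ℝ)) ↔
      X * D.mat = D.mat * X := by
  rw [Subalgebra.mem_centralizer_iff]
  simp [eq_comm]

namespace MultiIndex

variable {D : WeyrData} {r : ℕ} (I : MultiIndex D r)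

/-- The fixed places of the first `r` rows in a reduced form. -/
abbrev FixedPlace : Type := {x : Fin r × D.Idx // I.Fixed x.1 x.2}

/-- The linear map that takes `X` to the fixed entries of `Z X`. -/
def fixedEntries (Z : Matrix (Fin r) D.Idx ℝ) : Cent D →ₗ[ℝ] (I.FixedPlace → ℝ) where
  toFun X x := (Z * X.1) x.1.1 x.1.2
  map_add' X Y := by
    ext x
    simp [Matrix.mul_add]
  map_smul' t X := by
    ext x
    simp

theorem fixedEntries_injective {Z : Matrix (Fin r) D.Idx ℝ} (hZ : I.Admissible Z) :
    Function.Injective (I.fixedEntries Z) := by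
  refine (injective_iff_map_eq_zero _).2 fun X hX => Subtype.ext ?_
  exact I.eq_zero_of_fixed hZ (mem_cent_iff.1 X.2) fun ρ c h => congrFun hX ⟨(ρ, c), h⟩

theorem fixedEntries_baseRows_surjective : Function.Surjective (I.fixedEntries I.baseRows) := by
  classical
  intro y
  obtain ⟨y', hy'⟩ : ∃ y' : Fin r → D.Idx → ℝ, ∀ x : I.FixedPlace, y' x.1.1 x.1.2 = y x :=
    ⟨fun ρ c => if h : I.Fixed ρ c then y ⟨(ρ, c), h⟩ else 0, fun x => dif_pos x.2⟩
  refine ⟨⟨I.commutantElt y', mem_cent_iff.2 (I.commutantElt_comm _)⟩, ?_⟩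
  ext x
  exact (I.baseRows_mul_commutantElt y' _ _ x.2).trans (hy' x)

/-- For `baseRows` the map to the fixed entries is a linear isomorphism. Only the count is kept, and
it makes injectivity sufficient for every other matrix. -/
theorem centDim_eq : D.centDim = Nat.card I.FixedPlace := by
  classical
  have e := LinearEquiv.ofBijective _
    ⟨I.fixedEntries_injective (I.admissible_of_reduced I.reduced_baseRows),
      I.fixedEntries_baseRows_surjective⟩
  rw [WeyrData.centDim, e.finrank_eq, Module.finrank_fintype_fun_eq_card,
    Nat.card_eq_fintype_card]

theorem exists_mul_fixed {Z : Matrix (Fin r) D.Idx ℝ}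
    (hZ : Function.Injective (I.fixedEntries Z)) (y : Fin r → D.Idx → ℝ) :
    ∃ X : Matrix D.Idx D.Idx ℝ, X * D.mat = D.mat * X ∧
      ∀ ρ c, I.Fixed ρ c → (Z * X) ρ c = y ρ c := by
  classical
  have hd : Module.finrank ℝ (Cent D) = Module.finrank ℝ (I.FixedPlace → ℝ) := by
    rw [Module.finrank_fintype_fun_eq_card, ← Nat.card_eq_fintype_card, ← centDim_eq]
    rfl
  obtain ⟨X, hX⟩ := (LinearMap.injective_iff_surjective_of_finrank_eq_finrank hd).1 hZ
    fun x => y x.1.1 x.1.2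
  exact ⟨X.1, mem_cent_iff.1 X.2, fun ρ c h => congrFun hX ⟨(ρ, c), h⟩⟩

theorem card_free_add : Nat.card I.Free + D.centDim = r * Fintype.card D.Idx := by
  classical
  rw [I.centDim_eq, Nat.card_eq_fintype_card, Nat.card_eq_fintype_card, add_comm,
    Fintype.card_subtype_compl, Nat.add_sub_cancel' (Fintype.card_subtype_le _)]
  simp

theorem rows_apply_fixed {d : ℕ} (e : I.Free ≃ Fin d) (x : EuclideanSpace ℝ (Fin d)) {ρ : Fin r}
    {c : D.Idx} (h : I.Fixed ρ c) : I.rows e x ρ c = I.fixedVal ρ c := by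
  simp [rows, h, fixedVal]

theorem rows_apply_free {d : ℕ} (e : I.Free ≃ Fin d) (x : EuclideanSpace ℝ (Fin d)) {ρ : Fin r}
    {c : D.Idx} (h : ¬ I.Fixed ρ c) : I.rows e x ρ c = x (e ⟨(ρ, c), h⟩) := by
  simp [rows, h]

theorem reduced_rows {d : ℕ} (e : I.Free ≃ Fin d) (x : EuclideanSpace ℝ (Fin d)) :
    I.Reduced (I.rows e x) :=
  I.reduced_iff.2 fun _ _ h => I.rows_apply_fixed e x h

/-- The free entries of a matrix. -/
def freeEntries {d : ℕ} (e : I.Free ≃ Fin d) (Z : Matrix (Fin r) D.Idx ℝ) :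
    EuclideanSpace ℝ (Fin d) :=
  WithLp.toLp 2 fun k => Z (e.symm k).1.1 (e.symm k).1.2

theorem freeEntries_rows {d : ℕ} (e : I.Free ≃ Fin d) (x : EuclideanSpace ℝ (Fin d)) :
    I.freeEntries e (I.rows e x) = x := by
  ext k
  simp [freeEntries, I.rows_apply_free e x (e.symm k).2]

theorem rows_freeEntries {d : ℕ} (e : I.Free ≃ Fin d) {Z : Matrix (Fin r) D.Idx ℝ}
    (hZ : I.Reduced Z) : I.rows e (I.freeEntries e Z) = Z := by
  ext ρ c
  by_cases h : I.Fixed ρ c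
  · rw [I.rows_apply_fixed e _ h, I.reduced_iff.1 hZ ρ c h]
  · rw [I.rows_apply_free e _ h]
    simp [freeEntries]

end MultiIndex

/-! ### Existence of multi-indices -/

/-- The column space of `U` is `A`-invariant, so if `Z` annihilates it, then so does every `Z A ^
k`. This is used for eigenvectors, and for real planes spanned by complex eigenvectors. -/
theorem observability_mul_eq_zero {ι κ : Type} [Fintype ι] [DecidableEq ι] [Fintype κ]
    {μ : YoungDiagram} {A : Matrix ι ι ℝ} {Z : Matrix (Fin (μ.rowLen 0)) ι ℝ} {U : Matrix ι κ ℝ}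
    {S : Matrix κ κ ℝ} (h : A * U = U * S) (hZ : Z * U = 0) : observability μ A Z * U = 0 := by
  classical
  have hp : ∀ k, Z * A ^ k * U = 0 := by
    intro k
    have : A ^ k * U = U * S ^ k := by
      induction k with
      | zero => simp
      | succ k ih =>
        rw [pow_succ', Matrix.mul_assoc, ih, ← Matrix.mul_assoc, h, Matrix.mul_assoc, ← pow_succ']
    rw [Matrix.mul_assoc, this, ← Matrix.mul_assoc, hZ, Matrix.zero_mul]
  ext c k
  exact congrFun₂ (hp c.1.1) c.pos k

/-- The extension by zero of a vector on the first block of a Weyr block. -/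
def topVec {w : YoungDiagram} {K : Type} [Field K] (v : Fin (w.rowLen 0) → K) :
    Matrix (Cell w) (Fin 1) K :=
  Matrix.of fun c _ => if c.1.1 = 0 then v c.pos else 0

theorem weyrNil_mul_topVec {w : YoungDiagram} {K : Type} [Field K] (v : Fin (w.rowLen 0) → K) :
    weyrNil w K * topVec v = 0 := by
  ext c k
  by_cases hc : (c.1.1 + 1, c.1.2) ∈ w.cells
  · rw [weyrNil_mul_apply_succ _ c ⟨_, hc⟩ k rfl]
    simp [topVec]
  · rw [weyrNil_mul_apply_last _ _ _ hc]
    rfl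

theorem mul_topVec {w : YoungDiagram} {K κ : Type} [Field K] (Z : Matrix κ (Cell w) K)
    (v : Fin (w.rowLen 0) → K) (ρ : κ) (k : Fin 1) :
    (Z * topVec v) ρ k = (Z.submatrix id (topCell w) *ᵥ v) ρ := by
  symm
  rw [Matrix.mul_apply]
  simp only [Matrix.mulVec, dotProduct]
  refine Finset.sum_of_injOn (topCell w) (topCell_injective w).injOn (by simp) ?_ ?_
  · intro c _ hc
    have : c.1.1 ≠ 0 := fun h => hc ⟨c.pos, by simp, (c.eq_topCell h).symm⟩
    simp [topVec, this]
  · intro a _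
    simp [topVec, topCell, Cell.pos]

theorem topVec_eq_zero {w : YoungDiagram} {K : Type} [Field K] {v : Fin (w.rowLen 0) → K}
    (h : topVec v = 0) : v = 0 := by
  ext a
  have := congrFun₂ h (topCell w a) 0
  simpa [topVec, topCell, Cell.pos] using this

/-- Some multi-index is admissible for each nonsingular truncated observability matrix. -/
theorem exists_multiIndex {μ : YoungDiagram} {D : WeyrData}
    {Z : Matrix (Fin (μ.rowLen 0)) D.Idx ℝ}
    (hZ : ∀ (κ : Type) [Fintype κ] (U : Matrix D.Idx κ ℝ),
      observability μ D.mat Z * U = 0 → U = 0) :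
    ∃ I : MultiIndex D (μ.rowLen 0), I.Admissible Z := by
  have hr : ∀ i, ∃ s : IndexSeq (D.realWeyr i) (μ.rowLen 0), s.Admissible (realCols Z i) := by
    intro i
    refine exists_indexSeq (realCols Z i) fun v hv => ?_
    -- A dependency `v` between the columns of `Z₁` is an eigenvector of `A` annihilated by `Z`,
    -- contrary to full column rank.
    have h1 : weyrBlock (D.realWeyr i) (D.realEig i) * topVec v =
        topVec v * (D.realEig i • (1 : Matrix (Fin 1) (Fin 1) ℝ)) := by
      rw [weyrBlock_eq, Matrix.add_mul, weyrNil_mul_topVec]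
      simp
    have h2 : Z * ((1 : Matrix D.Idx D.Idx ℝ).submatrix id (realEmb D i) * topVec v) = 0 := by
      rw [← Matrix.mul_assoc, mul_one_submatrix]
      ext ρ k
      exact (mul_topVec (realCols Z i) v ρ k).trans (congrFun hv ρ)
    have h3 := hZ _ _ (observability_mul_eq_zero (by
      rw [(isBlock_real D i).mul_extend, h1, ← Matrix.mul_assoc]) h2)
    apply topVec_eq_zero
    rw [← submatrix_extend (isBlock_real D i).injective (topVec v), h3]
    rfl
  have hc : ∀ j, ∃ s : IndexSeq (D.cplxWeyr j) (μ.rowLen 0),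
      s.AdmissiblePair (cplxCols Z j) := by
    intro j
    obtain ⟨s, hs⟩ := exists_indexSeq (toCplx (cplxCols Z j)) fun v hv => by
      have h1 : weyrBlockPair (D.cplxWeyr j) (D.cplxEig j) * toReal (topVec v) =
          toReal (topVec v) * toReal (D.cplxEig j • (1 : Matrix (Fin 1) (Fin 1) ℂ)) := by
        rw [weyrBlockPair_eq, ← toReal_mul, ← toReal_mul, Matrix.add_mul, weyrNil_mul_topVec]
        simp
      have h2 : Z * ((1 : Matrix D.Idx D.Idx ℝ).submatrix id (cplxEmb D j) *
          toReal (topVec v)) = 0 := by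
        rw [← Matrix.mul_assoc, mul_one_submatrix]
        have : toCplx (cplxCols Z j * toReal (topVec v)) = 0 := by
          rw [toCplx_mul_toReal]
          ext ρ k
          rw [mul_topVec, hv]
          rfl
        ext ρ ⟨k, u⟩
        have h := congrFun₂ this ρ k
        fin_cases u
        · exact congrArg Complex.re h
        · exact congrArg Complex.im h
      have h3 := hZ _ _ (observability_mul_eq_zero (by
        rw [(isBlock_cplx D j).mul_extend, h1, ← Matrix.mul_assoc]) h2)
      apply topVec_eq_zero
      apply toReal_injective
      rw [← submatrix_extend (isBlock_cplx D j).injective (toReal (topVec v)), h3, toReal_zero]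
      rfl
    exact ⟨s, fun t => isUnit_toReal (hs t)⟩
  choose sr hsr using hr
  choose sc hsc using hc
  exact ⟨⟨sr, sc⟩, hsr, hsc⟩

/-! ### Left inverses -/

section LeftInv

variable {κ ι : Type} [Fintype κ] [Fintype ι] [DecidableEq ι]

theorem leftInv_mul {P : Matrix κ ι ℝ} (h : P.rank = Fintype.card ι) : leftInv P * P = 1 := by
  rw [leftInv, Matrix.mul_assoc,
    Matrix.nonsing_inv_mul _ (isUnit_iff_ne_zero.2 ((rank_eq_card_iff P).1 h))]

theorem mul_leftInv [DecidableEq κ] {P : Matrix κ ι ℝ} (h : P.rank = Fintype.card ι)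
    (hc : Fintype.card κ = Fintype.card ι) : P * leftInv P = 1 :=
  (Matrix.mul_eq_one_comm_of_equiv (Fintype.equivOfCardEq hc.symm)).1 (leftInv_mul h)

theorem rank_eq_of_mul_eq_one {P : Matrix κ ι ℝ} {S : Matrix ι κ ℝ} (h : S * P = 1) :
    P.rank = Fintype.card ι := by
  refine le_antisymm P.rank_le_card_width ?_
  rw [← Matrix.rank_one (R := ℝ) (n := ι), ← h]
  exact Matrix.rank_mul_le_right S P

theorem rank_eq_card_iff_injective {P : Matrix κ ι ℝ} :
    P.rank = Fintype.card ι ↔ ∀ v, P *ᵥ v = 0 → v = 0 := by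
  constructor
  · intro h v hv
    rw [← Matrix.one_mulVec v, ← leftInv_mul h, ← Matrix.mulVec_mulVec, hv, Matrix.mulVec_zero]
  · intro h
    rw [rank_eq_card_iff]
    intro h0
    obtain ⟨v, hv, hv0⟩ := Matrix.exists_mulVec_eq_zero_iff.2 h0
    refine hv (h v ?_)
    rw [← Matrix.mulVec_mulVec] at hv0
    have : P *ᵥ v ⬝ᵥ P *ᵥ v = 0 := by
      rw [Matrix.dotProduct_mulVec, ← Matrix.mulVec_transpose, hv0, zero_dotProduct]
    exact dotProduct_self_eq_zero.1 this

theorem eq_zero_of_mul_eq_zero {P : Matrix κ ι ℝ} (h : P.rank = Fintype.card ι) {τ : Type}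
    {U : Matrix ι τ ℝ} (hU : P * U = 0) : U = 0 := by
  rw [← Matrix.one_mul U, ← leftInv_mul h, Matrix.mul_assoc, hU, Matrix.mul_zero]

section Smooth

variable {E : Type} [NormedAddCommGroup E] [NormedSpace ℝ E] {k : WithTop ℕ∞}

theorem contDiffAt_matrix {m n : Type} [Fintype m] [Fintype n] {f : E → Matrix m n ℝ} {x : E} :
    ContDiffAt ℝ k f x ↔ ∀ i j, ContDiffAt ℝ k (fun y => f y i j) x := by
  rw [show ContDiffAt ℝ k f x ↔ ∀ i, ContDiffAt ℝ k (fun y => f y i) x from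
    contDiffAt_pi (F' := fun _ : m => n → ℝ)]
  exact forall_congr' fun i => contDiffAt_pi (F' := fun _ : n => ℝ)

theorem contDiffAt_entry {m n : Type} [Fintype m] [Fintype n] {f : E → Matrix m n ℝ} {x : E}
    (h : ContDiffAt ℝ k f x) (i : m) (j : n) : ContDiffAt ℝ k (fun y => f y i j) x :=
  contDiffAt_matrix.1 h i j

theorem contDiffAt_mul {l m n : Type} [Fintype l] [Fintype m] [Fintype n] {f : E → Matrix l m ℝ}
    {g : E → Matrix m n ℝ} {x : E} (hf : ContDiffAt ℝ k f x) (hg : ContDiffAt ℝ k g x) :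
    ContDiffAt ℝ k (fun y => f y * g y) x := by
  refine contDiffAt_matrix.2 fun i j => ?_
  simp only [Matrix.mul_apply]
  exact ContDiffAt.sum fun s _ => (contDiffAt_entry hf i s).mul (contDiffAt_entry hg s j)

theorem contDiffAt_det {n : Type} [Fintype n] [DecidableEq n] {f : E → Matrix n n ℝ} {x : E}
    (hf : ContDiffAt ℝ k f x) : ContDiffAt ℝ k (fun y => (f y).det) x := by
  simp only [Matrix.det_apply]
  exact ContDiffAt.sum fun σ _ => (contDiffAt_prod fun i _ => contDiffAt_entry hf _ _).const_smul _

/-- By Cramer's rule the entries of the inverse are quotients of determinants. -/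
theorem contDiffAt_inv {n : Type} [Fintype n] [DecidableEq n] {f : E → Matrix n n ℝ} {x : E}
    (hf : ContDiffAt ℝ k f x) (hx : (f x).det ≠ 0) : ContDiffAt ℝ k (fun y => (f y)⁻¹) x := by
  refine contDiffAt_matrix.2 fun i j => ?_
  simp only [Matrix.inv_def, Ring.inverse_eq_inv', Matrix.smul_apply, Matrix.adjugate_apply,
    smul_eq_mul]
  refine ((contDiffAt_det hf).inv hx).mul (contDiffAt_det (contDiffAt_matrix.2 fun a b => ?_))
  by_cases h : a = j
  · subst h
    simpa using contDiffAt_const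
  · simpa [Matrix.updateRow_ne h] using contDiffAt_entry hf a b

theorem contDiffAt_leftInv {f : E → Matrix κ ι ℝ} {x : E} (hf : ContDiffAt ℝ k f x)
    (hx : (f x).rank = Fintype.card ι) : ContDiffAt ℝ k (fun y => leftInv (f y)) x := by
  have ht : ContDiffAt ℝ k (fun y => (f y)ᵀ) x :=
    contDiffAt_matrix.2 fun i j => contDiffAt_entry hf j i
  exact contDiffAt_mul (contDiffAt_inv (contDiffAt_mul ht hf) ((rank_eq_card_iff _).1 hx)) ht

end Smooth

theorem isOpen_rank_eq : IsOpen {P : Matrix κ ι ℝ | P.rank = Fintype.card ι} := by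
  simp only [rank_eq_card_iff]
  exact isOpen_ne_fun (by fun_prop) continuous_const

end LeftInv

/-! ### Truncated observability matrices and feedback matrices -/

section Feedback

variable {ι : Type} [Fintype ι] [DecidableEq ι] {μ : YoungDiagram} {A : Matrix ι ι ℝ}

theorem card_cell (μ : YoungDiagram) : Fintype.card (Cell μ) = μ.card := Fintype.card_coe _

/-- The matrix with the rows `z_a A ^ k_a`. -/
def lastRows (μ : YoungDiagram) (A : Matrix ι ι ℝ) (Z : Matrix (Fin (μ.rowLen 0)) ι ℝ) :
    Matrix (Fin (μ.rowLen 0)) ι ℝ :=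
  Matrix.of fun a => (Z * A ^ μ.colLen a) a

theorem brunovskyG_mul_apply {κ : Type} (K : Matrix (Fin (μ.rowLen 0)) κ ℝ) (c : Cell μ) (d : κ) :
    (brunovskyG μ * K) c d = if (c.1.1 + 1, c.1.2) ∈ μ.cells then 0 else K c.pos d := by
  rw [Matrix.mul_apply]
  rw [Finset.sum_eq_single c.pos]
  · by_cases h : (c.1.1 + 1, c.1.2) ∈ μ.cells
    · rw [if_pos h]
      rw [mem_cells_iff_lt_rowLen] at h
      simp [brunovskyG, h]
    · rw [if_neg h]
      rw [mem_cells_iff_lt_rowLen, not_lt] at h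
      simp [brunovskyG, h, Cell.pos]
  · intro a _ ha
    have : ¬ c.1.2 = (a : ℕ) := fun h => ha (Fin.ext h.symm)
    simp [brunovskyG, this]
  · simp

/-- `F + G₁ K` replaces each row `(i, a)` of `P` by row `(i + 1, a)` if there is one; at the last
cell of column `a`, where only `G₁ K` contributes, it yields row `a` of `K P`. -/
theorem closedLoop_mul_apply_succ {κ : Type} (K : Matrix (Fin (μ.rowLen 0)) (Cell μ) ℝ)
    (P : Matrix (Cell μ) κ ℝ) {c c' : Cell μ} (d : κ) (hc : c'.1 = (c.1.1 + 1, c.1.2)) :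
    ((brunovskyF μ + brunovskyG μ * K) * P) c d = P c' d := by
  have h : (c.1.1 + 1, c.1.2) ∈ μ.cells := hc ▸ c'.2
  rw [Matrix.add_mul, Matrix.mul_assoc, Matrix.add_apply, brunovskyG_mul_apply, if_pos h, add_zero]
  exact weyrNil_mul_apply_succ P c c' d hc

theorem closedLoop_mul_apply_last {κ : Type} (K : Matrix (Fin (μ.rowLen 0)) (Cell μ) ℝ)
    (P : Matrix (Cell μ) κ ℝ) {c : Cell μ} (d : κ) (hc : (c.1.1 + 1, c.1.2) ∉ μ.cells) :
    ((brunovskyF μ + brunovskyG μ * K) * P) c d = (K * P) c.pos d := by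
  rw [Matrix.add_mul, Matrix.mul_assoc, Matrix.add_apply, brunovskyG_mul_apply, if_neg hc]
  rw [show (brunovskyF μ * P) c d = 0 from weyrNil_mul_apply_last P c d hc, zero_add]

theorem observability_mul_apply (Z : Matrix (Fin (μ.rowLen 0)) ι ℝ) (c : Cell μ) (d : ι) :
    (observability μ A Z * A) c d = (Z * A ^ (c.1.1 + 1)) c.pos d := by
  rw [pow_succ, ← Matrix.mul_assoc]
  rfl

theorem colLen_eq_of_last {c : Cell μ} (hc : (c.1.1 + 1, c.1.2) ∉ μ.cells) :
    μ.colLen c.1.2 = c.1.1 + 1 := by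
  rw [mem_cells_iff_lt_colLen] at hc
  have := c.lt_colLen
  omega

/-- The two sides agree automatically except at the last cells of the columns, where the equation
compares row `a` of `Z A ^ k_a` with row `a` of `K P`. -/
theorem observability_mul_eq_iff (Z : Matrix (Fin (μ.rowLen 0)) ι ℝ)
    (K : Matrix (Fin (μ.rowLen 0)) (Cell μ) ℝ) :
    observability μ A Z * A = (brunovskyF μ + brunovskyG μ * K) * observability μ A Z ↔
      K * observability μ A Z = lastRows μ A Z := by
  constructor
  · intro h
    ext a d
    have ha : 0 < μ.colLen a := lt_rowLen_iff_lt_colLen.1 a.2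
    let c : Cell μ := ⟨(μ.colLen a - 1, a), mem_cells_iff_lt_colLen.2 (by omega)⟩
    have hc : (c.1.1 + 1, c.1.2) ∉ μ.cells := by
      rw [mem_cells_iff_lt_colLen]
      change ¬ (μ.colLen a - 1 + 1 < μ.colLen a)
      omega
    have h1 := congrFun₂ h c d
    rw [observability_mul_apply, closedLoop_mul_apply_last _ _ _ hc, ← colLen_eq_of_last hc] at h1
    exact h1.symm
  · intro h
    ext c d
    rw [observability_mul_apply]
    by_cases hc : (c.1.1 + 1, c.1.2) ∈ μ.cells
    · rw [closedLoop_mul_apply_succ (c' := ⟨_, hc⟩) _ _ _ rfl]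
      rfl
    · rw [closedLoop_mul_apply_last _ _ _ hc, h, ← colLen_eq_of_last hc]
      rfl

/-- Read from block to block, the equation says that row `(i + 1, a)` of `P` is row `(i, a)` times
`A`. -/
theorem eq_observability_of_mul_eq {P : Matrix (Cell μ) ι ℝ}
    {K : Matrix (Fin (μ.rowLen 0)) (Cell μ) ℝ}
    (h : P * A = (brunovskyF μ + brunovskyG μ * K) * P) : P = observability μ A (topRows P) := by
  have key : ∀ i, ∀ c : Cell μ, c.1.1 = i → P c = observability μ A (topRows P) c := by
    intro i
    induction i with
    | zero =>
      intro c hc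
      rw [c.eq_topCell hc]
      ext d
      simp [observability, topCell, topRows, Cell.pos]
    | succ i ih =>
      intro c hc
      ext d
      have hl : c.1 = ((c.lower 1).1.1 + 1, (c.lower 1).1.2) :=
        Prod.ext (by change c.1.1 = c.1.1 - 1 + 1; omega) rfl
      have h1 := congrFun₂ h (c.lower 1) d
      rw [closedLoop_mul_apply_succ _ _ _ hl] at h1
      rw [← h1, Matrix.mul_apply, ih (c.lower 1) (by change c.1.1 - 1 = i; omega),
        ← Matrix.mul_apply, observability_mul_apply]
      have hi : (c.lower 1).1.1 + 1 = c.1.1 := by change c.1.1 - 1 + 1 = c.1.1; omega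
      rw [hi]
      rfl
  ext c d
  exact congrFun (key _ c rfl) d

omit [DecidableEq ι] in
theorem topRows_mul (P : Matrix (Cell μ) ι ℝ) (X : Matrix ι ι ℝ) :
    topRows (P * X) = topRows P * X := by
  ext a d
  simp [topRows, Matrix.mul_apply]

theorem observability_mul_of_comm (Z : Matrix (Fin (μ.rowLen 0)) ι ℝ) {X : Matrix ι ι ℝ}
    (hX : X * A = A * X) : observability μ A (Z * X) = observability μ A Z * X := by
  have h : ∀ k, Z * X * A ^ k = Z * A ^ k * X := fun k => by
    rw [Matrix.mul_assoc, (show Commute X A from hX).pow_right k, ← Matrix.mul_assoc]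
  ext c d
  simp only [observability, h, Matrix.of_apply]
  rfl

theorem lastRows_mul_of_comm (Z : Matrix (Fin (μ.rowLen 0)) ι ℝ) {X : Matrix ι ι ℝ}
    (hX : X * A = A * X) : lastRows μ A (Z * X) = lastRows μ A Z * X := by
  have h : ∀ k, Z * X * A ^ k = Z * A ^ k * X := fun k => by
    rw [Matrix.mul_assoc, (show Commute X A from hX).pow_right k, ← Matrix.mul_assoc]
  ext c d
  simp only [lastRows, h, Matrix.of_apply]
  rfl

theorem feedbackOf_observability (Z : Matrix (Fin (μ.rowLen 0)) ι ℝ) :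
    feedbackOf μ A (observability μ A Z) = lastRows μ A Z * leftInv (observability μ A Z) := by
  rw [feedbackOf, topRows_observability]
  rfl

theorem toMat_eq (P : truncSpace μ A) : toMat P = observability μ A (topRows (toMat P)) := P.2

variable (hn : μ.card = Fintype.card ι)

include hn

theorem feedbackOf_eq_iff {Z : Matrix (Fin (μ.rowLen 0)) ι ℝ}
    (hZ : (observability μ A Z).rank = Fintype.card ι)
    {K : Matrix (Fin (μ.rowLen 0)) (Cell μ) ℝ} :
    feedbackOf μ A (observability μ A Z) = K ↔
      K * observability μ A Z = lastRows μ A Z := by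
  rw [feedbackOf_observability]
  constructor
  · rintro rfl
    rw [Matrix.mul_assoc, leftInv_mul hZ, Matrix.mul_one]
  · intro h
    rw [← h, Matrix.mul_assoc, mul_leftInv hZ ((card_cell μ).trans hn), Matrix.mul_one]

/-- The matrix `T` that realizes the similarity is itself the required truncated observability
matrix. -/
theorem exists_rows_of_mem_feedbackSet {K : Matrix (Fin (μ.rowLen 0)) (Cell μ) ℝ}
    (hK : K ∈ feedbackSet (brunovskyF μ) (brunovskyG μ) A) :
    ∃ P : fullRank μ A, feedbackOf μ A (toMat P.1) = K := by
  obtain ⟨T, S, h1, h2, h3⟩ := hK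
  have hT : T * A = (brunovskyF μ + brunovskyG μ * K) * T := by
    rw [h3, Matrix.mul_assoc _ S, h2, Matrix.mul_one]
  have hobs := eq_observability_of_mul_eq hT
  have hr : (observability μ A (topRows T)).rank = Fintype.card ι := by
    rw [← hobs]
    exact rank_eq_of_mul_eq_one h2
  refine ⟨⟨truncOf μ A (topRows T), hr⟩, ?_⟩
  rw [toMat_truncOf, feedbackOf_eq_iff hn hr, ← observability_mul_eq_iff, ← hobs, hT]

theorem closedLoop_of_fullRank (P : fullRank μ A) : toMat P.1 * A =
    (brunovskyF μ + brunovskyG μ * feedbackOf μ A (toMat P.1)) * toMat P.1 := by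
  have hr : (toMat P.1).rank = Fintype.card ι := P.2
  have h := toMat_eq P.1
  rw [h] at hr ⊢
  rw [observability_mul_eq_iff, ← feedbackOf_eq_iff hn hr]

theorem phi_mem_feedbackSet (q : OrbitSpace μ A) :
    phi μ A q ∈ feedbackSet (brunovskyF μ) (brunovskyG μ) A := by
  induction q using Quotient.inductionOn with
  | h P =>
    have hr : (toMat P.1).rank = Fintype.card ι := P.2
    refine ⟨toMat P.1, leftInv (toMat P.1), mul_leftInv hr ((card_cell μ).trans hn),
      leftInv_mul hr, ?_⟩
    change brunovskyF μ + brunovskyG μ * feedbackOf μ A (toMat P.1) = _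
    have h1 := closedLoop_of_fullRank hn P
    rw [h1, Matrix.mul_assoc, mul_leftInv hr ((card_cell μ).trans hn), Matrix.mul_one]

/-- `P` conjugates `F + G₁ K` to `A`, which turns a second solution `Q` into `P⁻¹ Q`, a matrix
commuting with `A`. `Q` may be singular; this matters when kernels of the linear system are
computed. -/
theorem exists_comm_of_closedLoop {K : Matrix (Fin (μ.rowLen 0)) (Cell μ) ℝ}
    {P Q : Matrix (Cell μ) ι ℝ} (hr : P.rank = Fintype.card ι)
    (hP : P * A = (brunovskyF μ + brunovskyG μ * K) * P)
    (hQ : Q * A = (brunovskyF μ + brunovskyG μ * K) * Q) :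
    leftInv P * Q * A = A * (leftInv P * Q) ∧ P * (leftInv P * Q) = Q := by
  have h1 := mul_leftInv hr ((card_cell μ).trans hn)
  refine ⟨?_, by rw [← Matrix.mul_assoc, h1, Matrix.one_mul]⟩
  have h2 : leftInv P * (brunovskyF μ + brunovskyG μ * K) = A * leftInv P := by
    rw [← Matrix.one_mul A, ← leftInv_mul hr, Matrix.mul_assoc _ P, hP, Matrix.mul_assoc,
      Matrix.mul_assoc _ P, h1, Matrix.mul_one]
  rw [Matrix.mul_assoc, hQ, ← Matrix.mul_assoc, h2, Matrix.mul_assoc]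

theorem phi_injective : Function.Injective (phi μ A) := by
  intro q q' h
  induction q, q' using Quotient.inductionOn₂ with
  | h P Q =>
    have hK : feedbackOf μ A (toMat P.1) = feedbackOf μ A (toMat Q.1) := h
    have hP := closedLoop_of_fullRank hn P
    have hQ := closedLoop_of_fullRank hn Q
    rw [← hK] at hQ
    obtain ⟨h1, h2⟩ := exists_comm_of_closedLoop hn P.2 hP hQ
    obtain ⟨-, h4⟩ := exists_comm_of_closedLoop hn Q.2 hQ hP
    have h5 : (leftInv (toMat P.1) * toMat Q.1) * (leftInv (toMat Q.1) * toMat P.1) = 1 := by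
      rw [Matrix.mul_assoc, h4, leftInv_mul P.2]
    refine Quotient.sound ⟨⟨_, _, h5, mul_eq_one_comm.1 h5⟩, h1, h2.symm⟩

theorem range_phi : range (phi μ A) = feedbackSet (brunovskyF μ) (brunovskyG μ) A := by
  refine Subset.antisymm (range_subset_iff.2 (phi_mem_feedbackSet hn)) fun K hK => ?_
  obtain ⟨P, hP⟩ := exists_rows_of_mem_feedbackSet hn hK
  exact ⟨orbitMk μ A P, hP⟩

end Feedback

/-! ### Recovering the parameters from the feedback matrix -/

section Residual

variable {ι : Type} [Fintype ι] [DecidableEq ι]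

theorem lastRows_add (μ : YoungDiagram) (A : Matrix ι ι ℝ) (Z Z' : Matrix (Fin (μ.rowLen 0)) ι ℝ) :
    lastRows μ A (Z + Z') = lastRows μ A Z + lastRows μ A Z' := by
  ext a d
  simp [lastRows, Matrix.add_mul]

theorem lastRows_smul (μ : YoungDiagram) (A : Matrix ι ι ℝ) (t : ℝ)
    (Z : Matrix (Fin (μ.rowLen 0)) ι ℝ) : lastRows μ A (t • Z) = t • lastRows μ A Z := by
  ext a d
  simp [lastRows]

theorem observability_add (μ : YoungDiagram) (A : Matrix ι ι ℝ)
    (Z Z' : Matrix (Fin (μ.rowLen 0)) ι ℝ) :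
    observability μ A (Z + Z') = observability μ A Z + observability μ A Z' := by
  ext a d
  simp [observability, Matrix.add_mul]

theorem observability_smul (μ : YoungDiagram) (A : Matrix ι ι ℝ) (t : ℝ)
    (Z : Matrix (Fin (μ.rowLen 0)) ι ℝ) :
    observability μ A (t • Z) = t • observability μ A Z := by
  ext a d
  simp [observability]

/-- The linear map whose kernel consists of the first blocks of rows of the solutions `P` of
`P A = (F + G K) P`. -/
def residual (μ : YoungDiagram) (A : Matrix ι ι ℝ) (K : Matrix (Fin (μ.rowLen 0)) (Cell μ) ℝ) :
    Matrix (Fin (μ.rowLen 0)) ι ℝ →ₗ[ℝ] Matrix (Fin (μ.rowLen 0)) ι ℝ where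
  toFun Z := lastRows μ A Z - K * observability μ A Z
  map_add' Z Z' := by
    rw [lastRows_add, observability_add, Matrix.mul_add]
    abel
  map_smul' t Z := by
    rw [lastRows_smul, observability_smul, Matrix.mul_smul, RingHom.id_apply, smul_sub]

variable {μ : YoungDiagram} {A : Matrix ι ι ℝ} {K : Matrix (Fin (μ.rowLen 0)) (Cell μ) ℝ}

theorem residual_eq_zero_iff {Z : Matrix (Fin (μ.rowLen 0)) ι ℝ} :
    residual μ A K Z = 0 ↔ K * observability μ A Z = lastRows μ A Z := by
  rw [eq_comm (a := K * _)]
  exact sub_eq_zero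

theorem residual_mul_of_comm (Z : Matrix (Fin (μ.rowLen 0)) ι ℝ) {X : Matrix ι ι ℝ}
    (hX : X * A = A * X) : residual μ A K (Z * X) = residual μ A K Z * X := by
  change lastRows μ A (Z * X) - K * observability μ A (Z * X) =
    (lastRows μ A Z - K * observability μ A Z) * X
  rw [lastRows_mul_of_comm _ hX, observability_mul_of_comm _ hX, Matrix.sub_mul, Matrix.mul_assoc]

end Residual

namespace MultiIndex

section Reduce

variable {D : WeyrData} {r : ℕ} (I : MultiIndex D r)

/-- Each admissible matrix is equivalent to a matrix in reduced form. -/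
theorem exists_reduced {Z : Matrix (Fin r) D.Idx ℝ} (hZ : I.Admissible Z) :
    ∃ X ∈ centGroup D.mat, I.Reduced (Z * X.1) := by
  obtain ⟨X, hX, h⟩ := I.exists_mul_fixed (I.fixedEntries_injective hZ) I.fixedVal
  have hred : I.Reduced (Z * X) := I.reduced_iff.2 h
  -- To see that `X` is invertible, the fixed entries of `Z` are recovered from the reduced matrix
  -- by some `Y`. Then `Z (X Y - 1)` has vanishing fixed entries, so `X Y = 1`.
  obtain ⟨Y, hY, h'⟩ := I.exists_mul_fixed
    (I.fixedEntries_injective (I.admissible_of_reduced hred)) Z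
  have h1 : X * Y - 1 = 0 := by
    refine I.eq_zero_of_fixed hZ ?_ fun ρ c hc => ?_
    · rw [Matrix.sub_mul, Matrix.mul_sub, Matrix.mul_assoc, hY, ← Matrix.mul_assoc, hX,
        Matrix.mul_assoc]
      simp
    · rw [Matrix.mul_sub, ← Matrix.mul_assoc, Matrix.mul_one, Matrix.sub_apply, h' ρ c hc, sub_self]
  have h2 := sub_eq_zero.1 h1
  exact ⟨⟨X, Y, h2, mul_eq_one_comm.1 h2⟩, hX, hred⟩

/-- The matrix with given free entries whose fixed entries vanish. -/
def freeRows {d : ℕ} (e : I.Free ≃ Fin d) : (Fin d → ℝ) →ₗ[ℝ] Matrix (Fin r) D.Idx ℝ where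
  toFun x := Matrix.of fun ρ c =>
    open Classical in if h : I.Fixed ρ c then 0 else x (e ⟨(ρ, c), h⟩)
  map_add' x y := by
    ext ρ c
    by_cases h : I.Fixed ρ c <;> simp [h]
  map_smul' t x := by
    ext ρ c
    by_cases h : I.Fixed ρ c <;> simp [h]

theorem rows_eq_add {d : ℕ} (e : I.Free ≃ Fin d) (x : EuclideanSpace ℝ (Fin d)) :
    I.rows e x = I.rows e 0 + I.freeRows e x := by
  ext ρ c
  by_cases h : I.Fixed ρ c <;> simp [h, rows, freeRows]

theorem freeRows_fixed {d : ℕ} (e : I.Free ≃ Fin d) (x : Fin d → ℝ) {ρ : Fin r} {c : D.Idx}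
    (h : I.Fixed ρ c) : I.freeRows e x ρ c = 0 := by
  simp [freeRows, h]

theorem freeRows_freeEntries {d : ℕ} (e : I.Free ≃ Fin d) {Z : Matrix (Fin r) D.Idx ℝ}
    (hZ : ∀ ρ c, I.Fixed ρ c → Z ρ c = 0) : I.freeRows e (I.freeEntries e Z) = Z := by
  ext ρ c
  by_cases h : I.Fixed ρ c
  · rw [freeRows_fixed _ _ _ h, hZ ρ c h]
  · simp [freeRows, h, freeEntries]

theorem freeRows_injective {d : ℕ} (e : I.Free ≃ Fin d) {x : Fin d → ℝ}
    (h : I.freeRows e x = 0) : x = 0 := by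
  ext k
  have := congrFun₂ h (e.symm k).1.1 (e.symm k).1.2
  simpa [freeRows, (e.symm k).2] using this

theorem contDiffAt_rows {d : ℕ} (e : I.Free ≃ Fin d) {x : EuclideanSpace ℝ (Fin d)} :
    ContDiffAt ℝ ∞ (I.rows e) x := by
  refine contDiffAt_matrix.2 fun ρ c => ?_
  by_cases h : I.Fixed ρ c
  · simp only [I.rows_apply_fixed e _ h]
    exact contDiffAt_const
  · simp only [I.rows_apply_free e _ h]
    fun_prop

end Reduce

section Solve

variable {D : WeyrData} {μ : YoungDiagram} (I : MultiIndex D (μ.rowLen 0)) {d : ℕ}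
  (e : I.Free ≃ Fin d)

/-- The matrix of the linear system for the parameters of a matrix in reduced form with given
feedback matrix. -/
def sysMat (K : Matrix (Fin (μ.rowLen 0)) (Cell μ) ℝ) :
    Matrix (Fin (μ.rowLen 0) × D.Idx) (Fin d) ℝ :=
  Matrix.of fun p k => residual μ D.mat K (I.freeRows e (Pi.single k 1)) p.1 p.2

theorem sysMat_mulVec (K : Matrix (Fin (μ.rowLen 0)) (Cell μ) ℝ) (x : Fin d → ℝ)
    (p : Fin (μ.rowLen 0) × D.Idx) :
    (I.sysMat e K *ᵥ x) p = residual μ D.mat K (I.freeRows e x) p.1 p.2 := by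
  let T : (Fin d → ℝ) →ₗ[ℝ] (Fin (μ.rowLen 0) × D.Idx → ℝ) :=
    { toFun := fun x p => residual μ D.mat K (I.freeRows e x) p.1 p.2
      map_add' := fun x y => by
        ext p
        simp
      map_smul' := fun t x => by
        ext p
        simp }
  have h : LinearMap.toMatrix' T = I.sysMat e K := by
    ext p k
    rw [LinearMap.toMatrix'_apply]
    rfl
  rw [← h, LinearMap.toMatrix'_mulVec]
  rfl

/-- The right hand side of the linear system. -/
def sysVec (K : Matrix (Fin (μ.rowLen 0)) (Cell μ) ℝ) (p : Fin (μ.rowLen 0) × D.Idx) : ℝ :=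
  -residual μ D.mat K (I.rows e 0) p.1 p.2

/-- The least squares solution of the linear system. -/
def solve (K : Matrix (Fin (μ.rowLen 0)) (Cell μ) ℝ) : EuclideanSpace ℝ (Fin d) :=
  WithLp.toLp 2 (leftInv (I.sysMat e K) *ᵥ I.sysVec e K)

/-- For fixed `K` the residual is linear in `Z`, and the reduced forms are an affine space, so the
parameters satisfy a linear system. -/
theorem residual_rows_eq_zero_iff (K : Matrix (Fin (μ.rowLen 0)) (Cell μ) ℝ)
    (x : EuclideanSpace ℝ (Fin d)) :
    residual μ D.mat K (I.rows e x) = 0 ↔ I.sysMat e K *ᵥ x = I.sysVec e K := by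
  rw [rows_eq_add, map_add, add_comm, add_eq_zero_iff_eq_neg, funext_iff, ← Matrix.ext_iff]
  simp only [sysMat_mulVec, sysVec, Matrix.neg_apply, Prod.forall]

theorem solve_eq {K : Matrix (Fin (μ.rowLen 0)) (Cell μ) ℝ}
    (hK : (I.sysMat e K).rank = Fintype.card (Fin d)) {x : EuclideanSpace ℝ (Fin d)}
    (h : residual μ D.mat K (I.rows e x) = 0) : I.solve e K = x := by
  rw [residual_rows_eq_zero_iff] at h
  rw [solve, ← h, Matrix.mulVec_mulVec, leftInv_mul hK, Matrix.one_mulVec]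

theorem contDiffAt_residual (Z : Matrix (Fin (μ.rowLen 0)) D.Idx ℝ)
    (K : Matrix (Fin (μ.rowLen 0)) (Cell μ) ℝ) :
    ContDiffAt ℝ ∞ (fun K => residual μ D.mat K Z) K := by
  change ContDiffAt ℝ ∞ (fun K => lastRows μ D.mat Z - K * observability μ D.mat Z) K
  exact contDiffAt_const.sub (contDiffAt_mul contDiffAt_id contDiffAt_const)

theorem contDiffAt_sysMat (K : Matrix (Fin (μ.rowLen 0)) (Cell μ) ℝ) :
    ContDiffAt ℝ ∞ (I.sysMat e) K :=
  contDiffAt_matrix.2 fun p _ => contDiffAt_entry (contDiffAt_residual _ K) p.1 p.2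

theorem contDiffAt_solve {K : Matrix (Fin (μ.rowLen 0)) (Cell μ) ℝ}
    (hK : (I.sysMat e K).rank = Fintype.card (Fin d)) : ContDiffAt ℝ ∞ (I.solve e) K := by
  rw [contDiffAt_euclidean]
  intro k
  simp only [solve, Matrix.mulVec, dotProduct]
  exact ContDiffAt.sum fun p _ =>
    (contDiffAt_entry (contDiffAt_leftInv (I.contDiffAt_sysMat e K) hK) k p).mul
      (contDiffAt_entry (contDiffAt_residual (I.rows e 0) K) p.1 p.2).neg

/-- The set of the feedback matrices for which the linear system has a unique least squares
solution, and this solution gives a nonsingular matrix. -/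
def solveDom : Set (Matrix (Fin (μ.rowLen 0)) (Cell μ) ℝ) :=
  {K | (I.sysMat e K).rank = Fintype.card (Fin d) ∧
    (observability μ D.mat (I.rows e (I.solve e K))).rank = Fintype.card D.Idx}

theorem contDiffAt_observability {E : Type} [NormedAddCommGroup E] [NormedSpace ℝ E] {x : E}
    {ι : Type} [Fintype ι] [DecidableEq ι] {A : Matrix ι ι ℝ}
    {f : E → Matrix (Fin (μ.rowLen 0)) ι ℝ} (hf : ContDiffAt ℝ ∞ f x) :
    ContDiffAt ℝ ∞ (fun y => observability μ A (f y)) x :=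
  contDiffAt_matrix.2 fun c d => contDiffAt_entry
    (contDiffAt_mul hf (contDiffAt_const (c := A ^ c.1.1))) c.pos d

theorem contDiffAt_lastRows {E : Type} [NormedAddCommGroup E] [NormedSpace ℝ E] {x : E}
    {ι : Type} [Fintype ι] [DecidableEq ι] {A : Matrix ι ι ℝ}
    {f : E → Matrix (Fin (μ.rowLen 0)) ι ℝ} (hf : ContDiffAt ℝ ∞ f x) :
    ContDiffAt ℝ ∞ (fun y => lastRows μ A (f y)) x :=
  contDiffAt_matrix.2 fun a d => contDiffAt_entry
    (contDiffAt_mul hf (contDiffAt_const (c := A ^ μ.colLen a))) a d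

theorem isOpen_solveDom : IsOpen (I.solveDom e) := by
  have h1 : IsOpen {K | (I.sysMat e K).rank = Fintype.card (Fin d)} :=
    isOpen_rank_eq.preimage
      (continuous_iff_continuousAt.2 fun K => (I.contDiffAt_sysMat e K).continuousAt)
  have h2 : ContinuousOn (fun K => observability μ D.mat (I.rows e (I.solve e K)))
      {K | (I.sysMat e K).rank = Fintype.card (Fin d)} := fun K hK =>
    (contDiffAt_observability ((I.contDiffAt_rows e).comp K
      (I.contDiffAt_solve e hK))).continuousAt.continuousWithinAt
  exact h2.isOpen_inter_preimage h1 isOpen_rank_eq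

variable (hn : μ.card = Fintype.card D.Idx)

include hn

/-- A kernel vector gives a second solution of the closed loop equation, so its rows are `Z X` with
`X` commuting with `A`. Their fixed entries vanish, hence `X = 0`: this is uniqueness of the reduced
form. -/
theorem rank_sysMat_of_solution {K : Matrix (Fin (μ.rowLen 0)) (Cell μ) ℝ}
    {x : EuclideanSpace ℝ (Fin d)}
    (hx : (observability μ D.mat (I.rows e x)).rank = Fintype.card D.Idx)
    (h : residual μ D.mat K (I.rows e x) = 0) :
    (I.sysMat e K).rank = Fintype.card (Fin d) := by
  rw [rank_eq_card_iff_injective]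
  intro v hv
  have h1 : residual μ D.mat K (I.freeRows e v) = 0 := by
    ext ρ c
    rw [← I.sysMat_mulVec e K v (ρ, c), hv]
    rfl
  rw [residual_eq_zero_iff, ← observability_mul_eq_iff] at h h1
  obtain ⟨h2, h3⟩ := exists_comm_of_closedLoop hn hx h h1
  have h4 : I.rows e x * (leftInv (observability μ D.mat (I.rows e x)) *
      observability μ D.mat (I.freeRows e v)) = I.freeRows e v := by
    have := congrArg topRows h3
    rwa [topRows_mul, topRows_observability, topRows_observability] at this
  have h5 := I.eq_zero_of_fixed (I.admissible_of_reduced (I.reduced_rows e x)) h2 fun ρ c hc => by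
    rw [h4, I.freeRows_fixed e v hc]
  rw [h5, Matrix.mul_zero] at h4
  exact I.freeRows_injective e h4.symm

/-- A least squares solution need not be a solution. For `K` in the feedback set one exists: take
any `P` with feedback matrix `K`; full rank of the system makes the map to fixed entries injective
for `P`, so some `Z X` is reduced and solves the system. -/
theorem residual_solve {K : Matrix (Fin (μ.rowLen 0)) (Cell μ) ℝ}
    (hK : K ∈ feedbackSet (brunovskyF μ) (brunovskyG μ) D.mat)
    (hr : (I.sysMat e K).rank = Fintype.card (Fin d)) :
    residual μ D.mat K (I.rows e (I.solve e K)) = 0 := by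
  obtain ⟨P, hP⟩ := exists_rows_of_mem_feedbackSet hn hK
  have hPr : (toMat P.1).rank = Fintype.card D.Idx := P.2
  have hobs := toMat_eq P.1
  set Z := topRows (toMat P.1)
  rw [hobs] at hP hPr
  have hZ : residual μ D.mat K Z = 0 := residual_eq_zero_iff.2 ((feedbackOf_eq_iff hn hPr).1 hP)
  have hinj : Function.Injective (I.fixedEntries Z) := by
    refine (injective_iff_map_eq_zero _).2 fun X hX => Subtype.ext ?_
    have hXc := mem_cent_iff.1 X.2
    have h1 : ∀ ρ c, I.Fixed ρ c → (Z * X.1) ρ c = 0 := fun ρ c h => congrFun hX ⟨(ρ, c), h⟩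
    have h2 := I.freeRows_freeEntries e h1
    have h3 : (I.freeEntries e (Z * X.1)).ofLp = 0 := by
      refine rank_eq_card_iff_injective.1 hr _ (funext fun p => ?_)
      rw [sysMat_mulVec, h2, residual_mul_of_comm Z hXc, hZ, Matrix.zero_mul]
      rfl
    rw [h3, map_zero] at h2
    refine eq_zero_of_mul_eq_zero hPr ?_
    rw [← observability_mul_of_comm Z hXc, ← h2]
    ext c k
    simp [observability]
  -- Invertibility of `X` is not needed here; nonsingularity of the resulting matrix is part of the
  -- definition of `solveDom`.
  obtain ⟨X, hX, h⟩ := I.exists_mul_fixed hinj I.fixedVal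
  have h1 := I.rows_freeEntries e (I.reduced_iff.2 h)
  have h2 : residual μ D.mat K (I.rows e (I.freeEntries e (Z * X))) = 0 := by
    rw [h1, residual_mul_of_comm Z hX, hZ, Matrix.zero_mul]
  rwa [I.solve_eq e hr h2]

end Solve

/-! ### The parametrization by reduced forms and its inverse -/

section Param

variable {D : WeyrData} {μ : YoungDiagram} (I : MultiIndex D (μ.rowLen 0))
  (e : I.Free ≃ Fin (paramDim μ D))

theorem mem_dom_iff {x : Param μ D} : x ∈ I.dom e ↔
    (observability μ D.mat (I.rows e x)).rank = Fintype.card D.Idx := by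
  refine ⟨fun h => h.1, fun h => ⟨h, ?_⟩⟩
  change I.Reduced (topRows (observability μ D.mat (I.rows e x)))
  rw [topRows_observability]
  exact I.reduced_rows e x

theorem isOpen_dom : IsOpen (I.dom e) := by
  have : I.dom e = (fun x => observability μ D.mat (I.rows e x)) ⁻¹'
      {P | P.rank = Fintype.card D.Idx} := by
    ext x
    exact I.mem_dom_iff e
  rw [this]
  exact isOpen_rank_eq.preimage (continuous_iff_continuousAt.2 fun x =>
    (contDiffAt_observability (I.contDiffAt_rows e)).continuousAt)

theorem bijOn_nu : BijOn (I.nu e) (I.dom e) I.reducedSet := by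
  refine ⟨fun x hx => hx, fun x _ y _ h => ?_, fun P hP => ?_⟩
  · have h1 : I.rows e x = I.rows e y := by
      have := congrArg (fun P => topRows (toMat P)) h
      simpa only [nu, toMat_truncOf, topRows_observability] using this
    rw [← I.freeEntries_rows e x, h1, I.freeEntries_rows]
  · have h : I.nu e (I.freeEntries e (topRows (toMat P))) = P := by
      rw [nu, I.rows_freeEntries e hP.2]
      exact Subtype.ext (toMat_eq P).symm
    exact ⟨_, by rw [dom, mem_preimage, h]; exact hP, h⟩

theorem psi_mem_orbits (x : I.dom e) : I.psi e x ∈ I.orbits := by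
  refine ⟨_, ?_, rfl⟩
  change I.Admissible (topRows (observability μ D.mat (I.rows e x)))
  rw [topRows_observability]
  exact I.admissible_of_reduced (I.reduced_rows e x)

theorem exists_psi_eq {q : OrbitSpace μ D.mat} (hq : q ∈ I.orbits) : ∃ x, I.psi e x = q := by
  obtain ⟨P, hP, rfl⟩ := hq
  obtain ⟨X, hX, hred⟩ := I.exists_reduced hP
  have hobs := toMat_eq P.1
  set Z := topRows (toMat P.1) with hZ
  have h1 : observability μ D.mat (Z * X.1) = toMat P.1 * X.1 := by
    rw [observability_mul_of_comm Z hX, ← hobs]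
  have h2 := I.rows_freeEntries e hred
  have hdom : I.freeEntries e (Z * X.1) ∈ I.dom e := by
    rw [mem_dom_iff, h2, h1, Matrix.rank_mul_eq_left_of_isUnit_det _ _
      ((Matrix.isUnit_iff_isUnit_det _).1 X.isUnit)]
    exact P.2
  refine ⟨⟨_, hdom⟩, ?_⟩
  symm
  refine Quotient.sound ⟨X, hX, ?_⟩
  change observability μ D.mat (I.rows e _) = _
  rw [h2, h1]

theorem contDiffAt_alpha {x : Param μ D} (hx : x ∈ I.dom e) : ContDiffAt ℝ ∞ (I.alpha e) x := by
  have h : I.alpha e = fun x => lastRows μ D.mat (I.rows e x) *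
      leftInv (observability μ D.mat (I.rows e x)) := by
    funext x
    exact feedbackOf_observability _
  rw [h]
  exact contDiffAt_mul (contDiffAt_lastRows (I.contDiffAt_rows e))
    (contDiffAt_leftInv (contDiffAt_observability (I.contDiffAt_rows e)) ((I.mem_dom_iff e).1 hx))

variable (hn : μ.card = Fintype.card D.Idx)

include hn

theorem residual_alpha {x : Param μ D} (hx : x ∈ I.dom e) :
    residual μ D.mat (I.alpha e x) (I.rows e x) = 0 :=
  residual_eq_zero_iff.2 ((feedbackOf_eq_iff hn ((I.mem_dom_iff e).1 hx)).1 rfl)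

theorem solve_alpha {x : Param μ D} (hx : x ∈ I.dom e) : I.solve e (I.alpha e x) = x :=
  I.solve_eq e (I.rank_sysMat_of_solution e hn ((I.mem_dom_iff e).1 hx)
    (I.residual_alpha e hn hx)) (I.residual_alpha e hn hx)

theorem alpha_mem_solveDom {x : Param μ D} (hx : x ∈ I.dom e) : I.alpha e x ∈ I.solveDom e := by
  refine ⟨I.rank_sysMat_of_solution e hn ((I.mem_dom_iff e).1 hx) (I.residual_alpha e hn hx), ?_⟩
  rw [I.solve_alpha e hn hx]
  exact (I.mem_dom_iff e).1 hx

theorem alpha_solve {K : Matrix (Fin (μ.rowLen 0)) (Cell μ) ℝ}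
    (hK : K ∈ feedbackSet (brunovskyF μ) (brunovskyG μ) D.mat) (hd : K ∈ I.solveDom e) :
    I.alpha e (I.solve e K) = K :=
  (feedbackOf_eq_iff hn hd.2).2 (residual_eq_zero_iff.1 (I.residual_solve e hn hK hd.1))

/-- `solveDom` is open in the space of all feedback matrices, so this yields relative openness in
the feedback set, and an open set on which the inverse of `α` extends smoothly. -/
theorem phi_image_orbits : phi μ D.mat '' I.orbits =
    I.solveDom e ∩ feedbackSet (brunovskyF μ) (brunovskyG μ) D.mat := by
  ext K
  constructor
  · rintro ⟨q, hq, rfl⟩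
    refine ⟨?_, phi_mem_feedbackSet hn q⟩
    obtain ⟨x, rfl⟩ := I.exists_psi_eq e hq
    exact I.alpha_mem_solveDom e hn x.2
  · rintro ⟨hd, hK⟩
    refine ⟨I.psi e ⟨I.solve e K, (I.mem_dom_iff e).2 hd.2⟩, I.psi_mem_orbits e _, ?_⟩
    rw [← I.alpha_eq]
    exact I.alpha_solve e hn hK hd

/-- Injectivity of `φ` turns the description of the image into one of a preimage under a continuous
map, which shows that the set of orbits is open. -/
theorem orbits_eq_preimage : I.orbits = phi μ D.mat ⁻¹' I.solveDom e := by
  ext q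
  rw [mem_preimage]
  constructor
  · intro hq
    exact ((I.phi_image_orbits e hn).subset ⟨q, hq, rfl⟩).1
  · intro hq
    obtain ⟨q', hq', h⟩ := (I.phi_image_orbits e hn).superset ⟨hq, phi_mem_feedbackSet hn q⟩
    rwa [← phi_injective hn h]

theorem psi_solve_phi {q : OrbitSpace μ D.mat} (hq : q ∈ I.orbits) :
    ∃ h : I.solve e (phi μ D.mat q) ∈ I.dom e, I.psi e ⟨_, h⟩ = q := by
  obtain ⟨x, rfl⟩ := I.exists_psi_eq e hq
  have h : I.solve e (phi μ D.mat (I.psi e x)) = x := by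
    rw [← I.alpha_eq, I.solve_alpha e hn x.2]
  refine ⟨by rw [h]; exact x.2, ?_⟩
  congr 1
  exact Subtype.ext h

theorem isDiffeoOnto_alpha : IsDiffeoOnto (I.alpha e) (I.dom e) (phi μ D.mat '' I.orbits) := by
  refine ⟨⟨fun x hx => ⟨I.psi e ⟨x, hx⟩, I.psi_mem_orbits e _, rfl⟩, fun x hx y hy h => ?_,
    ?_⟩, fun x hx => ⟨I.dom e, I.isOpen_dom e, hx, I.alpha e, ?_, fun _ _ => rfl⟩,
    I.solve e, fun x hx => I.solve_alpha e hn hx, fun K hK => ⟨I.solveDom e, I.isOpen_solveDom e,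
      ?_, I.solve e, fun K hK => (I.contDiffAt_solve e hK.1).contDiffWithinAt, fun _ _ => rfl⟩⟩
  · rw [← I.solve_alpha e hn hx, h, I.solve_alpha e hn hy]
  · rintro K ⟨q, hq, rfl⟩
    obtain ⟨x, rfl⟩ := I.exists_psi_eq e hq
    exact ⟨x.1, x.2, rfl⟩
  · exact fun y hy => (I.contDiffAt_alpha e hy).contDiffWithinAt
  · exact ((I.phi_image_orbits e hn).subset hK).1

end Param

theorem isOpenSubset_phi_image {D : WeyrData} {μ : YoungDiagram} (I : MultiIndex D (μ.rowLen 0))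
    (e : I.Free ≃ Fin (paramDim μ D)) (hn : μ.card = Fintype.card D.Idx) :
    IsOpenSubset (phi μ D.mat '' I.orbits)
      (feedbackSet (brunovskyF μ) (brunovskyG μ) D.mat) :=
  ⟨_, I.isOpen_solveDom e, I.phi_image_orbits e hn⟩

end MultiIndex

theorem iUnion_orbits (μ : YoungDiagram) (D : WeyrData) :
    (⋃ I : MultiIndex D (μ.rowLen 0), I.orbits) = univ := by
  refine eq_univ_of_forall fun q => ?_
  induction q using Quotient.inductionOn with
  | h P =>
    have hr : (toMat P.1).rank = Fintype.card D.Idx := P.2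
    obtain ⟨I, hI⟩ := exists_multiIndex (μ := μ) (D := D) (Z := topRows (toMat P.1))
      fun κ _ U hU => by
        rw [← toMat_eq] at hU
        exact eq_zero_of_mul_eq_zero hr hU
    exact mem_iUnion.2 ⟨I, P, hI, rfl⟩

theorem iUnion_phi_image {μ : YoungDiagram} {D : WeyrData} (hn : μ.card = Fintype.card D.Idx) :
    (⋃ I : MultiIndex D (μ.rowLen 0), phi μ D.mat '' I.orbits) =
      feedbackSet (brunovskyF μ) (brunovskyG μ) D.mat := by
  rw [← image_iUnion, iUnion_orbits, image_univ, range_phi hn]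

/-! ### Feedback matrices with additional rows -/

section Extended

variable {μ : YoungDiagram} {l : ℕ} {ι : Type} [Fintype ι] [DecidableEq ι] {A : Matrix ι ι ℝ}

theorem fromRows_mem_feedbackSet_iff {K₁ : Matrix (Fin (μ.rowLen 0)) (Cell μ) ℝ}
    {K₂ : Matrix (Fin l) (Cell μ) ℝ} :
    Matrix.fromRows K₁ K₂ ∈ feedbackSet (brunovskyF μ) (brunovskyGFull μ l) A ↔
      K₁ ∈ feedbackSet (brunovskyF μ) (brunovskyG μ) A := by
  simp only [feedbackSet, mem_ofPred_eq]
  rw [brunovskyGFull, Matrix.fromCols_mul_fromRows, Matrix.zero_mul, add_zero]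

/-- The rows `K₂` meet the zero columns of `G`, so all statements for `(F, G)` are preimages of
those for `(F, G₁)` under the projection to the upper rows. -/
theorem fromRows_image_eq (Y : Set (Matrix (Fin (μ.rowLen 0)) (Cell μ) ℝ)) :
    (fun K : Matrix (Fin (μ.rowLen 0)) (Cell μ) ℝ × Matrix (Fin l) (Cell μ) ℝ =>
      Matrix.fromRows K.1 K.2) '' (Y ×ˢ univ) = Matrix.toRows₁ ⁻¹' Y := by
  ext K
  constructor
  · rintro ⟨⟨K₁, K₂⟩, h, rfl⟩
    simpa using h
  · intro h
    exact ⟨(K.toRows₁, K.toRows₂), ⟨h, mem_univ _⟩, Matrix.fromRows_toRows K⟩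

theorem toRows₁_preimage_feedbackSet : Matrix.toRows₁ ⁻¹'
    feedbackSet (brunovskyF μ) (brunovskyG μ) A =
      feedbackSet (brunovskyF μ) (brunovskyGFull μ l) A := by
  ext K
  rw [mem_preimage, ← fromRows_mem_feedbackSet_iff (l := l) (K₂ := K.toRows₂),
    Matrix.fromRows_toRows]

variable {m₁ m₂ n : Type} [Fintype m₁] [Fintype m₂] [Fintype n]

theorem contDiff_toRows₁ : ContDiff ℝ ∞ (Matrix.toRows₁ : Matrix (m₁ ⊕ m₂) n ℝ → _) :=
  contDiff_iff_contDiffAt.2 fun _ =>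
    contDiffAt_matrix.2 fun i j => contDiffAt_entry contDiffAt_id (Sum.inl i) j

theorem contDiff_toRows₂ : ContDiff ℝ ∞ (Matrix.toRows₂ : Matrix (m₁ ⊕ m₂) n ℝ → _) :=
  contDiff_iff_contDiffAt.2 fun _ =>
    contDiffAt_matrix.2 fun i j => contDiffAt_entry contDiffAt_id (Sum.inr i) j

theorem contDiff_fromRows : ContDiff ℝ ∞
    (fun K : Matrix m₁ n ℝ × Matrix m₂ n ℝ => Matrix.fromRows K.1 K.2) := by
  refine contDiff_iff_contDiffAt.2 fun _ => contDiffAt_matrix.2 fun i j => ?_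
  rcases i with i | i
  · exact contDiffAt_entry contDiffAt_fst i j
  · exact contDiffAt_entry contDiffAt_snd i j

theorem IsOpenSubset.preimage_toRows₁ {Y H : Set (Matrix m₁ n ℝ)} (h : IsOpenSubset Y H) :
    IsOpenSubset (Matrix.toRows₁ ⁻¹' Y : Set (Matrix (m₁ ⊕ m₂) n ℝ)) (Matrix.toRows₁ ⁻¹' H) := by
  obtain ⟨O, hO, rfl⟩ := h
  exact ⟨_, hO.preimage contDiff_toRows₁.continuous, rfl⟩

theorem IsDiffeoOnto.fromRows {E : Type} [NormedAddCommGroup E] [NormedSpace ℝ E]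
    {f : E → Matrix m₁ n ℝ} {X : Set E} {Y : Set (Matrix m₁ n ℝ)} (h : IsDiffeoOnto f X Y) :
    IsDiffeoOnto (fun x : E × Matrix m₂ n ℝ => Matrix.fromRows (f x.1) x.2) (X ×ˢ univ)
      (Matrix.toRows₁ ⁻¹' Y) := by
  obtain ⟨⟨hm, hi, hs⟩, hf, g, hg, hgs⟩ := h
  refine ⟨⟨fun x hx => ?_, ?_, fun K hK => ?_⟩, fun x hx => ?_,
    fun K => (g K.toRows₁, K.toRows₂), fun x hx => ?_, fun K hK => ?_⟩
  · change Matrix.toRows₁ (Matrix.fromRows _ _) ∈ Y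
    rw [Matrix.toRows₁_fromRows]
    exact hm hx.1
  · rintro ⟨x, K⟩ hx ⟨y, L⟩ hy hxy
    obtain ⟨h1, h2⟩ := Matrix.fromRows_inj hxy
    exact Prod.ext (hi hx.1 hy.1 h1) h2
  · obtain ⟨x, hx, hxK⟩ := hs hK
    refine ⟨(x, K.toRows₂), ⟨hx, mem_univ _⟩, ?_⟩
    simp only
    rw [hxK, Matrix.fromRows_toRows]
  · obtain ⟨U, hU, hxU, F, hF, hFe⟩ := hf x.1 hx.1
    refine ⟨U ×ˢ univ, hU.prod isOpen_univ, ⟨hxU, mem_univ _⟩,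
      fun y => Matrix.fromRows (F y.1) y.2, ?_, ?_⟩
    · exact contDiff_fromRows.comp_contDiffOn
        ((hF.comp contDiffOn_fst fun y hy => hy.1).prodMk contDiffOn_snd)
    · intro y hy
      simp only
      rw [hFe ⟨hy.1.1, hy.2.1⟩]
  · simp only [Matrix.toRows₁_fromRows, Matrix.toRows₂_fromRows]
    rw [hg hx.1]
  · obtain ⟨U, hU, hKU, F, hF, hFe⟩ := hgs _ hK
    refine ⟨Matrix.toRows₁ ⁻¹' U, hU.preimage contDiff_toRows₁.continuous, hKU,
      fun K => (F K.toRows₁, K.toRows₂), ?_, ?_⟩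
    · exact (hF.comp contDiff_toRows₁.contDiffOn fun y hy => hy).prodMk
        contDiff_toRows₂.contDiffOn
    · intro y hy
      simp only
      rw [hFe ⟨hy.1, hy.2⟩]

end Extended

/-! ### The orbit space as a topological space -/

section Orbit

variable {ι : Type} [Fintype ι] [DecidableEq ι] (μ : YoungDiagram) (A : Matrix ι ι ℝ)

theorem contDiff_toMat : ContDiff ℝ ∞ (toMat : truncSpace μ A → Matrix (Cell μ) ι ℝ) :=
  (truncSpace μ A).subtypeL.contDiff

/-- The linear map that takes `Z` to the truncated observability matrix with first block of
rows `Z`. -/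
def truncOfLinear : Matrix (Fin (μ.rowLen 0)) ι ℝ →ₗ[ℝ] truncSpace μ A where
  toFun := truncOf μ A
  map_add' Z Z' := Subtype.ext (observability_add μ A Z Z')
  map_smul' t Z := Subtype.ext (observability_smul μ A t Z)

theorem contDiff_truncOf : ContDiff ℝ ∞ (truncOf μ A) :=
  (truncOfLinear μ A).toContinuousLinearMap.contDiff

theorem finrank_truncSpace :
    Module.finrank ℝ (truncSpace μ A) = μ.rowLen 0 * Fintype.card ι := by
  have e : Matrix (Fin (μ.rowLen 0)) ι ℝ ≃ₗ[ℝ] truncSpace μ A :=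
    LinearEquiv.ofBijective (truncOfLinear μ A)
      ⟨fun Z Z' h => by
        have := congrArg (fun P => topRows (toMat P)) h
        change topRows (observability μ A Z) = topRows (observability μ A Z') at this
        rwa [topRows_observability, topRows_observability] at this,
      fun P => ⟨topRows (toMat P), Subtype.ext (toMat_eq P).symm⟩⟩
  rw [← e.finrank_eq, Module.finrank_matrix]
  simp

theorem contDiffAt_feedbackOf {P : truncSpace μ A} (hP : P ∈ fullRank μ A) :
    ContDiffAt ℝ ∞ (fun P : truncSpace μ A => feedbackOf μ A (toMat P)) P := by
  have h : ∀ P : truncSpace μ A, feedbackOf μ A (toMat P) =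
      lastRows μ A (topRows (toMat P)) * leftInv (toMat P) := fun P => rfl
  simp only [h]
  have h1 := (contDiff_toMat μ A).contDiffAt (x := P)
  exact contDiffAt_mul (contDiffAt_lastRows_topRows h1) (contDiffAt_leftInv h1 hP)
where
  contDiffAt_lastRows_topRows {P : truncSpace μ A} (h1 : ContDiffAt ℝ ∞ toMat P) :
      ContDiffAt ℝ ∞ (fun P : truncSpace μ A => lastRows μ A (topRows (toMat P))) P :=
    MultiIndex.contDiffAt_lastRows
      (contDiffAt_matrix.2 fun a d => contDiffAt_entry h1 (topCell μ a) d)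

theorem continuous_orbitMk : Continuous (orbitMk μ A) := continuous_quotient_mk'

theorem continuous_phi : Continuous (phi μ A) :=
  Continuous.quotient_lift (continuous_iff_continuousAt.2 fun P =>
    (contDiffAt_feedbackOf μ A P.2).continuousAt.comp continuous_subtype_val.continuousAt) _

/-- A function on the orbit space is smooth if its composition with the projection is smooth. -/
theorem contMDiffAt_of_comp_orbitMk {E F : Type} [NormedAddCommGroup E] [NormedSpace ℝ E]
    [NormedAddCommGroup F] [NormedSpace ℝ F]
    [cs : ChartedSpace E (OrbitSpace μ A)] (h : IsOrbitManifold μ A E cs)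
    {f : OrbitSpace μ A → F} {g : truncSpace μ A → F} {P : fullRank μ A}
    (hfg : ∀ P : fullRank μ A, f (orbitMk μ A P) = g P.1) (hg : ContDiffAt ℝ ∞ g P.1) :
    ContMDiffAt 𝓘(ℝ, E) 𝓘(ℝ, F) ∞ f (orbitMk μ A P) := by
  obtain ⟨hM, hS⟩ := h
  have hP := hS.isSubmersionAt P
  have hsrc : orbitMk μ A P ∈ hP.codChart.source := hP.mem_codChart_source
  let L := hP.equiv
  -- A local section of the projection through `P`: in the charts of the submersion, the
  -- complementary coordinate is frozen at its value at `P`. Near the orbit of `P`, `f` equals `g ∘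
  -- s`.
  let s : OrbitSpace μ A → fullRank μ A := fun q' =>
    hP.domChart.symm (L.symm (hP.codChart q', (L (hP.domChart P)).2))
  have hw : ∀ y ∈ hP.domChart.target,
      hP.codChart (orbitMk μ A (hP.domChart.symm y)) = (L y).1 := by
    intro y hy
    have hy' : y ∈ (hP.domChart.extend 𝓘(ℝ, truncSpace μ A)).target := by
      simpa [mfld_simps] using hy
    have := hP.writtenInCharts hy'
    simpa [mfld_simps] using this
  have hLP : L.symm (hP.codChart (orbitMk μ A P), (L (hP.domChart P)).2) = hP.domChart P := by
    rw [L.symm_apply_eq]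
    refine Prod.ext ?_ rfl
    have := hw _ (hP.domChart.map_source hP.mem_domChart_source)
    rwa [hP.domChart.left_inv hP.mem_domChart_source] at this
  have hsP : s (orbitMk μ A P) = P := by
    change hP.domChart.symm _ = P
    rw [hLP, hP.domChart.left_inv hP.mem_domChart_source]
  have hcod : ContMDiffAt 𝓘(ℝ, E) 𝓘(ℝ, E) ∞ hP.codChart (orbitMk μ A P) :=
    contMDiffAt_of_mem_maximalAtlas hP.codChart_mem_maximalAtlas hsrc
  have hin : ContMDiffAt 𝓘(ℝ, E) 𝓘(ℝ, truncSpace μ A) ∞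
      (fun q' => L.symm (hP.codChart q', (L (hP.domChart P)).2)) (orbitMk μ A P) := by
    have h1 : ContDiff ℝ ∞ (fun z : E => L.symm (z, (L (hP.domChart P)).2)) :=
      L.symm.contDiff.comp (contDiff_id.prodMk contDiff_const)
    exact h1.contMDiff.contMDiffAt.comp _ hcod
  have htgt : L.symm (hP.codChart (orbitMk μ A P), (L (hP.domChart P)).2) ∈
      hP.domChart.target := by
    rw [hLP]
    exact hP.domChart.map_source hP.mem_domChart_source
  have hs : ContMDiffAt 𝓘(ℝ, E) 𝓘(ℝ, truncSpace μ A) ∞ s (orbitMk μ A P) := by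
    refine ContMDiffAt.comp (g := hP.domChart.symm) _ ?_ hin
    exact (contMDiffOn_symm_of_mem_maximalAtlas hP.domChart_mem_maximalAtlas).contMDiffAt
      (hP.domChart.open_target.mem_nhds htgt)
  have hev : f =ᶠ[nhds (orbitMk μ A P)] fun q' => g (s q').1 := by
    filter_upwards [hP.codChart.open_source.mem_nhds hsrc,
      hin.continuousAt.preimage_mem_nhds (hP.domChart.open_target.mem_nhds htgt)] with q' h1 h2
    have h3 := hw _ h2
    rw [L.apply_symm_apply] at h3
    have h4 : orbitMk μ A (s q') = q' :=
      hP.codChart.injOn (hP.source_subset_preimage_source (hP.domChart.map_target h2)) h1 h3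
    rw [← hfg, h4]
  refine ContMDiffAt.congr_of_eventuallyEq ?_ hev
  have hF : ContMDiffAt 𝓘(ℝ, truncSpace μ A) 𝓘(ℝ, F) ∞ (fun P : fullRank μ A => g P.1)
      (s (orbitMk μ A P)) := by
    rw [hsP]
    exact contMDiffAt_subtype_iff.2 hg.contMDiffAt
  exact hF.comp _ hs

end Orbit

namespace MultiIndex

section

variable {D : WeyrData} {μ : YoungDiagram} (I : MultiIndex D (μ.rowLen 0))
  (e : I.Free ≃ Fin (paramDim μ D))

theorem contDiff_nu : ContDiff ℝ ∞ (I.nu e) :=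
  (contDiff_truncOf μ D.mat).comp (contDiff_iff_contDiffAt.2 fun _ => I.contDiffAt_rows e)

theorem contDiffAt_solve_feedbackOf {P : truncSpace μ D.mat} (hP : P ∈ fullRank μ D.mat)
    (h : (I.sysMat e (feedbackOf μ D.mat (toMat P))).rank = Fintype.card (Fin (paramDim μ D))) :
    ContDiffAt ℝ ∞ (fun P : truncSpace μ D.mat => I.solve e (feedbackOf μ D.mat (toMat P))) P :=
  ContDiffAt.comp (f := fun P : truncSpace μ D.mat => feedbackOf μ D.mat (toMat P))
    (g := I.solve e) P (I.contDiffAt_solve e h) (contDiffAt_feedbackOf μ D.mat hP)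

variable (hn : μ.card = Fintype.card D.Idx)

include e hn

theorem isOpen_orbits : IsOpen I.orbits := by
  rw [I.orbits_eq_preimage e hn]
  exact (I.isOpen_solveDom e).preimage (continuous_phi μ D.mat)

/-- `ψ` is smooth because `ν` and `π` are. Its inverse `solve ∘ φ` is smooth because its composition
with `π` is smooth in `P`. Both arguments work for every structure that makes `π` a submersion. -/
theorem exists_diffeomorph (hW : IsOpen (I.dom e)) (hV : IsOpen I.orbits)
    [cs : ChartedSpace (Param μ D) (OrbitSpace μ D.mat)]
    (h : IsOrbitManifold μ D.mat (Param μ D) cs) :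
    ∃ Φ : Diffeomorph 𝓘(ℝ, Param μ D) 𝓘(ℝ, Param μ D)
        (⟨I.dom e, hW⟩ : TopologicalSpace.Opens (Param μ D))
        (⟨I.orbits, hV⟩ : TopologicalSpace.Opens (OrbitSpace μ D.mat)) ∞,
      ∀ x : I.dom e, (Φ x : OrbitSpace μ D.mat) = I.psi e x := by
  refine ⟨⟨⟨fun x => ⟨I.psi e x, I.psi_mem_orbits e x⟩,
    fun q => ⟨I.solve e (phi μ D.mat q.1), (I.psi_solve_phi e hn q.2).1⟩, fun x => ?_,
    fun q => ?_⟩, ?_, ?_⟩, fun x => rfl⟩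
  · refine Subtype.ext ?_
    change I.solve e (phi μ D.mat (I.psi e x)) = x.1
    rw [← I.alpha_eq, I.solve_alpha e hn x.2]
  · exact Subtype.ext (I.psi_solve_phi e hn q.2).2
  · rw [← ContMDiff.subtypeVal_comp_iff]
    have h1 : ContMDiff 𝓘(ℝ, Param μ D) 𝓘(ℝ, truncSpace μ D.mat) ∞
        (fun x : (⟨I.dom e, hW⟩ : TopologicalSpace.Opens (Param μ D)) =>
          (⟨I.nu e x.1, x.2.1⟩ : fullRank μ D.mat)) := by
      rw [← ContMDiff.subtypeVal_comp_iff]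
      intro x
      exact (contMDiffAt_subtype_iff (f := I.nu e)).2 (I.contDiff_nu e).contMDiff.contMDiffAt
    exact h.2.contMDiff.comp h1
  · rw [← ContMDiff.subtypeVal_comp_iff]
    intro q
    refine (contMDiffAt_subtype_iff (f := fun q => I.solve e (phi μ D.mat q))).2 ?_
    obtain ⟨q, hq⟩ := q
    have h1 : phi μ D.mat q ∈ I.solveDom e := (I.orbits_eq_preimage e hn).subset hq
    induction q using Quotient.inductionOn with
    | h P =>
    have h2 : (I.sysMat e (feedbackOf μ D.mat (toMat P.1))).rank =
      Fintype.card (Fin (paramDim μ D)) := h1.1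
    exact contMDiffAt_of_comp_orbitMk μ D.mat h
      (f := fun q => I.solve e (phi μ D.mat q)) (P := P) (fun _ => rfl)
      (I.contDiffAt_solve_feedbackOf e P.2 h2)

end

end MultiIndex

/-! ### The manifold structure of the orbit space -/

namespace MultiIndex

variable {D : WeyrData} {μ : YoungDiagram} (I : MultiIndex D (μ.rowLen 0))

theorem nonempty_equiv (hn : μ.card = Fintype.card D.Idx) :
    Nonempty (I.Free ≃ Fin (paramDim μ D)) := by
  classical
  refine ⟨Fintype.equivFinOfCardEq ?_⟩
  have := I.card_free_add
  rw [paramDim, hn, ← Nat.card_eq_fintype_card, mul_comm, ← this, Nat.add_sub_cancel]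

-- A multi-index guarantees that the subtraction in `paramDim` is not truncated, since the `N` fixed
-- places are among the `nr` places.
include I in
theorem paramDim_add (hn : μ.card = Fintype.card D.Idx) :
    paramDim μ D + D.centDim = μ.rowLen 0 * Fintype.card D.Idx := by
  have := I.card_free_add
  rw [paramDim, hn, mul_comm]
  omega

variable (e : I.Free ≃ Fin (paramDim μ D)) (hn : μ.card = Fintype.card D.Idx)

open Classical in
/-- The chart of the orbit space given by the parameters of the matrices in reduced form. -/
def orbitChart [Nonempty (OrbitSpace μ D.mat)] :
    OpenPartialHomeomorph (OrbitSpace μ D.mat) (Param μ D) where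
  toFun q := I.solve e (phi μ D.mat q)
  invFun x := if h : x ∈ I.dom e then I.psi e ⟨x, h⟩ else Classical.arbitrary _
  source := I.orbits
  target := I.dom e
  map_source' q hq := (I.psi_solve_phi e hn hq).1
  map_target' x hx := by
    rw [dif_pos hx]
    exact I.psi_mem_orbits e _
  left_inv' q hq := by
    obtain ⟨h, h'⟩ := I.psi_solve_phi e hn hq
    rw [dif_pos h, h']
  right_inv' x hx := by
    rw [dif_pos hx, ← I.alpha_eq, I.solve_alpha e hn hx]
  open_source := I.isOpen_orbits e hn
  open_target := I.isOpen_dom e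
  continuousOn_toFun q hq := by
    have h : phi μ D.mat q ∈ I.solveDom e := (I.orbits_eq_preimage e hn).subset hq
    exact ((I.contDiffAt_solve e h.1).continuousAt.comp
      (continuous_phi μ D.mat).continuousAt).continuousWithinAt
  continuousOn_invFun := by
    rw [continuousOn_iff_continuous_domRestrict]
    have h : Continuous (I.psi e) := (continuous_orbitMk μ D.mat).comp
      (Continuous.subtype_mk ((I.contDiff_nu e).continuous.comp continuous_subtype_val) _)
    refine h.congr fun x => ?_
    change _ = dite _ _ _
    rw [dif_pos x.2]

theorem orbitChart_symm [Nonempty (OrbitSpace μ D.mat)] {x : Param μ D} (hx : x ∈ I.dom e) :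
    (I.orbitChart e hn).symm x = I.psi e ⟨x, hx⟩ := dif_pos hx

/-- The transition map is `solve` for `J` after `α` for `I`, so it factors through feedback
matrices. -/
theorem contDiffOn_symm_trans [Nonempty (OrbitSpace μ D.mat)] (J : MultiIndex D (μ.rowLen 0))
    (e' : J.Free ≃ Fin (paramDim μ D)) :
    ContDiffOn ℝ ∞ ((I.orbitChart e hn).symm ≫ₕ J.orbitChart e' hn)
      ((I.orbitChart e hn).symm ≫ₕ J.orbitChart e' hn).source := by
  have key : ∀ x ∈ ((I.orbitChart e hn).symm ≫ₕ J.orbitChart e' hn).source,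
      ∃ hx : x ∈ I.dom e, I.psi e ⟨x, hx⟩ ∈ J.orbits := by
    intro x hx
    rw [OpenPartialHomeomorph.trans_source] at hx
    have hx' : x ∈ I.dom e := hx.1
    refine ⟨hx', ?_⟩
    rw [← I.orbitChart_symm e hn hx']
    exact hx.2
  intro x hx
  obtain ⟨h1, h2⟩ := key x hx
  rw [J.orbits_eq_preimage e' hn, mem_preimage, ← I.alpha_eq] at h2
  have h4 : ContDiffAt ℝ ∞ (fun y => J.solve e' (I.alpha e y)) x :=
    ContDiffAt.comp (g := J.solve e') (f := I.alpha e) x (J.contDiffAt_solve e' h2.1)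
      (I.contDiffAt_alpha e h1)
  refine h4.contDiffWithinAt.congr_of_mem ?_ hx
  intro y hy
  obtain ⟨h5, -⟩ := key y hy
  rw [OpenPartialHomeomorph.coe_trans, Function.comp_apply, I.orbitChart_symm e hn h5]
  rfl

end MultiIndex

theorem exists_mem_orbits {μ : YoungDiagram} {D : WeyrData} (q : OrbitSpace μ D.mat) :
    ∃ I : MultiIndex D (μ.rowLen 0), q ∈ I.orbits :=
  mem_iUnion.1 ((iUnion_orbits μ D).superset (mem_univ q))

/-- The atlas of the orbit space that consists of the parametrizations by reduced forms. -/
@[reducible]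
def orbitChartedSpace {μ : YoungDiagram} {D : WeyrData} (hn : μ.card = Fintype.card D.Idx)
    [Nonempty (OrbitSpace μ D.mat)] : ChartedSpace (Param μ D) (OrbitSpace μ D.mat) where
  atlas := range fun I : MultiIndex D (μ.rowLen 0) =>
    I.orbitChart (Classical.choice (I.nonempty_equiv hn)) hn
  chartAt q := (Classical.choose (exists_mem_orbits q)).orbitChart
    (Classical.choice ((Classical.choose (exists_mem_orbits q)).nonempty_equiv hn)) hn
  mem_chart_source q := Classical.choose_spec (exists_mem_orbits q)
  chart_mem_atlas _ := ⟨_, rfl⟩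

theorem isManifold_orbitSpace {μ : YoungDiagram} {D : WeyrData}
    (hn : μ.card = Fintype.card D.Idx) [Nonempty (OrbitSpace μ D.mat)] :
    letI := orbitChartedSpace hn
    IsManifold 𝓘(ℝ, Param μ D) ∞ (OrbitSpace μ D.mat) := by
  let := orbitChartedSpace hn
  refine isManifold_of_contDiffOn _ _ _ ?_
  rintro _ _ ⟨I, rfl⟩ ⟨J, rfl⟩
  have h := I.contDiffOn_symm_trans (Classical.choice (I.nonempty_equiv hn)) hn J
    (Classical.choice (J.nonempty_equiv hn))
  rw [modelWithCornersSelf_coe, modelWithCornersSelf_coe_symm, preimage_id, range_id, inter_univ,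
    Function.id_comp, Function.comp_id]
  exact h

/-- The commutant of the real Weyr form, as a subspace of the space of matrices. -/
abbrev centSubmodule (D : WeyrData) : Submodule ℝ (Matrix D.Idx D.Idx ℝ) :=
  Subalgebra.toSubmodule (Subalgebra.centralizer ℝ ({D.mat} : Set (Matrix D.Idx D.Idx ℝ)))

theorem exists_projection (D : WeyrData) :
    ∃ p : Matrix D.Idx D.Idx ℝ →ₗ[ℝ] centSubmodule D, ∀ X : centSubmodule D, p X.1 = X := by
  obtain ⟨p, hp⟩ := (centSubmodule D).subtype.exists_leftInverse_of_injective
    (Submodule.ker_subtype _)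
  exact ⟨p, fun X => LinearMap.congr_fun hp X⟩

/-- A projection onto the commutant. -/
def centProj (D : WeyrData) : Matrix D.Idx D.Idx ℝ →ₗ[ℝ] centSubmodule D :=
  Classical.choose (exists_projection D)

theorem centProj_apply {D : WeyrData} (X : centSubmodule D) : centProj D X.1 = X :=
  Classical.choose_spec (exists_projection D) X

/-! ### Local product structure of the nonsingular matrices over the orbit space -/

namespace MultiIndex

variable {D : WeyrData} {μ : YoungDiagram} (I : MultiIndex D (μ.rowLen 0))

variable (e : I.Free ≃ Fin (paramDim μ D)) (hn : μ.card = Fintype.card D.Idx)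

/-- The decomposition of an admissible matrix into the parameters of its reduced form and an element
of the commutant. -/
def splitFun (P : truncSpace μ D.mat) : Param μ D × centSubmodule D :=
  (I.solve e (feedbackOf μ D.mat (toMat P)),
    centProj D (leftInv (observability μ D.mat (I.rows e (I.solve e
      (feedbackOf μ D.mat (toMat P))))) * toMat P))

/-- The inverse of `splitFun`. -/
def joinFun (y : Param μ D × centSubmodule D) : truncSpace μ D.mat :=
  truncOf μ D.mat (I.rows e y.1 * y.2.1)

theorem toMat_joinFun (y : Param μ D × centSubmodule D) :
    toMat (I.joinFun e y) = observability μ D.mat (I.rows e y.1) * y.2.1 :=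
  observability_mul_of_comm _ (mem_cent_iff.1 y.2.2)

/-- The domain of `splitFun`. -/
def splitSource : Set (truncSpace μ D.mat) :=
  {P | P ∈ fullRank μ D.mat ∧ feedbackOf μ D.mat (toMat P) ∈ I.solveDom e}

/-- The domain of `joinFun`. -/
def splitTarget : Set (Param μ D × centSubmodule D) := {y | y.1 ∈ I.dom e ∧ IsUnit y.2.1}

theorem contDiffAt_splitFun {P : truncSpace μ D.mat} (hP : P ∈ I.splitSource e) :
    ContDiffAt ℝ ∞ (I.splitFun e) P := by
  have h1 := I.contDiffAt_solve_feedbackOf e hP.1 hP.2.1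
  refine h1.prodMk ?_
  refine (centProj D).toContinuousLinearMap.contDiff.contDiffAt.comp P ?_
  refine contDiffAt_mul ?_ (contDiff_toMat μ D.mat).contDiffAt
  refine contDiffAt_leftInv (contDiffAt_observability ?_) hP.2.2
  exact ContDiffAt.comp (g := I.rows e)
    (f := fun P : truncSpace μ D.mat => I.solve e (feedbackOf μ D.mat (toMat P))) P
    (I.contDiffAt_rows e) h1

theorem contDiff_joinFun : ContDiff ℝ ∞ (I.joinFun e) := by
  refine (contDiff_truncOf μ D.mat).comp (contDiff_iff_contDiffAt.2 fun y => ?_)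
  exact contDiffAt_mul (ContDiffAt.comp (g := I.rows e) (f := Prod.fst) y
    (I.contDiffAt_rows e) contDiffAt_fst)
    ((centSubmodule D).subtypeL.contDiff.contDiffAt.comp y contDiffAt_snd)

theorem isOpen_splitSource : IsOpen (I.splitSource e) :=
  ContinuousOn.isOpen_inter_preimage (f := fun P : truncSpace μ D.mat =>
    feedbackOf μ D.mat (toMat P))
    (fun _ hP => (contDiffAt_feedbackOf μ D.mat hP).continuousAt.continuousWithinAt)
    (fullRank μ D.mat).isOpen (I.isOpen_solveDom e)

theorem isOpen_splitTarget : IsOpen (I.splitTarget e) := by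
  have : I.splitTarget e = Prod.fst ⁻¹' I.dom e ∩ {y | y.2.1.det ≠ 0} := by
    ext y
    exact and_congr_right fun _ => (Matrix.isUnit_iff_isUnit_det _).trans isUnit_iff_ne_zero
  rw [this]
  exact ((I.isOpen_dom e).preimage continuous_fst).inter
    (isOpen_ne_fun (by fun_prop) continuous_const)

include hn

/-- On this domain `P = ν(x) X` with `X` in the commutant, so `ν(x)⁻¹ P = X` and the projection
`centProj` changes nothing. -/
theorem splitFun_spec {P : truncSpace μ D.mat} (hP : P ∈ I.splitSource e) :
    I.splitFun e P ∈ I.splitTarget e ∧ I.joinFun e (I.splitFun e P) = P := by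
  have hq : orbitMk μ D.mat ⟨P, hP.1⟩ ∈ I.orbits :=
    (I.orbits_eq_preimage e hn).superset hP.2
  obtain ⟨h1, h2⟩ := I.psi_solve_phi e hn hq
  obtain ⟨X, hX, h3⟩ := Quotient.exact h2
  change I.solve e (feedbackOf μ D.mat (toMat P)) ∈ I.dom e at h1
  change toMat P = observability μ D.mat (I.rows e (I.solve e
    (feedbackOf μ D.mat (toMat P)))) * X.1 at h3
  have hXc : X.1 ∈ centSubmodule D := mem_cent_iff.2 hX
  clear h2
  have h5 : leftInv (observability μ D.mat (I.rows e (I.solve e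
      (feedbackOf μ D.mat (toMat P))))) * toMat P = X.1 := by
    generalize I.solve e (feedbackOf μ D.mat (toMat P)) = x at h1 h3
    rw [h3, ← Matrix.mul_assoc, leftInv_mul ((I.mem_dom_iff e).1 h1), Matrix.one_mul]
  have h4 : I.splitFun e P = (I.solve e (feedbackOf μ D.mat (toMat P)),
      ⟨X.1, hXc⟩) := by
    rw [splitFun, h5, centProj_apply ⟨X.1, hXc⟩]
  rw [h4]
  refine ⟨⟨h1, X.isUnit⟩, Subtype.ext ?_⟩
  exact (I.toMat_joinFun e _).trans h3.symm

theorem joinFun_spec {y : Param μ D × centSubmodule D} (hy : y ∈ I.splitTarget e) :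
    I.joinFun e y ∈ I.splitSource e ∧ I.splitFun e (I.joinFun e y) = y := by
  obtain ⟨x, X, hX⟩ := y
  obtain ⟨hx, hu⟩ := hy
  have hXc := mem_cent_iff.1 hX
  have h1 : toMat (I.joinFun e (x, ⟨X, hX⟩)) = observability μ D.mat (I.rows e x) * X :=
    I.toMat_joinFun e _
  have h2 : feedbackOf μ D.mat (toMat (I.joinFun e (x, ⟨X, hX⟩))) = I.alpha e x := by
    rw [h1]
    exact feedbackOf_mul μ D.mat _ hu.unit hXc
  refine ⟨⟨?_, ?_⟩, ?_⟩
  · change (toMat _).rank = _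
    rw [h1, Matrix.rank_mul_eq_left_of_isUnit_det _ _ ((Matrix.isUnit_iff_isUnit_det _).1 hu)]
    exact (I.mem_dom_iff e).1 hx
  · rw [h2]
    exact I.alpha_mem_solveDom e hn hx
  · rw [splitFun, h2, I.solve_alpha e hn hx, h1, ← Matrix.mul_assoc,
      leftInv_mul ((I.mem_dom_iff e).1 hx), Matrix.one_mul]
    exact Prod.ext rfl (centProj_apply ⟨X, hX⟩)

-- Both sides have dimension `nr = (nr - N) + N`. The isomorphism is arbitrary; it only makes the
-- decomposition a chart with values in the model space.
omit hn in
include I in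
theorem nonempty_splitEquiv (hn : μ.card = Fintype.card D.Idx) :
    Nonempty (truncSpace μ D.mat ≃L[ℝ] (Param μ D × centSubmodule D)) := by
  refine ⟨ContinuousLinearEquiv.ofFinrankEq ?_⟩
  rw [finrank_truncSpace, Module.finrank_prod, finrank_euclideanSpace, Fintype.card_fin,
    ← I.paramDim_add hn]
  rfl

omit hn in
/-- The chart of the space of the truncated observability matrices in which the projection to the
orbit space is a linear projection. -/
def splitChart (L : truncSpace μ D.mat ≃L[ℝ] (Param μ D × centSubmodule D))
    (hn : μ.card = Fintype.card D.Idx) :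
    OpenPartialHomeomorph (truncSpace μ D.mat) (truncSpace μ D.mat) where
  toFun P := L.symm (I.splitFun e P)
  invFun y := I.joinFun e (L y)
  source := I.splitSource e
  target := L ⁻¹' I.splitTarget e
  map_source' P hP := by
    rw [mem_preimage, L.apply_symm_apply]
    exact (I.splitFun_spec e hn hP).1
  map_target' y hy := (I.joinFun_spec e hn hy).1
  left_inv' P hP := by
    rw [L.apply_symm_apply]
    exact (I.splitFun_spec e hn hP).2
  right_inv' y hy := by rw [(I.joinFun_spec e hn hy).2, L.symm_apply_apply]
  open_source := I.isOpen_splitSource e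
  open_target := (I.isOpen_splitTarget e).preimage L.continuous
  continuousOn_toFun P hP := (L.symm.continuous.continuousAt.comp
    (I.contDiffAt_splitFun e hP).continuousAt).continuousWithinAt
  continuousOn_invFun :=
    ((I.contDiff_joinFun e).continuous.comp L.continuous).continuousOn

omit hn in
theorem splitChart_mem_contDiffGroupoid
    (L : truncSpace μ D.mat ≃L[ℝ] (Param μ D × centSubmodule D))
    (hn : μ.card = Fintype.card D.Idx) :
    I.splitChart e L hn ∈ contDiffGroupoid ∞ 𝓘(ℝ, truncSpace μ D.mat) := by
  rw [contDiffGroupoid, mem_groupoid_of_pregroupoid]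
  constructor
  · intro P hP
    exact (L.symm.contDiff.contDiffAt.comp P
      (I.contDiffAt_splitFun e hP.1)).contDiffWithinAt
  · exact ((I.contDiff_joinFun e).comp L.contDiff).contDiffOn

end MultiIndex

/-- Local diffeomorphisms of the linear space restrict to charts of its open subset; this is applied
to `splitChart` on the nonsingular matrices. -/
theorem subtypeRestr_mem_maximalAtlas_of_mem_groupoid {E : Type} [NormedAddCommGroup E]
    [NormedSpace ℝ E] {Θ : OpenPartialHomeomorph E E} (hΘ : Θ ∈ contDiffGroupoid ∞ 𝓘(ℝ, E))
    {U : TopologicalSpace.Opens E} (hU : Nonempty U) :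
    Θ.subtypeRestr hU ∈ IsManifold.maximalAtlas 𝓘(ℝ, E) ∞ U := by
  intro c hc
  obtain ⟨x, rfl⟩ := TopologicalSpace.Opens.chart_eq hU hc
  set G := contDiffGroupoid ∞ 𝓘(ℝ, E)
  have hm := G.mem_maximalAtlas_of_mem_groupoid hΘ _ (chart_mem_atlas E x.1)
  exact ⟨G.mem_of_eqOnSource (closedUnderRestriction' hm.1 (Θ.isOpen_inter_preimage_symm U.2))
      (Θ.subtypeRestr_symm_trans_subtypeRestr hU _),
    G.mem_of_eqOnSource (closedUnderRestriction' hm.2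
      ((chartAt E x.1).isOpen_inter_preimage_symm U.2))
      ((chartAt E x.1).subtypeRestr_symm_trans_subtypeRestr hU _)⟩

/-- In the coordinates `(x, X)` of `P = ν(x) X` and the chart `x` of the orbit, the projection is
`(x, X) ↦ x`. -/
theorem isSubmersion_orbitMk {μ : YoungDiagram} {D : WeyrData}
    (hn : μ.card = Fintype.card D.Idx) [Nonempty (OrbitSpace μ D.mat)] :
    letI := orbitChartedSpace hn
    Manifold.IsSubmersion 𝓘(ℝ, truncSpace μ D.mat) 𝓘(ℝ, Param μ D) ∞ (orbitMk μ D.mat) := by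
  let := orbitChartedSpace hn
  have := isManifold_orbitSpace hn
  refine ⟨centSubmodule D, inferInstance, inferInstance, fun P => ?_⟩
  obtain ⟨I, hI⟩ := exists_mem_orbits (orbitMk μ D.mat P)
  set e := Classical.choice (I.nonempty_equiv hn) with he
  obtain ⟨L⟩ := I.nonempty_splitEquiv hn
  set Θ := I.splitChart e L hn
  have hU : Nonempty (fullRank μ D.mat) := ⟨P⟩
  have hsrc : ∀ Q : fullRank μ D.mat, Q ∈ (Θ.subtypeRestr hU).source ↔
      orbitMk μ D.mat Q ∈ I.orbits := by
    intro Q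
    rw [Θ.subtypeRestr_source, I.orbits_eq_preimage e hn]
    exact ⟨fun h => h.2, fun h => ⟨Q.2, h⟩⟩
  refine Manifold.IsSubmersionAtOfComplement.mk_of_charts L (Θ.subtypeRestr hU)
    (I.orbitChart e hn) ((hsrc P).2 hI) hI
    (subtypeRestr_mem_maximalAtlas_of_mem_groupoid
      (I.splitChart_mem_contDiffGroupoid e L hn) hU)
    (StructureGroupoid.subset_maximalAtlas _ ⟨I, rfl⟩) (fun Q hQ => (hsrc Q).1 hQ) ?_
  intro y hy
  have hy' : y ∈ (Θ.subtypeRestr hU).target := by simpa [mfld_simps] using hy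
  obtain ⟨Q, hQ, rfl⟩ : ∃ Q ∈ (Θ.subtypeRestr hU).source, Θ.subtypeRestr hU Q = y :=
    ⟨_, (Θ.subtypeRestr hU).map_target hy', (Θ.subtypeRestr hU).right_inv hy'⟩
  have h1 : ((I.orbitChart e hn).extend 𝓘(ℝ, Param μ D) ∘ orbitMk μ D.mat ∘
      ((Θ.subtypeRestr hU).extend 𝓘(ℝ, truncSpace μ D.mat)).symm) (Θ.subtypeRestr hU Q) =
      I.orbitChart e hn (orbitMk μ D.mat ((Θ.subtypeRestr hU).symm (Θ.subtypeRestr hU Q))) := by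
    simp only [mfld_simps]
  rw [h1, (Θ.subtypeRestr hU).left_inv hQ]
  change _ = (L (L.symm (I.splitFun e Q.1))).1
  rw [L.apply_symm_apply]
  rfl

theorem exists_isOrbitManifold {μ : YoungDiagram} {D : WeyrData}
    (hn : μ.card = Fintype.card D.Idx) :
    ∃ cs : ChartedSpace (Param μ D) (OrbitSpace μ D.mat),
      IsOrbitManifold μ D.mat (Param μ D) cs := by
  rcases isEmpty_or_nonempty (OrbitSpace μ D.mat) with h | h
  -- Without orbits the conditions are vacuous. This case is separate because a multi-index may fail
  -- to exist, and the charts need a default orbit outside their targets.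
  · let cs := ChartedSpace.empty (Param μ D) (OrbitSpace μ D.mat)
    refine ⟨cs, IsManifold.empty _, PUnit, inferInstance, inferInstance, fun P => ?_⟩
    exact (h.false (orbitMk μ D.mat P)).elim
  · exact ⟨orbitChartedSpace hn, isManifold_orbitSpace hn, isSubmersion_orbitMk hn⟩

theorem t2Space_orbitSpace {μ : YoungDiagram} {D : WeyrData}
    (hn : μ.card = Fintype.card D.Idx) : T2Space (OrbitSpace μ D.mat) :=
  T2Space.of_injective_continuous (phi_injective hn) (continuous_phi μ D.mat)

theorem secondCountable_orbitSpace {μ : YoungDiagram} {D : WeyrData}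
    (hn : μ.card = Fintype.card D.Idx) : SecondCountableTopology (OrbitSpace μ D.mat) := by
  obtain ⟨cs, -⟩ := exists_isOrbitManifold hn
  -- The quotient of a Lindelöf space is Lindelöf, so countably many chart domains cover it, and
  -- each of them is second countable.
  have : LindelofSpace (OrbitSpace μ D.mat) := Quot.lindelofSpace
  obtain ⟨s, hs, hs'⟩ := LindelofSpace.elim_nhds_subcover _ fun x : OrbitSpace μ D.mat =>
    chart_source_mem_nhds (Param μ D) x
  exact ChartedSpace.secondCountable_of_countable_cover (Param μ D) hs' hs

end FeedbackParam

end

open FeedbackParam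
theorem theorem5p13 (μ : YoungDiagram) (D : WeyrData) (hn : μ.card = Fintype.card D.Idx) (l : ℕ) :
    -- the orbit space has a manifold structure for which the projection is a submersion
    (T2Space (OrbitSpace μ D.mat) ∧ SecondCountableTopology (OrbitSpace μ D.mat) ∧
      ∃ cs : ChartedSpace (Param μ D) (OrbitSpace μ D.mat),
        IsOrbitManifold μ D.mat (Param μ D) cs) ∧
    (∀ I : MultiIndex D (μ.rowLen 0),
      -- there are `n r - N` free entries
      Nat.card I.Free + D.centDim = μ.card * μ.rowLen 0 ∧
      ∀ e : I.Free ≃ Fin (paramDim μ D),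
        IsOpen (I.dom e) ∧ BijOn (I.nu e) (I.dom e) I.reducedSet ∧
        -- `ψ` is a diffeomorphism onto an open subset of the orbit space
        (∃ (hW : IsOpen (I.dom e)) (hV : IsOpen I.orbits),
          ∀ cs : ChartedSpace (Param μ D) (OrbitSpace μ D.mat),
            IsOrbitManifold μ D.mat (Param μ D) cs →
            ∃ Φ : Diffeomorph 𝓘(ℝ, Param μ D) 𝓘(ℝ, Param μ D)
                (⟨I.dom e, hW⟩ : TopologicalSpace.Opens (Param μ D))
                (⟨I.orbits, hV⟩ : TopologicalSpace.Opens (OrbitSpace μ D.mat)) ∞,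
              ∀ x : I.dom e, (Φ x : OrbitSpace μ D.mat) = I.psi e x) ∧
        -- `φ ∘ ψ` is a diffeomorphism onto an open subset of the feedback matrices for `(F, G₁)`
        IsOpenSubset (phi μ D.mat '' I.orbits)
          (feedbackSet (brunovskyF μ) (brunovskyG μ) D.mat) ∧
        IsDiffeoOnto (I.alpha e) (I.dom e) (phi μ D.mat '' I.orbits) ∧
        -- the same for `(F, G)`, where `G = [G₁ 0]`
        IsOpenSubset ((fun K : Matrix (Fin (μ.rowLen 0)) (Cell μ) ℝ × Matrix (Fin l) (Cell μ) ℝ =>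
            Matrix.fromRows K.1 K.2) '' ((phi μ D.mat '' I.orbits) ×ˢ univ))
          (feedbackSet (brunovskyF μ) (brunovskyGFull μ l) D.mat) ∧
        IsDiffeoOnto
          (fun x : Param μ D × Matrix (Fin l) (Cell μ) ℝ => Matrix.fromRows (I.alpha e x.1) x.2)
          (I.dom e ×ˢ univ)
          ((fun K : Matrix (Fin (μ.rowLen 0)) (Cell μ) ℝ × Matrix (Fin l) (Cell μ) ℝ =>
            Matrix.fromRows K.1 K.2) '' ((phi μ D.mat '' I.orbits) ×ˢ univ))) ∧
    -- these local parametrizations cover the orbit space and the sets of feedback matrices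
    (⋃ I : MultiIndex D (μ.rowLen 0), I.orbits) = univ ∧
    (⋃ I : MultiIndex D (μ.rowLen 0), phi μ D.mat '' I.orbits) =
      feedbackSet (brunovskyF μ) (brunovskyG μ) D.mat ∧
    (⋃ I : MultiIndex D (μ.rowLen 0),
      (fun K : Matrix (Fin (μ.rowLen 0)) (Cell μ) ℝ × Matrix (Fin l) (Cell μ) ℝ =>
        Matrix.fromRows K.1 K.2) '' ((phi μ D.mat '' I.orbits) ×ˢ univ)) =
      feedbackSet (brunovskyF μ) (brunovskyGFull μ l) D.mat := by
  refine ⟨⟨t2Space_orbitSpace hn, secondCountable_orbitSpace hn, exists_isOrbitManifold hn⟩,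
    fun I => ⟨?_, fun e => ?_⟩, iUnion_orbits μ D, iUnion_phi_image hn, ?_⟩
  · rw [I.card_free_add, hn, mul_comm]
  · rw [fromRows_image_eq, ← toRows₁_preimage_feedbackSet]
    exact ⟨I.isOpen_dom e, I.bijOn_nu e, ⟨I.isOpen_dom e, I.isOpen_orbits e hn,
      fun cs h => I.exists_diffeomorph e hn _ _ h⟩, I.isOpenSubset_phi_image e hn,
      I.isDiffeoOnto_alpha e hn, (I.isOpenSubset_phi_image e hn).preimage_toRows₁,
      (I.isDiffeoOnto_alpha e hn).fromRows⟩
  · simp only [fromRows_image_eq]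
    rw [← preimage_iUnion, iUnion_phi_image hn, toRows₁_preimage_feedbackSet]
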